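/- **Notation.** Let $\widehat D=\varinjlim_m \mathbb C[t^{\pm 1/m}]$ with the derivation $\delta_t=\frac{d}{dt}$, put $\delta_t^{(j)}=\delta_t^j/j!$ and $\widehat{\mathcal D}=(\widehat D,\delta_t)$. For $M=\begin{pmatrix}u_{11}&u_{12}\\u_{21}&u_{22}\end{pmatrix}$ put $M^\dagger=\begin{pmatrix}-u_{22}&u_{12}\\u_{21}&-u_{11}\end{pmatrix}$. **The large $N=4$ conformal superalgebra $\mathcal A$.** Let $V=V_{\bar 0}\oplus V_{\bar 1}$, where $V_{\bar0}=\mathbb C\mathrm L\oplus \mathrm T^+(\mathfrak{sl}_2(\mathbb C))\oplus \mathrm T^-(\mathfrak{sl}_2(\mathbb C))\oplus\mathbb C\mathrm U$ and $V_{\bar1}=\mathrm G(\mathbb C^{2\times2})\oplus \mathrm Q(\mathbb C^{2\times2})$, with $\mathrm T^{\pm},\mathrm G,\mathrm Q$ injective linear maps. Then $\mathcal A=\mathbb C[\partial]\otimes_{\mathbb C} V$, with products $a_{(n)}b$ ($n\ge0$) encoded by the $\lambda$-bracket $[a_\lambda b]=\sum_{j\ge 0}\frac{\lambda^j}{j!}a_{(j)}b$.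 It is determined by sesquilinearity, $[\partial a_\lambda b]=-\lambda[a_\lambda b]$ and $[a_\lambda\partial b]=(\partial+\lambda)[a_\lambda b]$, by skew-symmetry, $[b_\lambda a]=-(-1)^{p(a)p(b)}[a_{-\lambda-\partial}b]$, and by $$[\mathrm L_\lambda\mathrm L]=(\partial+2\lambda)\mathrm L,\quad [\mathrm L_\lambda\mathrm U]=(\partial+\lambda)\mathrm U,\quad [\mathrm L_\lambda\mathrm T^\pm(X)]=(\partial+\lambda)\mathrm T^\pm(X),$$ $$[\mathrm L_\lambda\mathrm G(M)]=(\partial+\tfrac32\lambda)\mathrm G(M),\quad [\mathrm L_\lambda\mathrm Q(M)]=(\partial+\tfrac12\lambda)\mathrm Q(M),$$ $$[\mathrm T^\pm(X)_\lambda\mathrm T^\pm(Y)]=\mathrm T^\pm([X,Y]),\quad [\mathrm T^+(X)_\lambda\mathrm T^-(Y)]=[\mathrm T^\pm(X)_\lambda\mathrm U]=[\mathrm U_\lambda\mathrm U]=0,$$ $$[\mathrm U_\lambda\mathrm G(M)]=\lambda\mathrm Q(M),\quad [\mathrm U_\lambda\mathrm Q(M)]=[\mathrm Q(M)_\lambda\mathrm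 Q(N)]=0,$$ $$[\mathrm T^+(X)_\lambda\mathrm G(M)]=\mathrm G(XM)-\lambda\mathrm Q(XM),\quad [\mathrm T^+(X)_\lambda\mathrm Q(M)]=\mathrm Q(XM),$$ $$[\mathrm T^-(X)_\lambda\mathrm G(M)]=-\mathrm G(MX)-\lambda\mathrm Q(MX),\quad [\mathrm T^-(X)_\lambda\mathrm Q(M)]=-\mathrm Q(MX),$$ $$[\mathrm G(M)_\lambda\mathrm G(N)]=4\,\mathrm{tr}(MN^\dagger)\mathrm L+(\partial+2\lambda)\big(\mathrm T^+(MN^\dagger-NM^\dagger)+\mathrm T^-(M^\dagger N-N^\dagger M)\big),$$ $$[\mathrm Q(M)_\lambda\mathrm G(N)]=2\,\mathrm{tr}(MN^\dagger)\mathrm U-\mathrm T^+(MN^\dagger-NM^\dagger)+\mathrm T^-(M^\dagger N-N^\dagger M).$$ **The differential conformal superalgebra.** On the $\widehat D$-module $\mathcal A_{\widehat{\mathcal D}}=\mathcal A\otimes_{\mathbb C}\widehat D$ put $\widehat\partial(a\otimes f)=\partial a\otimes f+a\otimes\delta_t(f)$ and $$(a\otimes f)_{(n)}(b\otimes g)=\sum_{j\ge0}(a_{(n+j)}b)\otimes\delta_t^{(j)}(f)g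 .$$ Let $\mathrm{Aut}_{\widehat{\mathcal D}\text{-conf}}(\mathcal A_{\widehat{\mathcal D}})$ be the group of all $\widehat D$-linear bijections of $\mathcal A_{\widehat{\mathcal D}}$ that preserve the $\mathbb Z/2\mathbb Z$-grading, commute with $\widehat\partial$ and preserve all $n$-products. The maps $\mathrm T^\pm,\mathrm G,\mathrm Q$ are extended $\widehat D$-linearly to matrices over $\widehat D$. **Theorem.** For $A,B\in\mathbf{SL}_2(\widehat D)$ and $f\in\widehat D$ there are unique elements $\theta_{A,B},\tau_f,\omega$ of $\mathrm{Aut}_{\widehat{\mathcal D}\text{-conf}}(\mathcal A_{\widehat{\mathcal D}})$ such that, for all $X\in\mathfrak{sl}_2(\mathbb C)$ and $M\in\mathbb C^{2\times2}$, * $\theta_{A,B}(\mathrm L)=\mathrm L+\mathrm T^+(\delta_t(A)A^{-1})+\mathrm T^-(\delta_t(B)B^{-1})$, $\theta_{A,B}(\mathrm U)=\mathrm U$, $\theta_{A,B}(\mathrm T^+(X))=\mathrm T^+(AXA^{-1})$, $\theta_{A,B}(\mathrm T^-(X))=\mathrm T^-(BXB^{-1})$, $\theta_{A,B}(\mathrm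 G(M))=\mathrm G(AMB^{-1})-\mathrm Q(\delta_t(A)MB^{-1}-AM\delta_t(B^{-1}))$, $\theta_{A,B}(\mathrm Q(M))=\mathrm Q(AMB^{-1})$; * $\tau_f(\mathrm L)=\mathrm L+\mathrm U\otimes f$, $\tau_f(\mathrm G(M))=\mathrm G(M)+\mathrm Q(fM)$, and $\tau_f$ fixes $\mathrm U$, $\mathrm T^\pm(X)$ and $\mathrm Q(M)$; * $\omega(\mathrm L)=\mathrm L$, $\omega(\mathrm U)=-\mathrm U$, $\omega(\mathrm T^\pm(X))=\mathrm T^\mp(X)$, $\omega(\mathrm G(M))=\mathrm G(M^\dagger)$, $\omega(\mathrm Q(M))=-\mathrm Q(M^\dagger)$. These automorphisms generate $\mathrm{Aut}_{\widehat{\mathcal D}\text{-conf}}(\mathcal A_{\widehat{\mathcal D}})$, and there is a group isomorphism $$\left(\frac{\mathbf{SL}_2(\widehat D)\times\mathbf{SL}_2(\widehat D)}{\langle(-I_2,-I_2)\rangle}\times\mathbf G_a(\widehat D)\right)\rtimes\mathbb Z/2\mathbb Z\;\cong\;\mathrm{Aut}_{\widehat{\mathcal D}\text{-conf}}(\mathcal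 A_{\widehat{\mathcal D}})$$ that sends the class of $(A,B)$ to $\theta_{A,B}$, $f\in\mathbf G_a(\widehat D)$ to $\tau_f$ and the generator of $\mathbb Z/2\mathbb Z$ to $\omega$; here the generator of $\mathbb Z/2\mathbb Z$ acts by $([A,B],f)\mapsto([B,A],-f)$. -/

import Mathlib

open scoped TensorProduct Polynomial

noncomputable section

set_option linter.unusedSimpArgs false
set_option linter.unusedTactic false
set_option linter.unreachableTactic false

namespace LargeN4

/-! ### The differential ring `(D̂, d/dt)` -/

/-- The ring `D̂ = lim C[t^{±1/m}]`: the group algebra of `(ℚ, +)` over `ℂ`. The basis vector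
`single q 1` is `t ^ q`. The lemmas `rootEmb_injective`, `rootEmb_root`, `exists_mem_range_rootEmb`
and `rootEmb_range_le` exhibit it as the increasing union of its subrings `ℂ[t^{±1/m}]`. -/
abbrev Dhat : Type := AddMonoidAlgebra ℂ ℚ

/-- The power `t ^ q`. -/
def tpow (q : ℚ) : Dhat := AddMonoidAlgebra.single q 1

/-- The inclusion of `ℂ[t^{±1/m}]`, a Laurent polynomial ring in the variable `T = t^{1/m}`. -/
def rootEmb (m : ℕ) : LaurentPolynomial ℂ →ₐ[ℂ] Dhat :=
  AddMonoidAlgebra.mapDomainAlgHom ℂ ℂ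
    ((AddMonoidHom.mulRight ((m : ℚ)⁻¹)).comp (Int.castAddHom ℚ))

lemma rootEmb_single (m : ℕ) (k : ℤ) (c : ℂ) :
    rootEmb m (AddMonoidAlgebra.single k c) = AddMonoidAlgebra.single ((k : ℚ) * (m : ℚ)⁻¹) c := by
  change AddMonoidAlgebra.mapDomain _ (AddMonoidAlgebra.single k c) = _
  rw [AddMonoidAlgebra.mapDomain_single]
  simp

lemma rootEmb_root (m : ℕ) : rootEmb m (LaurentPolynomial.T 1) = tpow (1 / m) := by
  rw [LaurentPolynomial.T, rootEmb_single]; simp [tpow]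

lemma rootEmb_injective (m : ℕ) (hm : 0 < m) : Function.Injective (rootEmb m) := by
  apply AddMonoidAlgebra.mapDomain_injective
  intro a b h
  have hm' : (m : ℚ) ≠ 0 := by positivity
  simpa [hm'] using h

lemma rootEmb_range_le (m k : ℕ) (hk : 0 < k) : (rootEmb m).range ≤ (rootEmb (m * k)).range := by
  rintro _ ⟨g, rfl⟩
  change rootEmb m g ∈ _
  induction g using AddMonoidAlgebra.induction_linear with
  | zero => simp
  | add f g hf hg => rw [map_add]; exact add_mem hf hg
  | single a c =>
    refine ⟨AddMonoidAlgebra.single (a * k) c, ?_⟩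
    change rootEmb _ _ = _
    have hk' : (k : ℚ) ≠ 0 := by positivity
    rw [rootEmb_single, rootEmb_single]
    congr 1
    push_cast
    rw [mul_inv]
    field_simp

lemma exists_mem_range_rootEmb (f : Dhat) : ∃ m : ℕ, 0 < m ∧ f ∈ (rootEmb m).range := by
  induction f using AddMonoidAlgebra.induction_linear with
  | zero => exact ⟨1, one_pos, zero_mem _⟩
  | add f g hf hg =>
    obtain ⟨m, hm, hf⟩ := hf
    obtain ⟨n, hn, hg⟩ := hg
    exact ⟨m * n, Nat.mul_pos hm hn, add_mem (rootEmb_range_le m n hn hf)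
      (by rw [mul_comm]; exact rootEmb_range_le n m hm hg)⟩
  | single q c =>
    refine ⟨q.den, q.den_pos, AddMonoidAlgebra.single q.num c, ?_⟩
    change rootEmb _ _ = _
    rw [rootEmb_single, ← div_eq_mul_inv, Rat.num_div_den]

/-- The `ℂ`-linear map `t ^ q ↦ q t ^ (q - 1)`. -/
def deltaLin : Dhat →ₗ[ℂ] Dhat :=
  (Finsupp.lsum ℂ fun q : ℚ =>
      (q : ℂ) • (AddMonoidAlgebra.lsingle (q - 1) : ℂ →ₗ[ℂ] Dhat)) ∘ₗ
    (AddMonoidAlgebra.coeffLinearEquiv ℂ).toLinearMap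

lemma deltaLin_single (q : ℚ) (c : ℂ) :
    deltaLin (AddMonoidAlgebra.single q c) = AddMonoidAlgebra.single (q - 1) (q * c) := by
  simp [deltaLin, AddMonoidAlgebra.coeffLinearEquiv]

lemma deltaLin_mul (f g : Dhat) : deltaLin (f * g) = f * deltaLin g + g * deltaLin f := by
  induction f using AddMonoidAlgebra.induction_linear with
  | zero => simp
  | add f₁ f₂ h₁ h₂ => rw [add_mul, map_add, h₁, h₂, map_add]; ring
  | single q c =>
    induction g using AddMonoidAlgebra.induction_linear with
    | zero => simp
    | add g₁ g₂ h₁ h₂ => rw [mul_add, map_add, h₁, h₂, map_add]; ring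
    | single r d =>
      simp only [AddMonoidAlgebra.single_mul_single, deltaLin_single]
      rw [show q + (r - 1) = q + r - 1 by ring, show r + (q - 1) = q + r - 1 by ring,
        ← AddMonoidAlgebra.single_add]
      congr 1
      push_cast
      ring

/-- The derivation `δ_t = d/dt` of `D̂`. -/
def delta : Derivation ℂ Dhat Dhat :=
  Derivation.mk' deltaLin fun f g => by simpa only [smul_eq_mul] using deltaLin_mul f g

lemma delta_tpow (q : ℚ) : delta (tpow q) = (q : ℂ) • tpow (q - 1) := by
  change deltaLin _ = _
  rw [tpow, deltaLin_single]; simp [tpow]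

/-- The divided power `δ_t^{(j)} = δ_t^j / j!`. -/
def dividedDelta (j : ℕ) : Dhat →ₗ[ℂ] Dhat :=
  ((j.factorial : ℂ)⁻¹) • ((delta : Dhat →ₗ[ℂ] Dhat) ^ j)

/-! ### The large `N = 4` conformal superalgebra `𝒜` -/

/-- `2 × 2` complex matrices. -/
abbrev M2 : Type := Matrix (Fin 2) (Fin 2) ℂ

/-- `sl₂(ℂ)`. -/
abbrev sl2 : Type := LieAlgebra.SpecialLinear.sl (Fin 2) ℂ

/-- The space of generators. The tuple `(ℓ, c, X, Y, M, N)` is the vector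
`ℓ L + c U + T⁺(X) + T⁻(Y) + G(M) + Q(N)`. -/
abbrev V : Type := ℂ × ℂ × sl2 × sl2 × M2 × M2

/-- `M ↦ M†`. -/
def dag {R : Type*} [CommRing R] (M : Matrix (Fin 2) (Fin 2) R) : Matrix (Fin 2) (Fin 2) R :=
  !![-(M 1 1), M 0 1; M 1 0, -(M 0 0)]

/-- `M N† - N M†`, a matrix of trace zero. -/
def skewR (M N : M2) : sl2 :=
  ⟨M * dag N - N * dag M, by
    change Matrix.trace (_ : M2) = 0
    simp [Matrix.trace_fin_two, Matrix.mul_apply, Fin.sum_univ_two, dag, Matrix.vecMul, dotProduct]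
    ring⟩

/-- `M† N - N† M`, a matrix of trace zero. -/
def skewL (M N : M2) : sl2 :=
  ⟨dag M * N - dag N * M, by
    change Matrix.trace (_ : M2) = 0
    simp [Matrix.trace_fin_two, Matrix.mul_apply, Fin.sum_univ_two, dag, Matrix.vecMul, dotProduct]
    ring⟩

lemma dag_add (M N : M2) : dag (M + N) = dag M + dag N := by
  ext i j; fin_cases i <;> fin_cases j <;> simp [dag] <;> ring

lemma dag_smul (r : ℂ) (M : M2) : dag (r • M) = r • dag M := by
  ext i j; fin_cases i <;> fin_cases j <;> simp [dag]

lemma skewR_add_left (M M' N : M2) : skewR (M + M') N = skewR M N + skewR M' N := by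
  apply Subtype.ext
  change (_ : M2) = (_ : M2) + (_ : M2)
  simp only [skewR, dag_add, Matrix.add_mul, Matrix.mul_add]; abel

lemma skewR_add_right (M N N' : M2) : skewR M (N + N') = skewR M N + skewR M N' := by
  apply Subtype.ext
  change (_ : M2) = (_ : M2) + (_ : M2)
  simp only [skewR, dag_add, Matrix.add_mul, Matrix.mul_add]; abel

lemma skewR_smul_left (r : ℂ) (M N : M2) : skewR (r • M) N = r • skewR M N := by
  apply Subtype.ext
  simp [skewR, dag_smul, smul_sub]

lemma skewR_smul_right (r : ℂ) (M N : M2) : skewR M (r • N) = r • skewR M N := by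
  apply Subtype.ext
  simp [skewR, dag_smul, smul_sub]

lemma skewL_add_left (M M' N : M2) : skewL (M + M') N = skewL M N + skewL M' N := by
  apply Subtype.ext
  change (_ : M2) = (_ : M2) + (_ : M2)
  simp only [skewL, dag_add, Matrix.add_mul, Matrix.mul_add]; abel

lemma skewL_add_right (M N N' : M2) : skewL M (N + N') = skewL M N + skewL M N' := by
  apply Subtype.ext
  change (_ : M2) = (_ : M2) + (_ : M2)
  simp only [skewL, dag_add, Matrix.add_mul, Matrix.mul_add]; abel

lemma skewL_smul_left (r : ℂ) (M N : M2) : skewL (r • M) N = r • skewL M N := by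
  apply Subtype.ext
  simp [skewL, dag_smul, smul_sub]

lemma skewL_smul_right (r : ℂ) (M N : M2) : skewL M (r • N) = r • skewL M N := by
  apply Subtype.ext
  simp [skewL, dag_smul, smul_sub]

/-- The terms without `∂` and `λ` in the `λ`-brackets of two generators. -/
def brConstFun : V → V → V
  | (_, _, X, Y, M, N), (_, _, X', Y', M', N') =>
    (4 * (M * dag M').trace,
      2 * (N * dag M').trace + 2 * (N' * dag M).trace,
      ⁅X, X'⁆ - skewR N M' - skewR N' M,
      ⁅Y, Y'⁆ + skewL N M' + skewL N' M,
      X.1 * M' - M' * Y.1 - X'.1 * M + M * Y'.1,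
      X.1 * N' - N' * Y.1 - X'.1 * N + N * Y'.1)

/-- `brConstFun` as a bilinear map. -/
def brConst : V →ₗ[ℂ] V →ₗ[ℂ] V :=
  LinearMap.mk₂ ℂ brConstFun
    (by
      rintro ⟨l, c, X, Y, M, N⟩ ⟨l₂, c₂, X₂, Y₂, M₂, N₂⟩ ⟨l', c', X', Y', M', N'⟩
      refine Prod.ext ?_ (Prod.ext ?_ (Prod.ext ?_ (Prod.ext ?_ (Prod.ext ?_ ?_)))) <;>
      simp [brConstFun, dag_add, dag_smul, skewR_add_left, skewR_add_right, skewR_smul_left, skewR_smul_right,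
        skewL_add_left, skewL_add_right, skewL_smul_left, skewL_smul_right, Matrix.add_mul,
        Matrix.mul_add, smul_sub, smul_add] <;> first | ring1 | module)
    (by
      rintro r ⟨l, c, X, Y, M, N⟩ ⟨l', c', X', Y', M', N'⟩
      refine Prod.ext ?_ (Prod.ext ?_ (Prod.ext ?_ (Prod.ext ?_ (Prod.ext ?_ ?_)))) <;>
      simp [brConstFun, dag_add, dag_smul, skewR_add_left, skewR_add_right, skewR_smul_left, skewR_smul_right,
        skewL_add_left, skewL_add_right, skewL_smul_left, skewL_smul_right, Matrix.add_mul,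
        Matrix.mul_add, smul_sub, smul_add] <;> first | ring1 | module)
    (by
      rintro ⟨l', c', X', Y', M', N'⟩ ⟨l, c, X, Y, M, N⟩ ⟨l₂, c₂, X₂, Y₂, M₂, N₂⟩
      refine Prod.ext ?_ (Prod.ext ?_ (Prod.ext ?_ (Prod.ext ?_ (Prod.ext ?_ ?_)))) <;>
      simp [brConstFun, dag_add, dag_smul, skewR_add_left, skewR_add_right, skewR_smul_left, skewR_smul_right,
        skewL_add_left, skewL_add_right, skewL_smul_left, skewL_smul_right, Matrix.add_mul,
        Matrix.mul_add, smul_sub, smul_add] <;> first | ring1 | module)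
    (by
      rintro r ⟨l, c, X, Y, M, N⟩ ⟨l', c', X', Y', M', N'⟩
      refine Prod.ext ?_ (Prod.ext ?_ (Prod.ext ?_ (Prod.ext ?_ (Prod.ext ?_ ?_)))) <;>
      simp [brConstFun, dag_add, dag_smul, skewR_add_left, skewR_add_right, skewR_smul_left, skewR_smul_right,
        skewL_add_left, skewL_add_right, skewL_smul_left, skewL_smul_right, Matrix.add_mul,
        Matrix.mul_add, smul_sub, smul_add] <;> first | ring1 | module)

/-- The coefficient of `∂` in the `λ`-brackets of two generators. -/
def brPartialFun : V → V → V
  | (l, _, _, _, M, N), (l', c', X', Y', M', N') =>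
    (l * l',
      l * c',
      l • X' + skewR M M',
      l • Y' + skewL M M',
      l • M' + (1 / 2 * l') • M,
      l • N' - (1 / 2 * l') • N + c' • M - X'.1 * M - M * Y'.1)

/-- `brPartialFun` as a bilinear map. -/
def brPartial : V →ₗ[ℂ] V →ₗ[ℂ] V :=
  LinearMap.mk₂ ℂ brPartialFun
    (by
      rintro ⟨l, c, X, Y, M, N⟩ ⟨l₂, c₂, X₂, Y₂, M₂, N₂⟩ ⟨l', c', X', Y', M', N'⟩
      refine Prod.ext ?_ (Prod.ext ?_ (Prod.ext ?_ (Prod.ext ?_ (Prod.ext ?_ ?_)))) <;>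
      simp [brPartialFun, dag_add, dag_smul, skewR_add_left, skewR_add_right, skewR_smul_left, skewR_smul_right,
        skewL_add_left, skewL_add_right, skewL_smul_left, skewL_smul_right, Matrix.add_mul,
        Matrix.mul_add, smul_sub, smul_add] <;> first | ring1 | module)
    (by
      rintro r ⟨l, c, X, Y, M, N⟩ ⟨l', c', X', Y', M', N'⟩
      refine Prod.ext ?_ (Prod.ext ?_ (Prod.ext ?_ (Prod.ext ?_ (Prod.ext ?_ ?_)))) <;>
      simp [brPartialFun, dag_add, dag_smul, skewR_add_left, skewR_add_right, skewR_smul_left, skewR_smul_right,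
        skewL_add_left, skewL_add_right, skewL_smul_left, skewL_smul_right, Matrix.add_mul,
        Matrix.mul_add, smul_sub, smul_add] <;> first | ring1 | module)
    (by
      rintro ⟨l', c', X', Y', M', N'⟩ ⟨l, c, X, Y, M, N⟩ ⟨l₂, c₂, X₂, Y₂, M₂, N₂⟩
      refine Prod.ext ?_ (Prod.ext ?_ (Prod.ext ?_ (Prod.ext ?_ (Prod.ext ?_ ?_)))) <;>
      simp [brPartialFun, dag_add, dag_smul, skewR_add_left, skewR_add_right, skewR_smul_left, skewR_smul_right,
        skewL_add_left, skewL_add_right, skewL_smul_left, skewL_smul_right, Matrix.add_mul,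
        Matrix.mul_add, smul_sub, smul_add] <;> first | ring1 | module)
    (by
      rintro r ⟨l, c, X, Y, M, N⟩ ⟨l', c', X', Y', M', N'⟩
      refine Prod.ext ?_ (Prod.ext ?_ (Prod.ext ?_ (Prod.ext ?_ (Prod.ext ?_ ?_)))) <;>
      simp [brPartialFun, dag_add, dag_smul, skewR_add_left, skewR_add_right, skewR_smul_left, skewR_smul_right,
        skewL_add_left, skewL_add_right, skewL_smul_left, skewL_smul_right, Matrix.add_mul,
        Matrix.mul_add, smul_sub, smul_add] <;> first | ring1 | module)

/-- The coefficient of `λ` in the `λ`-brackets of two generators. -/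
def brLambdaFun : V → V → V
  | (l, c, X, Y, M, N), (l', c', X', Y', M', N') =>
    (2 * l * l',
      l * c' + l' * c,
      l • X' + l' • X + (2 : ℂ) • skewR M M',
      l • Y' + l' • Y + (2 : ℂ) • skewL M M',
      (3 / 2 * l) • M' + (3 / 2 * l') • M,
      (1 / 2 * l) • N' + (1 / 2 * l') • N + c • M' + c' • M
        - X.1 * M' - M' * Y.1 - X'.1 * M - M * Y'.1)

/-- `brLambdaFun` as a bilinear map. -/
def brLambda : V →ₗ[ℂ] V →ₗ[ℂ] V :=
  LinearMap.mk₂ ℂ brLambdaFun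
    (by
      rintro ⟨l, c, X, Y, M, N⟩ ⟨l₂, c₂, X₂, Y₂, M₂, N₂⟩ ⟨l', c', X', Y', M', N'⟩
      refine Prod.ext ?_ (Prod.ext ?_ (Prod.ext ?_ (Prod.ext ?_ (Prod.ext ?_ ?_)))) <;>
      simp [brLambdaFun, dag_add, dag_smul, skewR_add_left, skewR_add_right, skewR_smul_left, skewR_smul_right,
        skewL_add_left, skewL_add_right, skewL_smul_left, skewL_smul_right, Matrix.add_mul,
        Matrix.mul_add, smul_sub, smul_add] <;> first | ring1 | module)
    (by
      rintro r ⟨l, c, X, Y, M, N⟩ ⟨l', c', X', Y', M', N'⟩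
      refine Prod.ext ?_ (Prod.ext ?_ (Prod.ext ?_ (Prod.ext ?_ (Prod.ext ?_ ?_)))) <;>
      simp [brLambdaFun, dag_add, dag_smul, skewR_add_left, skewR_add_right, skewR_smul_left, skewR_smul_right,
        skewL_add_left, skewL_add_right, skewL_smul_left, skewL_smul_right, Matrix.add_mul,
        Matrix.mul_add, smul_sub, smul_add] <;> first | ring1 | module)
    (by
      rintro ⟨l', c', X', Y', M', N'⟩ ⟨l, c, X, Y, M, N⟩ ⟨l₂, c₂, X₂, Y₂, M₂, N₂⟩
      refine Prod.ext ?_ (Prod.ext ?_ (Prod.ext ?_ (Prod.ext ?_ (Prod.ext ?_ ?_)))) <;>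
      simp [brLambdaFun, dag_add, dag_smul, skewR_add_left, skewR_add_right, skewR_smul_left, skewR_smul_right,
        skewL_add_left, skewL_add_right, skewL_smul_left, skewL_smul_right, Matrix.add_mul,
        Matrix.mul_add, smul_sub, smul_add] <;> first | ring1 | module)
    (by
      rintro r ⟨l, c, X, Y, M, N⟩ ⟨l', c', X', Y', M', N'⟩
      refine Prod.ext ?_ (Prod.ext ?_ (Prod.ext ?_ (Prod.ext ?_ (Prod.ext ?_ ?_)))) <;>
      simp [brLambdaFun, dag_add, dag_smul, skewR_add_left, skewR_add_right, skewR_smul_left, skewR_smul_right,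
        skewL_add_left, skewL_add_right, skewL_smul_left, skewL_smul_right, Matrix.add_mul,
        Matrix.mul_add, smul_sub, smul_add] <;> first | ring1 | module)

/-- The `ℂ[∂]`-module `𝒜 = ℂ[∂] ⊗ V`. -/
abbrev A : Type := ℂ[X] ⊗[ℂ] V

/-- The operator `∂` of `𝒜`. -/
def partialA : A →ₗ[ℂ] A := TensorProduct.map (LinearMap.mulLeft ℂ Polynomial.X) LinearMap.id

/-- The variable `∂` of `ℂ[∂][λ]`. -/
def dVar : ℂ[X][X] := Polynomial.C Polynomial.X

/-- The variable `λ` of `ℂ[∂][λ]`. -/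
def lVar : ℂ[X][X] := Polynomial.X

/-- The bilinear map `(p, q) ↦ p(-λ) q(∂ + λ)`. -/
def sesqui : ℂ[X] →ₗ[ℂ] ℂ[X] →ₗ[ℂ] ℂ[X][X] :=
  (LinearMap.mul ℂ ℂ[X][X]).compl₁₂ (Polynomial.aeval (-lVar)).toLinearMap
    (Polynomial.aeval (dVar + lVar)).toLinearMap

/-- The `λ`-bracket of `𝒜`, with values in `ℂ[∂][λ] ⊗ V = 𝒜[λ]`: it is determined by
`[p(∂)u _λ q(∂)v] = p(-λ) q(∂ + λ) [u _λ v]` and its values on `u, v ∈ V`. -/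
def lambdaBracket : A →ₗ[ℂ] A →ₗ[ℂ] ℂ[X][X] ⊗[ℂ] V :=
  TensorProduct.map₂ sesqui brConst
    + TensorProduct.map₂ (sesqui.compr₂ (LinearMap.mulLeft ℂ dVar)) brPartial
    + TensorProduct.map₂ (sesqui.compr₂ (LinearMap.mulLeft ℂ lVar)) brLambda

/-- The coefficient of `λ ^ n` of an element of `𝒜[λ]`. -/
def lambdaCoeff (n : ℕ) : ℂ[X][X] ⊗[ℂ] V →ₗ[ℂ] A :=
  TensorProduct.map ((Polynomial.lcoeff ℂ[X] n).restrictScalars ℂ) LinearMap.id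

/-- The product `a _(n) b` of `𝒜`; thus `[a _λ b] = ∑ j, λ ^ j / j! a _(j) b`. -/
def nprod (n : ℕ) : A →ₗ[ℂ] A →ₗ[ℂ] A :=
  (n.factorial : ℂ) • lambdaBracket.compr₂ (lambdaCoeff n)

/-! ### The differential conformal superalgebra `𝒜 ⊗ D̂` over `(D̂, d/dt)` -/

/-- `𝒜 ⊗ D̂`, with the factor `D̂` written on the left. -/
abbrev Ahat : Type := Dhat ⊗[ℂ] A

/-- `∂̂ (a ⊗ f) = ∂ a ⊗ f + a ⊗ δ_t f`. -/
def partialHat : Ahat →ₗ[ℂ] Ahat :=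
  TensorProduct.map LinearMap.id partialA + TensorProduct.map (delta : Dhat →ₗ[ℂ] Dhat) LinearMap.id

/-- The `j`-th summand `(a ⊗ f, b ⊗ g) ↦ (a _(n + j) b) ⊗ δ_t^{(j)}(f) g` of the `n`-th product. -/
def nprodTerm (n j : ℕ) : Ahat →ₗ[ℂ] Ahat →ₗ[ℂ] Ahat :=
  TensorProduct.map₂ ((LinearMap.mul ℂ Dhat).comp (dividedDelta j)) (nprod (n + j))

/-- The `n`-th product of `𝒜 ⊗ D̂`,
`(a ⊗ f) _(n) (b ⊗ g) = ∑ j, (a _(n + j) b) ⊗ δ_t^{(j)}(f) g`.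
The sum is finite by `nprodTerm_finite`. -/
def nprodHat (n : ℕ) (x y : Ahat) : Ahat := ∑ᶠ j : ℕ, nprodTerm n j x y

lemma lambdaCoeff_finite (z : ℂ[X][X] ⊗[ℂ] V) : {n : ℕ | lambdaCoeff n z ≠ 0}.Finite := by
  induction z using TensorProduct.induction_on with
  | zero => simp
  | add x y hx hy =>
    refine (hx.union hy).subset fun n hn => ?_
    by_contra h
    simp only [Set.mem_union, Set.mem_ofPred_eq, not_or, not_not] at h
    exact hn (by rw [map_add, h.1, h.2, add_zero])
  | tmul p v =>
    refine (p.support.finite_toSet).subset fun n hn => ?_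
    by_contra h
    have h' : p.coeff n = 0 := by simpa using h
    exact hn (by simp [lambdaCoeff, h'])

lemma nprod_finite (a b : A) : {n : ℕ | nprod n a b ≠ 0}.Finite := by
  refine (lambdaCoeff_finite (lambdaBracket a b)).subset fun n hn h => hn ?_
  simp [nprod, h]

lemma nprodTerm_finite (n : ℕ) (x y : Ahat) : {j : ℕ | nprodTerm n j x y ≠ 0}.Finite := by
  induction x using TensorProduct.induction_on with
  | zero => simp
  | add x₁ x₂ h₁ h₂ =>
    refine (h₁.union h₂).subset fun j hj => ?_
    by_contra h
    simp only [Set.mem_union, Set.mem_ofPred_eq, not_or, not_not] at h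
    exact hj (by rw [map_add, LinearMap.add_apply, h.1, h.2, add_zero])
  | tmul f a =>
    induction y using TensorProduct.induction_on with
    | zero => simp
    | add y₁ y₂ h₁ h₂ =>
      refine (h₁.union h₂).subset fun j hj => ?_
      by_contra h
      simp only [Set.mem_union, Set.mem_ofPred_eq, not_or, not_not] at h
      exact hj (by rw [map_add, h.1, h.2, add_zero])
    | tmul g b =>
      refine ((nprod_finite a b).preimage (f := fun j => n + j) ?_).subset fun j hj h => hj ?_
      · intro i _ j _ h
        simpa using h
      · simp only [nprodTerm, TensorProduct.map₂_apply_tmul, TensorProduct.map_tmul]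
        exact (congrArg _ h).trans (TensorProduct.tmul_zero _ _)

/-- The subspace `V_0` of `V` spanned by `L`, `U` and the `T^±(X)`. -/
def Veven : Submodule ℂ V where
  carrier := {v | v.2.2.2.2.1 = 0 ∧ v.2.2.2.2.2 = 0}
  zero_mem' := ⟨rfl, rfl⟩
  add_mem' := fun h h' => ⟨by simp [h.1, h'.1], by simp [h.2, h'.2]⟩
  smul_mem' := fun r _ h => ⟨by simp [h.1], by simp [h.2]⟩

/-- The subspace `V_1` of `V` spanned by the `G(M)` and the `Q(M)`. -/
def Vodd : Submodule ℂ V where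
  carrier := {v | v.1 = 0 ∧ v.2.1 = 0 ∧ v.2.2.1 = 0 ∧ v.2.2.2.1 = 0}
  zero_mem' := ⟨rfl, rfl, rfl, rfl⟩
  add_mem' := fun h h' => ⟨by simp [h.1, h'.1], by simp [h.2.1, h'.2.1],
    by simp [h.2.2.1, h'.2.2.1], by simp [h.2.2.2, h'.2.2.2]⟩
  smul_mem' := fun r _ h => ⟨by simp [h.1], by simp [h.2.1], by simp [h.2.2.1], by simp [h.2.2.2]⟩

/-- For `W ⊆ V`, the subspace `(ℂ[∂] ⊗ W) ⊗ D̂` of `𝒜 ⊗ D̂`. -/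
def extend (W : Submodule ℂ V) : Submodule Dhat Ahat :=
  Submodule.span Dhat {x | ∃ p : ℂ[X], ∃ v ∈ W, x = 1 ⊗ₜ[ℂ] (p ⊗ₜ[ℂ] v)}

/-- The even part of `𝒜 ⊗ D̂`. -/
def evenPart : Submodule Dhat Ahat := extend Veven

/-- The odd part of `𝒜 ⊗ D̂`. -/
def oddPart : Submodule Dhat Ahat := extend Vodd

/-- `Aut_{D̂-conf}(𝒜 ⊗ D̂)`: the group (under composition) of all `D̂`-linear bijections of
`𝒜 ⊗ D̂` that preserve the `ℤ/2ℤ`-grading, commute with `∂̂` and preserve all `n`-products. -/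
def AutConf : Subgroup (Ahat ≃ₗ[Dhat] Ahat) where
  carrier := {φ |
    (∀ x, φ x ∈ evenPart ↔ x ∈ evenPart) ∧
    (∀ x, φ x ∈ oddPart ↔ x ∈ oddPart) ∧
    (∀ x, φ (partialHat x) = partialHat (φ x)) ∧
    (∀ n x y, φ (nprodHat n x y) = nprodHat n (φ x) (φ y))}
  one_mem' := ⟨fun _ => Iff.rfl, fun _ => Iff.rfl, fun _ => rfl, fun _ _ _ => rfl⟩
  mul_mem' := by
    rintro φ ψ ⟨h₁, h₂, h₃, h₄⟩ ⟨k₁, k₂, k₃, k₄⟩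
    refine ⟨fun x => ?_, fun x => ?_, fun x => ?_, fun n x y => ?_⟩ <;>
      simp only [LinearEquiv.mul_apply, h₁, h₂, h₃, h₄, k₁, k₂, k₃, k₄]
  inv_mem' := by
    rintro φ ⟨h₁, h₂, h₃, h₄⟩
    refine ⟨fun x => ?_, fun x => ?_, fun x => ?_, fun n x y => ?_⟩
    · rw [← h₁]; simp
    · rw [← h₂]; simp
    · apply φ.injective; rw [h₃]; simp
    · apply φ.injective; rw [h₄]; simp

/-! ### The generators, and the automorphisms `θ_{A,B}`, `τ_f`, `ω` -/

/-- `2 × 2` matrices over `D̂`. -/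
abbrev MD : Type := Matrix (Fin 2) (Fin 2) Dhat

/-- `SL₂(D̂)`. -/
abbrev SLD : Type := Matrix.SpecialLinearGroup (Fin 2) Dhat

/-- A complex matrix, as a matrix over `D̂`. -/
def toMD (M : M2) : MD := M.map (algebraMap ℂ Dhat)

/-- `δ_t` applied to the entries of a matrix. -/
def deltaM (M : MD) : MD := M.map delta

/-- The element `1 ⊗ v ⊗ 1` of `𝒜 ⊗ D̂`. -/
def gen (v : V) : Ahat := 1 ⊗ₜ[ℂ] (1 ⊗ₜ[ℂ] v)

/-- The generator `L`. -/
def genL : Ahat := gen (1, 0, 0, 0, 0, 0)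

/-- The generator `U`. -/
def genU : Ahat := gen (0, 1, 0, 0, 0, 0)

/-- The matrix `E₁₁ - E₂₂`. -/
def slH : sl2 := LieAlgebra.SpecialLinear.singleSubSingle 0 1 1

/-- The matrix `E₁₂`. -/
def slE : sl2 := LieAlgebra.SpecialLinear.single 0 1 (by decide) 1

/-- The matrix `E₂₁`. -/
def slF : sl2 := LieAlgebra.SpecialLinear.single 1 0 (by decide) 1

/-- `T⁺(X)` for a matrix `X` of trace zero over `D̂` (the `D̂`-linear extension of `X ↦ T⁺(X)`). -/
def genTp (X : MD) : Ahat :=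
  X 0 0 • gen (0, 0, slH, 0, 0, 0) + X 0 1 • gen (0, 0, slE, 0, 0, 0)
    + X 1 0 • gen (0, 0, slF, 0, 0, 0)

/-- `T⁻(X)` for a matrix `X` of trace zero over `D̂` (the `D̂`-linear extension of `X ↦ T⁻(X)`). -/
def genTm (X : MD) : Ahat :=
  X 0 0 • gen (0, 0, 0, slH, 0, 0) + X 0 1 • gen (0, 0, 0, slE, 0, 0)
    + X 1 0 • gen (0, 0, 0, slF, 0, 0)

/-- `G(M)` for a matrix `M` over `D̂` (the `D̂`-linear extension of `M ↦ G(M)`). -/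
def genG (M : MD) : Ahat := ∑ i, ∑ j, M i j • gen (0, 0, 0, 0, Matrix.single i j 1, 0)

/-- `Q(M)` for a matrix `M` over `D̂` (the `D̂`-linear extension of `M ↦ Q(M)`). -/
def genQ (M : MD) : Ahat := ∑ i, ∑ j, M i j • gen (0, 0, 0, 0, 0, Matrix.single i j 1)

lemma single_smul_gen (r : ℂ) (v : V) :
    (AddMonoidAlgebra.single 0 r : Dhat) • gen v = gen (r • v) := by
  change algebraMap ℂ Dhat r • gen v = _
  rw [algebraMap_smul, gen, gen, TensorProduct.tmul_smul, TensorProduct.tmul_smul]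

lemma gen_add (v w : V) : gen (v + w) = gen v + gen w := by
  simp [gen, TensorProduct.tmul_add]

lemma sl2_eq (X : sl2) : X = X.1 0 0 • slH + X.1 0 1 • slE + X.1 1 0 • slF := by
  have h : X.1 0 0 + X.1 1 1 = 0 := by
    have := X.2
    change Matrix.trace X.1 = 0 at this
    rwa [Matrix.trace_fin_two] at this
  apply Subtype.ext
  change X.1 = X.1 0 0 • slH.1 + X.1 0 1 • slE.1 + X.1 1 0 • slF.1
  simp only [slH, slE, slF, LieAlgebra.SpecialLinear.val_single,
    LieAlgebra.SpecialLinear.val_singleSubSingle]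
  ext i j
  fin_cases i <;> fin_cases j <;> simp [Matrix.single]
  linear_combination h

lemma genTp_toMD (X : sl2) : genTp (toMD X.1) = gen (0, 0, X, 0, 0, 0) := by
  conv_rhs => rw [sl2_eq X]
  simp [genTp, toMD, single_smul_gen, ← gen_add]

lemma genTm_toMD (X : sl2) : genTm (toMD X.1) = gen (0, 0, 0, X, 0, 0) := by
  conv_rhs => rw [sl2_eq X]
  simp [genTm, toMD, single_smul_gen, ← gen_add]

lemma genG_toMD (M : M2) : genG (toMD M) = gen (0, 0, 0, 0, M, 0) := by
  conv_rhs => rw [Matrix.matrix_eq_sum_single M]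
  simp [genG, toMD, single_smul_gen, ← gen_add]

lemma genQ_toMD (M : M2) : genQ (toMD M) = gen (0, 0, 0, 0, 0, M) := by
  conv_rhs => rw [Matrix.matrix_eq_sum_single M]
  simp [genQ, toMD, single_smul_gen, ← gen_add]

/-- The formulas that define the automorphism `θ_{A,B}`. -/
structure IsTheta (A B : SLD) (φ : AutConf) : Prop where
  map_L : φ.1 genL = genL + genTp (deltaM A.1 * (A⁻¹).1) + genTm (deltaM B.1 * (B⁻¹).1)
  map_U : φ.1 genU = genU
  map_Tp : ∀ X : sl2, φ.1 (genTp (toMD X.1)) = genTp (A.1 * toMD X.1 * (A⁻¹).1)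
  map_Tm : ∀ X : sl2, φ.1 (genTm (toMD X.1)) = genTm (B.1 * toMD X.1 * (B⁻¹).1)
  map_G : ∀ M : M2, φ.1 (genG (toMD M)) = genG (A.1 * toMD M * (B⁻¹).1)
    - genQ (deltaM A.1 * toMD M * (B⁻¹).1 - A.1 * toMD M * deltaM (B⁻¹).1)
  map_Q : ∀ M : M2, φ.1 (genQ (toMD M)) = genQ (A.1 * toMD M * (B⁻¹).1)

/-- The formulas that define the automorphism `τ_f`. -/
structure IsTau (f : Dhat) (φ : AutConf) : Prop where
  map_L : φ.1 genL = genL + f • genU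
  map_U : φ.1 genU = genU
  map_Tp : ∀ X : sl2, φ.1 (genTp (toMD X.1)) = genTp (toMD X.1)
  map_Tm : ∀ X : sl2, φ.1 (genTm (toMD X.1)) = genTm (toMD X.1)
  map_G : ∀ M : M2, φ.1 (genG (toMD M)) = genG (toMD M) + genQ (f • toMD M)
  map_Q : ∀ M : M2, φ.1 (genQ (toMD M)) = genQ (toMD M)

/-- The formulas that define the automorphism `ω`. -/
structure IsOmega (φ : AutConf) : Prop where
  map_L : φ.1 genL = genL
  map_U : φ.1 genU = -genU
  map_Tp : ∀ X : sl2, φ.1 (genTp (toMD X.1)) = genTm (toMD X.1)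
  map_Tm : ∀ X : sl2, φ.1 (genTm (toMD X.1)) = genTp (toMD X.1)
  map_G : ∀ M : M2, φ.1 (genG (toMD M)) = genG (toMD (dag M))
  map_Q : ∀ M : M2, φ.1 (genQ (toMD M)) = -genQ (toMD (dag M))

/-! ### The group `((SL₂(D̂) × SL₂(D̂)) / ⟨(-I, -I)⟩ × G_a(D̂)) ⋊ ℤ/2ℤ` -/

/-- The subgroup `⟨(-I, -I)⟩` of `SL₂(D̂) × SL₂(D̂)`. -/
def negI : Subgroup (SLD × SLD) := Subgroup.zpowers (-1, -1)

lemma negI_le_center : negI ≤ Subgroup.center (SLD × SLD) := by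
  rw [negI, Subgroup.zpowers_le, Subgroup.mem_center_iff]
  intro g
  ext1 <;> simp

instance negI_normal : negI.Normal :=
  ⟨fun n hn g => by
    rw [Subgroup.mem_center_iff.1 (negI_le_center hn) g, mul_inv_cancel_right]; exact hn⟩

/-- `(SL₂(D̂) × SL₂(D̂)) / ⟨(-I, -I)⟩`. -/
abbrev SLQuot : Type := (SLD × SLD) ⧸ negI

/-- `(SL₂(D̂) × SL₂(D̂)) / ⟨(-I, -I)⟩ × G_a(D̂)`. -/
abbrev NormalPart : Type := SLQuot × Multiplicative Dhat

/-- The automorphism `[(A, B)] ↦ [(B, A)]`. -/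
def swapQuot : SLQuot ≃* SLQuot :=
  QuotientGroup.congr negI negI MulEquiv.prodComm (by
    rw [negI, MonoidHom.map_zpowers]; rfl)

lemma swapQuot_mk (A B : SLD) :
    swapQuot (QuotientGroup.mk (A, B)) = (QuotientGroup.mk (B, A) : SLQuot) := rfl

/-- The automorphism `([(A, B)], f) ↦ ([(B, A)], -f)`. -/
def sigma : MulAut NormalPart :=
  MulEquiv.prodCongr swapQuot (MulEquiv.inv (Multiplicative Dhat))

lemma sigma_apply (A B : SLD) (f : Dhat) :
    sigma (QuotientGroup.mk (A, B), Multiplicative.ofAdd f)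
      = (QuotientGroup.mk (B, A), Multiplicative.ofAdd (-f)) := rfl

lemma sigma_sq : sigma ^ 2 = 1 := by
  refine MulEquiv.ext fun x => Prod.ext ?_ ?_
  · obtain ⟨⟨A, B⟩, hx⟩ := QuotientGroup.mk_surjective x.1
    change swapQuot (swapQuot x.1) = x.1
    rw [← hx]; rfl
  · exact inv_inv x.2

/-- The action of `ℤ/2ℤ` for which the nontrivial element acts by `([(A, B)], f) ↦ ([(B, A)], -f)`. -/
def action : Multiplicative (ZMod 2) →* MulAut NormalPart where
  toFun e := sigma ^ (Multiplicative.toAdd e).val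
  map_one' := by simp
  map_mul' a b := by
    rw [toAdd_mul, ZMod.val_add, ← pow_add]
    exact (pow_eq_pow_mod _ sigma_sq).symm

lemma action_generator : action (Multiplicative.ofAdd 1) = sigma := pow_one sigma

/-- `((SL₂(D̂) × SL₂(D̂)) / ⟨(-I, -I)⟩ × G_a(D̂)) ⋊ ℤ/2ℤ`. -/
abbrev TargetGroup : Type := NormalPart ⋊[action] Multiplicative (ZMod 2)

/-- The class of `(A, B)` in `TargetGroup`. -/
def targetSL (A B : SLD) : TargetGroup := SemidirectProduct.inl (QuotientGroup.mk (A, B), 1)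

/-- The element of `TargetGroup` given by `f`. -/
def targetAdd (f : Dhat) : TargetGroup := SemidirectProduct.inl (1, Multiplicative.ofAdd f)

/-- The nontrivial element of `ℤ/2ℤ` in `TargetGroup`. -/
def targetInv : TargetGroup := SemidirectProduct.inr (Multiplicative.ofAdd 1)

end LargeN4

end

/-!
The group of automorphisms of the large `N = 4` conformal superalgebra over `D̂`.

*Evaluation.* Every element of `𝒜 ⊗ D̂` is uniquely a sum `∑ ∂̂ ^ k x_k` with `x_k` in the free
`D̂`-module `D̂ ⊗ V` (`assemble_surjective`, `eq_zero_of_ev`), so it is determined by its values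
`ev w` at `∂̂ = w`, `w ∈ ℂ`. Elements of `D̂ ⊗ V` are written as tuples `(ℓ, c, X, Y, M, N)`,
which stand for `ℓ L + c U + T⁺(X) + T⁻(Y) + G(M) + Q(N)`. Under evaluation the `λ`-bracket, and
with it all `n`-products together, becomes a family of explicit bilinear maps `beta u w` on tuples,
built from matrix products and `δ_t` (`ev_lam`). An automorphism `φ` is thus the same as a family of
maps `v ↦ φ_w(v)` from `V` to tuples, polynomial in `w`, that intertwines the brackets
(`AutConf.beta_ev`). Conversely, an invertible `D̂`-linear map of tuples that preserves every
`beta u w` extends to an automorphism whose family is independent of `w` (`map_nprodHat_of_beta`,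
`autOf`).

*Existence.* `θ_{A,B} τ_f` and `ω` come in this way from the maps `xi A B f` and `om`. The map `xi` is
conjugation by `(A, B)` followed by a unipotent map with parameters `δ_t(A) A⁻¹`, `δ_t(B) B⁻¹` and
`f`. The conjugation does not commute with `δ_t`, and the unipotent map does not preserve the constant
part of the bracket; `cW_nu` says that the two failures cancel. The relations between these maps
(`xi_mul`, `om_om`, `om_xi`) give a homomorphism from the semidirect product to the automorphism
group.

*Surjectivity* (`AutConf.exists_eq`). Let `φ` be an automorphism. If `[v_λ v] = 0`, comparing degrees
in `w` shows that the image of `v` has no component along `L`: multiplication by `w` raises the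
degree and `δ_t` does not (`genVal_fst`). So the images of a triple `h`, `e`, `f` in `T⁺` or `T⁻`
satisfy `[x(u), y(w)] = [x, y](u + w)` in `sl₂(D̂)` for each of the two components. Since
`(ad h)³ = -4 det(h) ad h`, this gives `e(2u + w) = -det(h(u)) e(w)`, and as the units of `D̂[u]` are
constants, these families are constant (`family_const`, `triple_const`). An `sl₂`-triple of matrices
over `D̂` is zero or conjugate under `SL₂(D̂)` to the standard one (`exists_conj_of_sl2_triple`),
because `D̂` is a Bézout domain, in the form needed here by `exists_coprime_parts`, and its units are
squares (`exists_sqrt_of_mul_eq_one`). As `T⁺` and `T⁻` commute, `φ` preserves or swaps them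
(`genVal_T`), so that a suitable `θ_{A,B}` or `θ_{A,B} ω` reduces to the case in which `φ` fixes `T⁺`
and `T⁻`. Then equivariance makes `φ` act on `G` and `Q` through scalars, which the remaining brackets
reduce to a sign and an element `f` of `D̂` (`exists_genVal_of_fixesT`). Hence `φ = θ_{±1,1} τ_f`
(`exists_eq_xiAut_of_fixesT`).

*Injectivity.* The values on `L`, `T⁺` and `G` show that `θ_{A,B} τ_f = 1` only for `f = 0` and
`(A, B) = ±(1, 1)` (`mem_negI_of_xiAut_eq_one`), and the value on `U` shows that `ω` is not of the
form `θ_{A,B} τ_f` (`omAut_ne_xiAut`).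
-/

noncomputable section

set_option linter.unusedSimpArgs false
set_option linter.unusedTactic false
set_option linter.unreachableTactic false

namespace LargeN4

/-! ### The ring `D̂`: coprime parts, and square roots of units -/

lemma tpow_mul (p q : ℚ) : tpow p * tpow q = tpow (p + q) := by
  simp [tpow, AddMonoidAlgebra.single_mul_single]

lemma tpow_zero : tpow 0 = 1 := rfl

/-- Two elements of `D̂`, multiplied by a suitable power of `t`, lie in the image of one polynomial
ring `ℂ[t^{1/m}]`. -/
lemma exists_polynomial_pair (a b : Dhat) :
    ∃ (φ : ℂ[X] →+* Dhat) (q : ℚ) (p₁ p₂ : ℂ[X]), φ p₁ = a * tpow q ∧ φ p₂ = b * tpow q := by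
  obtain ⟨m, hm, ha⟩ := exists_mem_range_rootEmb a
  obtain ⟨n, hn, hb⟩ := exists_mem_range_rootEmb b
  obtain ⟨a', ha'⟩ : a ∈ (rootEmb (m * n)).range := rootEmb_range_le m n hn ha
  obtain ⟨b', hb'⟩ : b ∈ (rootEmb (m * n)).range := by
    rw [mul_comm]; exact rootEmb_range_le n m hm hb
  obtain ⟨k, p, hp⟩ := LaurentPolynomial.exists_T_pow a'
  obtain ⟨l, q, hq⟩ := LaurentPolynomial.exists_T_pow b'
  have hT : ∀ j : ℤ, rootEmb (m * n) (LaurentPolynomial.T j)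
      = tpow ((j : ℚ) * ((m * n : ℕ) : ℚ)⁻¹) := fun j => by
    rw [LaurentPolynomial.T, rootEmb_single]; rfl
  have hX : ∀ j : ℕ, Polynomial.toLaurent (Polynomial.X ^ j : ℂ[X]) = LaurentPolynomial.T j :=
    fun j => by simp
  refine ⟨(rootEmb (m * n)).toRingHom.comp Polynomial.toLaurent,
    ((k + l : ℤ) : ℚ) * ((m * n : ℕ) : ℚ)⁻¹, p * Polynomial.X ^ l, q * Polynomial.X ^ k, ?_, ?_⟩
  · change rootEmb _ (Polynomial.toLaurent _) = _
    rw [map_mul, hp, hX, mul_assoc, ← LaurentPolynomial.T_add, map_mul, hT]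
    change rootEmb _ a' = a at ha'
    rw [ha']
  · change rootEmb _ (Polynomial.toLaurent _) = _
    rw [map_mul, hq, hX, mul_assoc, ← LaurentPolynomial.T_add, map_mul, hT, add_comm (l : ℤ)]
    change rootEmb _ b' = b at hb'
    rw [hb']

/-- `D̂` is a Bézout ring: two elements are multiples, by the entries of a unimodular row, of a
common element. -/
lemma exists_coprime_parts (a b : Dhat) :
    ∃ d r s x y : Dhat, a = d * r ∧ b = d * s ∧ x * r + y * s = 1 := by
  obtain ⟨φ, q, p₁, p₂, h₁, h₂⟩ := exists_polynomial_pair a b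
  have hback : ∀ c : Dhat, c * tpow q * tpow (-q) = c := fun c => by
    rw [mul_assoc, tpow_mul, add_neg_cancel, tpow_zero, mul_one]
  by_cases h : p₁ = 0 ∧ p₂ = 0
  · refine ⟨0, 1, 0, 1, 0, ?_, ?_, by ring⟩
    · rw [← hback a, ← h₁, h.1]; simp
    · rw [← hback b, ← h₂, h.2]; simp
  · have hg : EuclideanDomain.gcd p₁ p₂ ≠ 0 := fun h0 => h (EuclideanDomain.gcd_eq_zero_iff.1 h0)
    obtain ⟨r, hr⟩ := EuclideanDomain.gcd_dvd_left p₁ p₂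
    obtain ⟨s, hs⟩ := EuclideanDomain.gcd_dvd_right p₁ p₂
    have hbez := EuclideanDomain.gcd_eq_gcd_ab p₁ p₂
    generalize EuclideanDomain.gcd p₁ p₂ = g at *
    generalize EuclideanDomain.gcdA p₁ p₂ = x at *
    generalize EuclideanDomain.gcdB p₁ p₂ = y at *
    have h1 : x * r + y * s = 1 := by
      apply mul_left_cancel₀ hg
      rw [mul_one]
      conv_rhs => rw [hbez, hr, hs]
      ring
    refine ⟨φ g * tpow (-q), φ r, φ s, φ x, φ y, ?_, ?_, ?_⟩
    · rw [← hback a, ← h₁, hr, map_mul]; ring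
    · rw [← hback b, ← h₂, hs, map_mul]; ring
    · rw [← map_mul, ← map_mul, ← map_add, h1, map_one]

/-- The units of `D̂` are the monomials `c t ^ q`; hence they are squares. -/
lemma exists_sqrt_of_mul_eq_one {f g : Dhat} (h : f * g = 1) :
    ∃ s r : Dhat, s * s = f ∧ s * r = 1 := by
  have hf : f.coeff.support.Nonempty := by
    rw [Finsupp.support_nonempty_iff]; rintro h0
    have : f = 0 := AddMonoidAlgebra.coeff_injective h0
    simp [this] at h
  have hg : g.coeff.support.Nonempty := by
    rw [Finsupp.support_nonempty_iff]; rintro h0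
    have : g = 0 := AddMonoidAlgebra.coeff_injective h0
    simp [this] at h
  -- a sum of exponents that arises in only one way is an exponent of `f * g = 1`
  have key : ∀ p : ℚ × ℚ, p ∈ f.coeff.support ×ˢ g.coeff.support →
      UniqueAdd f.coeff.support g.coeff.support p.1 p.2 → p.1 + p.2 = 0 := by
    rintro ⟨a, b⟩ hp hu
    rw [Finset.mem_product] at hp
    by_contra hne
    have := AddMonoidAlgebra.coeff_mul_add_of_uniqueAdd hu
    rw [h] at this
    simp only [Finsupp.mem_support_iff] at hp
    have h1 : (1 : Dhat).coeff (a + b) = 0 := by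
      rw [AddMonoidAlgebra.one_def]
      simp [Ne.symm hne]
    rw [h1] at this
    exact mul_ne_zero hp.1 hp.2 this.symm
  have hcard : f.coeff.support.card * g.coeff.support.card ≤ 1 := by
    by_contra hlt
    obtain ⟨p, hp, p', hp', hne, hu, hu'⟩ :=
      TwoUniqueSums.uniqueAdd_of_one_lt_card (not_le.1 hlt)
    have e := key p hp hu
    have e' := key p' hp' hu'
    rw [Finset.mem_product] at hp'
    obtain ⟨e1, e2⟩ := hu hp'.1 hp'.2 (e'.trans e.symm)
    exact hne (Prod.ext e1 e2).symm
  have hfc : f.coeff.support.card = 1 := by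
    have h1 := hf.card_pos
    have h2 := hg.card_pos
    nlinarith
  obtain ⟨q, c, hc, hq⟩ := Finsupp.card_support_eq_one'.1 hfc
  have hfq : f = AddMonoidAlgebra.single q c := AddMonoidAlgebra.coeff_injective hq
  obtain ⟨z, hz⟩ := IsAlgClosed.exists_pow_nat_eq c (n := 2) (by norm_num)
  have hz0 : z ≠ 0 := by rintro rfl; exact hc (by simpa using hz.symm)
  refine ⟨AddMonoidAlgebra.single (q / 2) z, AddMonoidAlgebra.single (-(q / 2)) z⁻¹, ?_, ?_⟩
  · rw [hfq, AddMonoidAlgebra.single_mul_single, add_halves, ← sq, hz]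
  · rw [AddMonoidAlgebra.single_mul_single, add_neg_cancel, mul_inv_cancel₀ hz0]; rfl

/-! ### `sl₂`-triples over `D̂` -/

/-- A matrix with determinant zero kills a unimodular vector, and such a vector is the first column
of a matrix in `SL₂(D̂)`. -/
lemma exists_SL_col_of_det_eq_zero (e : MD) (he : e.det = 0) :
    ∃ A : SLD, e 0 0 * A.1 0 0 + e 0 1 * A.1 1 0 = 0 ∧ e 1 0 * A.1 0 0 + e 1 1 * A.1 1 0 = 0 := by
  rw [Matrix.det_fin_two] at he
  have main : ∀ a b c d : Dhat, a * d - b * c = 0 → (a ≠ 0 ∨ b ≠ 0) →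
      ∃ A : SLD, a * A.1 0 0 + b * A.1 1 0 = 0 ∧ c * A.1 0 0 + d * A.1 1 0 = 0 := by
    intro a b c d h hne
    obtain ⟨g, r, s, x, y, rfl, rfl, hxy⟩ := exists_coprime_parts a b
    have hg : g ≠ 0 := by rintro rfl; simp at hne
    refine ⟨⟨!![-s, -x; r, -y], by rw [Matrix.det_fin_two_of]; linear_combination hxy⟩, ?_, ?_⟩
    · simp; ring
    · apply mul_left_cancel₀ hg
      simp only [Matrix.of_apply, Matrix.cons_val', Matrix.cons_val_zero, Matrix.cons_val_one,
        Matrix.cons_val_fin_one]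
      linear_combination h
  by_cases h1 : e 0 0 ≠ 0 ∨ e 0 1 ≠ 0
  · exact main _ _ _ _ he h1
  · by_cases h2 : e 1 0 ≠ 0 ∨ e 1 1 ≠ 0
    · obtain ⟨A, hA, hA'⟩ := main (e 1 0) (e 1 1) (e 0 0) (e 0 1) (by linear_combination -he) h2
      exact ⟨A, hA', hA⟩
    · push Not at h1 h2
      exact ⟨1, by simp [h1], by simp [h2]⟩

lemma Dhat.two_ne_zero : (2 : Dhat) ≠ 0 := by
  have h := (FaithfulSMul.algebraMap_injective ℂ Dhat).ne (_root_.two_ne_zero (α := ℂ))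
  rwa [map_ofNat, map_zero] at h

/-- An `sl₂`-triple whose raising element is upper triangular and nilpotent is conjugate, by an
upper triangular matrix in `SL₂(D̂)`, to the standard triple. -/
lemma exists_conj_of_upper {c a b b' p q r : Dhat}
    (he : !![a, b; b', -a] * !![0, c; 0, 0] - !![0, c; 0, 0] * !![a, b; b', -a]
      = (2 : Dhat) • !![0, c; 0, 0])
    (hf : !![a, b; b', -a] * !![p, q; r, -p] - !![p, q; r, -p] * !![a, b; b', -a]
      = (-2 : Dhat) • !![p, q; r, -p])
    (hef : !![0, c; 0, 0] * !![p, q; r, -p] - !![p, q; r, -p] * !![0, c; 0, 0] = !![a, b; b', -a])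
    (hc : c ≠ 0) :
    ∃ B : SLD, !![0, c; 0, 0] = B.1 * !![0, 1; 0, 0] * (B⁻¹).1 ∧
      !![a, b; b', -a] = B.1 * !![1, 0; 0, -1] * (B⁻¹).1 ∧
      !![p, q; r, -p] = B.1 * !![0, 0; 1, 0] * (B⁻¹).1 := by
  have two := Dhat.two_ne_zero
  have e01 := congrFun (congrFun he 0) 1
  have f01 := congrFun (congrFun hf 0) 1
  have k00 := congrFun (congrFun hef 0) 0
  have k01 := congrFun (congrFun hef 0) 1
  have k10 := congrFun (congrFun hef 1) 0
  simp at e01 f01 k00 k01 k10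
  have ha : a = 1 := mul_left_cancel₀ (mul_ne_zero two hc) (by linear_combination e01)
  subst ha
  subst k10
  have hb : b = -(2 * c * p) := by linear_combination -k01
  subst hb
  obtain ⟨s, t, rfl, hst⟩ := exists_sqrt_of_mul_eq_one k00
  have hs : s ≠ 0 := by rintro rfl; simp at hc
  have hr : r = t * t := by
    apply mul_left_cancel₀ (mul_ne_zero hs hs)
    linear_combination k00 - (s * t + 1) * hst
  have hq : q = -(s * s * p * p) := by
    apply mul_left_cancel₀ (mul_ne_zero two two)
    linear_combination f01
  subst hr hq
  obtain ⟨B, hB⟩ : ∃ B : SLD, B.1 = !![s, s * p; 0, t] :=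
    ⟨⟨!![s, s * p; 0, t], by rw [Matrix.det_fin_two_of]; linear_combination hst⟩, rfl⟩
  refine ⟨B, ?_, ?_, ?_⟩ <;>
    rw [Matrix.SpecialLinearGroup.coe_inv, hB, Matrix.adjugate_fin_two_of] <;>
    ext i j : 1 <;> fin_cases i <;> fin_cases j <;>
    simp [Matrix.mul_apply, Fin.sum_univ_two]
  · linear_combination -hst
  · ring
  · linear_combination -hst
  · linear_combination -p * hst
  · ring
  · linear_combination -p * hst

lemma SLD.inv_mul_coe (A : SLD) : (A⁻¹).1 * A.1 = 1 := by
  rw [← Matrix.SpecialLinearGroup.coe_mul, inv_mul_cancel]; rfl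

lemma SLD.mul_inv_coe (A : SLD) : A.1 * (A⁻¹).1 = 1 := by
  rw [← Matrix.SpecialLinearGroup.coe_mul, mul_inv_cancel]; rfl

lemma eq_of_trace_eq_zero {R : Type*} [CommRing R] {X : Matrix (Fin 2) (Fin 2) R}
    (h : X.trace = 0) : X = !![X 0 0, X 0 1; X 1 0, -X 0 0] := by
  rw [Matrix.trace_fin_two] at h
  ext i j : 1; fin_cases i <;> fin_cases j <;> simp
  linear_combination h

/-- Every `sl₂`-triple over `D̂` is conjugate under `SL₂(D̂)` to the standard one. The raising element
is nilpotent, so it kills a unimodular vector; the remaining scalar is a unit, hence a square. -/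
lemma exists_conj_of_sl2_triple {e h f : MD} (te : e.trace = 0) (th : h.trace = 0)
    (tf : f.trace = 0) (he : h * e - e * h = (2 : Dhat) • e) (hf : h * f - f * h = (-2 : Dhat) • f)
    (hef : e * f - f * e = h) (hne : e ≠ 0) :
    ∃ A : SLD, e = A.1 * !![0, 1; 0, 0] * (A⁻¹).1 ∧ h = A.1 * !![1, 0; 0, -1] * (A⁻¹).1 ∧
      f = A.1 * !![0, 0; 1, 0] * (A⁻¹).1 := by
  have two := Dhat.two_ne_zero
  have hdet : e.det = 0 := by
    have h1 : ((h * e - e * h) * e).trace = 0 := by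
      rw [Matrix.sub_mul, Matrix.trace_sub, Matrix.mul_assoc h e e, Matrix.mul_assoc e h e,
        Matrix.trace_mul_comm e (h * e), ← Matrix.mul_assoc, sub_self]
    rw [he] at h1
    rw [eq_of_trace_eq_zero te] at h1 ⊢
    simp [Matrix.trace_fin_two] at h1
    rw [Matrix.det_fin_two_of]
    apply mul_left_cancel₀ (mul_ne_zero two two)
    linear_combination -h1
  obtain ⟨A, hA0, hA1⟩ := exists_SL_col_of_det_eq_zero e hdet
  have i1 := SLD.mul_inv_coe A
  have i2 := SLD.inv_mul_coe A
  have hconj : ∀ X : MD, A.1 * ((A⁻¹).1 * X * A.1) * (A⁻¹).1 = X := fun X => by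
    calc A.1 * ((A⁻¹).1 * X * A.1) * (A⁻¹).1 = (A.1 * (A⁻¹).1) * X * (A.1 * (A⁻¹).1) := by
          noncomm_ring
      _ = X := by rw [i1]; simp
  have hmul : ∀ X Y : MD, ((A⁻¹).1 * X * A.1) * ((A⁻¹).1 * Y * A.1) = (A⁻¹).1 * (X * Y) * A.1 :=
    fun X Y => by
    calc ((A⁻¹).1 * X * A.1) * ((A⁻¹).1 * Y * A.1)
        = (A⁻¹).1 * X * (A.1 * (A⁻¹).1) * Y * A.1 := by noncomm_ring
      _ = _ := by rw [i1]; noncomm_ring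
  have htr : ∀ X : MD, X.trace = 0 → ((A⁻¹).1 * X * A.1).trace = 0 := fun X hX => by
    rw [Matrix.trace_mul_comm, ← Matrix.mul_assoc, i1, Matrix.one_mul, hX]
  have hcomm : ∀ X Y Z : MD, X * Y - Y * X = Z →
      ((A⁻¹).1 * X * A.1) * ((A⁻¹).1 * Y * A.1) - ((A⁻¹).1 * Y * A.1) * ((A⁻¹).1 * X * A.1)
        = (A⁻¹).1 * Z * A.1 := fun X Y Z hZ => by
    rw [hmul, hmul, ← hZ]; noncomm_ring
  have he' := hcomm _ _ _ he
  have hf' := hcomm _ _ _ hf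
  have hef' := hcomm _ _ _ hef
  rw [Matrix.mul_smul, Matrix.smul_mul] at he' hf'
  have te' := htr e te
  have th' := htr h th
  have tf' := htr f tf
  have col : ((A⁻¹).1 * e * A.1) 0 0 = 0 ∧ ((A⁻¹).1 * e * A.1) 1 0 = 0 := by
    rw [Matrix.mul_assoc]
    simp [Matrix.mul_apply, Fin.sum_univ_two, hA0, hA1]
  have ce := hconj e
  have ch := hconj h
  have cf := hconj f
  generalize (A⁻¹).1 * e * A.1 = e₁ at *
  generalize (A⁻¹).1 * h * A.1 = h₁ at *
  generalize (A⁻¹).1 * f * A.1 = f₁ at *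
  have ee : e₁ = !![0, e₁ 0 1; 0, 0] := by
    conv_lhs => rw [eq_of_trace_eq_zero te', col.1, col.2]
    simp
  have hc : e₁ 0 1 ≠ 0 := by
    intro h0
    apply hne
    rw [← ce, ee, h0]
    ext i j : 1; fin_cases i <;> fin_cases j <;> simp [Matrix.mul_apply, Fin.sum_univ_two]
  rw [ee, eq_of_trace_eq_zero th'] at he'
  rw [eq_of_trace_eq_zero th', eq_of_trace_eq_zero tf'] at hf'
  rw [ee, eq_of_trace_eq_zero th', eq_of_trace_eq_zero tf'] at hef'
  obtain ⟨B, h1, h2, h3⟩ := exists_conj_of_upper he' hf' hef' hc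
  rw [← ee] at h1
  rw [← eq_of_trace_eq_zero th'] at h2
  rw [← eq_of_trace_eq_zero tf'] at h3
  refine ⟨A * B, ?_, ?_, ?_⟩
  · rw [← ce, h1, mul_inv_rev]; simp only [Matrix.SpecialLinearGroup.coe_mul, Matrix.mul_assoc]
  · rw [← ch, h2, mul_inv_rev]; simp only [Matrix.SpecialLinearGroup.coe_mul, Matrix.mul_assoc]
  · rw [← cf, h3, mul_inv_rev]; simp only [Matrix.SpecialLinearGroup.coe_mul, Matrix.mul_assoc]

/-! ### The free module `D̂ ⊗ V` and its three bilinear products -/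

/-- Tuples `(ℓ, c, X, Y, M, N)` over `D̂`, standing for `ℓ L + c U + T⁺(X) + T⁻(Y) + G(M) + Q(N)`.
The matrices `X` and `Y` are not required to have trace zero; see `IsTl`. -/
abbrev WD : Type := Dhat × Dhat × MD × MD × MD × MD

/-- The constant `1 / 2` of `D̂`. -/
def half : Dhat := algebraMap ℂ Dhat (1 / 2)

lemma two_mul_half : 2 * half = 1 := by
  rw [half, ← map_ofNat (algebraMap ℂ Dhat) 2, ← map_mul,
    show (2 : ℂ) * (1 / 2) = 1 by norm_num, map_one]

lemma algebraMap_half_mul (z : ℂ) : algebraMap ℂ Dhat (1 / 2 * z) = half * algebraMap ℂ Dhat z := by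
  rw [map_mul, half]

lemma dag_add' {R : Type*} [CommRing R] (M N : Matrix (Fin 2) (Fin 2) R) :
    dag (M + N) = dag M + dag N := by
  ext i j : 1; fin_cases i <;> fin_cases j <;> simp [dag] <;> ring

lemma dag_smul' {R : Type*} [CommRing R] (r : R) (M : Matrix (Fin 2) (Fin 2) R) :
    dag (r • M) = r • dag M := by
  ext i j : 1; fin_cases i <;> fin_cases j <;> simp [dag]

/-- `M N† - N M†`. -/
def skR (M N : MD) : MD := M * dag N - N * dag M

/-- `M† N - N† M`. -/
def skL (M N : MD) : MD := dag M * N - dag N * M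

lemma skR_add_left (M M' N : MD) : skR (M + M') N = skR M N + skR M' N := by
  simp only [skR, dag_add', Matrix.add_mul, Matrix.mul_add]; abel

lemma skR_add_right (M N N' : MD) : skR M (N + N') = skR M N + skR M N' := by
  simp only [skR, dag_add', Matrix.add_mul, Matrix.mul_add]; abel

lemma skR_smul_left (r : Dhat) (M N : MD) : skR (r • M) N = r • skR M N := by
  simp [skR, dag_smul', smul_sub]

lemma skR_smul_right (r : Dhat) (M N : MD) : skR M (r • N) = r • skR M N := by
  simp [skR, dag_smul', smul_sub]

lemma skL_add_left (M M' N : MD) : skL (M + M') N = skL M N + skL M' N := by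
  simp only [skL, dag_add', Matrix.add_mul, Matrix.mul_add]; abel

lemma skL_add_right (M N N' : MD) : skL M (N + N') = skL M N + skL M N' := by
  simp only [skL, dag_add', Matrix.add_mul, Matrix.mul_add]; abel

lemma skL_smul_left (r : Dhat) (M N : MD) : skL (r • M) N = r • skL M N := by
  simp [skL, dag_smul', smul_sub]

lemma skL_smul_right (r : Dhat) (M N : MD) : skL M (r • N) = r • skL M N := by
  simp [skL, dag_smul', smul_sub]

/-- The `D̂`-bilinear extension of `brConst`. -/
def cFun : WD → WD → WD
  | (_, _, X, Y, M, N), (_, _, X', Y', M', N') =>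
    (4 * (M * dag M').trace,
      2 * (N * dag M').trace + 2 * (N' * dag M).trace,
      X * X' - X' * X - skR N M' - skR N' M,
      Y * Y' - Y' * Y + skL N M' + skL N' M,
      X * M' - M' * Y - X' * M + M * Y',
      X * N' - N' * Y - X' * N + N * Y')

/-- The `D̂`-bilinear extension of `brPartial`. -/
def bFun : WD → WD → WD
  | (l, _, _, _, M, N), (l', c', X', Y', M', N') =>
    (l * l',
      l * c',
      l • X' + skR M M',
      l • Y' + skL M M',
      l • M' + (half * l') • M,
      l • N' - (half * l') • N + c' • M - X' * M - M * Y')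

/-- The `D̂`-bilinear extension of `brLambda - brPartial`. -/
def eFun : WD → WD → WD
  | (l, c, X, Y, M, N), (l', _, _, _, M', N') =>
    (l * l',
      l' * c,
      l' • X + skR M M',
      l' • Y + skL M M',
      (half * l) • M' + l' • M,
      l' • N - (half * l) • N' + c • M' - X * M' - M' * Y)

/-- `cFun` as a bilinear map. -/
def cW : WD →ₗ[Dhat] WD →ₗ[Dhat] WD :=
  LinearMap.mk₂ Dhat cFun
    (by
      rintro ⟨l, c, X, Y, M, N⟩ ⟨l₂, c₂, X₂, Y₂, M₂, N₂⟩ ⟨l', c', X', Y', M', N'⟩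
      refine Prod.ext ?_ (Prod.ext ?_ (Prod.ext ?_ (Prod.ext ?_ (Prod.ext ?_ ?_)))) <;>
      simp [cFun, dag_add', dag_smul', skR_add_left, skR_add_right, skR_smul_left, skR_smul_right,
        skL_add_left, skL_add_right, skL_smul_left, skL_smul_right, Matrix.add_mul,
        Matrix.mul_add, smul_sub, smul_add] <;> first | ring1 | module)
    (by
      rintro r ⟨l, c, X, Y, M, N⟩ ⟨l', c', X', Y', M', N'⟩
      refine Prod.ext ?_ (Prod.ext ?_ (Prod.ext ?_ (Prod.ext ?_ (Prod.ext ?_ ?_)))) <;>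
      simp [cFun, dag_add', dag_smul', skR_add_left, skR_add_right, skR_smul_left, skR_smul_right,
        skL_add_left, skL_add_right, skL_smul_left, skL_smul_right, Matrix.add_mul,
        Matrix.mul_add, smul_sub, smul_add] <;> first | ring1 | module)
    (by
      rintro ⟨l', c', X', Y', M', N'⟩ ⟨l, c, X, Y, M, N⟩ ⟨l₂, c₂, X₂, Y₂, M₂, N₂⟩
      refine Prod.ext ?_ (Prod.ext ?_ (Prod.ext ?_ (Prod.ext ?_ (Prod.ext ?_ ?_)))) <;>
      simp [cFun, dag_add', dag_smul', skR_add_left, skR_add_right, skR_smul_left, skR_smul_right,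
        skL_add_left, skL_add_right, skL_smul_left, skL_smul_right, Matrix.add_mul,
        Matrix.mul_add, smul_sub, smul_add] <;> first | ring1 | module)
    (by
      rintro r ⟨l, c, X, Y, M, N⟩ ⟨l', c', X', Y', M', N'⟩
      refine Prod.ext ?_ (Prod.ext ?_ (Prod.ext ?_ (Prod.ext ?_ (Prod.ext ?_ ?_)))) <;>
      simp [cFun, dag_add', dag_smul', skR_add_left, skR_add_right, skR_smul_left, skR_smul_right,
        skL_add_left, skL_add_right, skL_smul_left, skL_smul_right, Matrix.add_mul,
        Matrix.mul_add, smul_sub, smul_add] <;> first | ring1 | module)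

/-- `bFun` as a bilinear map. -/
def bW : WD →ₗ[Dhat] WD →ₗ[Dhat] WD :=
  LinearMap.mk₂ Dhat bFun
    (by
      rintro ⟨l, c, X, Y, M, N⟩ ⟨l₂, c₂, X₂, Y₂, M₂, N₂⟩ ⟨l', c', X', Y', M', N'⟩
      refine Prod.ext ?_ (Prod.ext ?_ (Prod.ext ?_ (Prod.ext ?_ (Prod.ext ?_ ?_)))) <;>
      simp [bFun, skR_add_left, skL_add_left, Matrix.add_mul,
        Matrix.mul_add, smul_sub, smul_add] <;> first | ring1 | module)
    (by
      rintro r ⟨l, c, X, Y, M, N⟩ ⟨l', c', X', Y', M', N'⟩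
      refine Prod.ext ?_ (Prod.ext ?_ (Prod.ext ?_ (Prod.ext ?_ (Prod.ext ?_ ?_)))) <;>
      simp [bFun, skR_smul_left, skL_smul_left, smul_sub, smul_add] <;> first | ring1 | module)
    (by
      rintro ⟨l', c', X', Y', M', N'⟩ ⟨l, c, X, Y, M, N⟩ ⟨l₂, c₂, X₂, Y₂, M₂, N₂⟩
      refine Prod.ext ?_ (Prod.ext ?_ (Prod.ext ?_ (Prod.ext ?_ (Prod.ext ?_ ?_)))) <;>
      simp [bFun, skR_add_right, skL_add_right, Matrix.add_mul,
        Matrix.mul_add, smul_sub, smul_add] <;> first | ring1 | module)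
    (by
      rintro r ⟨l, c, X, Y, M, N⟩ ⟨l', c', X', Y', M', N'⟩
      refine Prod.ext ?_ (Prod.ext ?_ (Prod.ext ?_ (Prod.ext ?_ (Prod.ext ?_ ?_)))) <;>
      simp [bFun, skR_smul_right, skL_smul_right, smul_sub, smul_add] <;> first | ring1 | module)

/-- `eFun` as a bilinear map. -/
def eW : WD →ₗ[Dhat] WD →ₗ[Dhat] WD :=
  LinearMap.mk₂ Dhat eFun
    (by
      rintro ⟨l, c, X, Y, M, N⟩ ⟨l₂, c₂, X₂, Y₂, M₂, N₂⟩ ⟨l', c', X', Y', M', N'⟩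
      refine Prod.ext ?_ (Prod.ext ?_ (Prod.ext ?_ (Prod.ext ?_ (Prod.ext ?_ ?_)))) <;>
      simp [eFun, skR_add_left, skL_add_left, Matrix.add_mul,
        Matrix.mul_add, smul_sub, smul_add] <;> first | ring1 | module)
    (by
      rintro r ⟨l, c, X, Y, M, N⟩ ⟨l', c', X', Y', M', N'⟩
      refine Prod.ext ?_ (Prod.ext ?_ (Prod.ext ?_ (Prod.ext ?_ (Prod.ext ?_ ?_)))) <;>
      simp [eFun, skR_smul_left, skL_smul_left, smul_sub, smul_add] <;> first | ring1 | module)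
    (by
      rintro ⟨l', c', X', Y', M', N'⟩ ⟨l, c, X, Y, M, N⟩ ⟨l₂, c₂, X₂, Y₂, M₂, N₂⟩
      refine Prod.ext ?_ (Prod.ext ?_ (Prod.ext ?_ (Prod.ext ?_ (Prod.ext ?_ ?_)))) <;>
      simp [eFun, skR_add_right, skL_add_right, Matrix.add_mul,
        Matrix.mul_add, smul_sub, smul_add] <;> first | ring1 | module)
    (by
      rintro r ⟨l, c, X, Y, M, N⟩ ⟨l', c', X', Y', M', N'⟩
      refine Prod.ext ?_ (Prod.ext ?_ (Prod.ext ?_ (Prod.ext ?_ (Prod.ext ?_ ?_)))) <;>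
      simp [eFun, skR_smul_right, skL_smul_right, smul_sub, smul_add] <;> first | ring1 | module)

lemma cW_apply (x y : WD) : cW x y = cFun x y := rfl
lemma bW_apply (x y : WD) : bW x y = bFun x y := rfl
lemma eW_apply (x y : WD) : eW x y = eFun x y := rfl

lemma brConst_apply (v w : V) : brConst v w = brConstFun v w := rfl
lemma brPartial_apply (v w : V) : brPartial v w = brPartialFun v w := rfl
lemma brLambda_apply (v w : V) : brLambda v w = brLambdaFun v w := rfl

lemma toMD_add (M N : M2) : toMD (M + N) = toMD M + toMD N := by
  ext i j : 1; simp [toMD]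

lemma toMD_sub (M N : M2) : toMD (M - N) = toMD M - toMD N := by
  ext i j : 1; simp [toMD]

lemma toMD_smul (r : ℂ) (M : M2) : toMD (r • M) = r • toMD M := by
  ext i j : 1; exact (Algebra.linearMap ℂ Dhat).map_smul r (M i j)

lemma toMD_mul (M N : M2) : toMD (M * N) = toMD M * toMD N := Matrix.map_mul

lemma toMD_dag (M : M2) : toMD (dag M) = dag (toMD M) := by
  ext i j : 1; fin_cases i <;> fin_cases j <;> simp [toMD, dag]

lemma toMD_zero : toMD 0 = 0 := by ext i j : 1; simp [toMD]

lemma trace_toMD (M : M2) : (toMD M).trace = algebraMap ℂ Dhat M.trace := by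
  simp [toMD, Matrix.trace_fin_two]

lemma toMD_skewR (M N : M2) : toMD (skewR M N).1 = skR (toMD M) (toMD N) := by
  simp only [skewR, skR, toMD_sub, toMD_mul, toMD_dag]

lemma toMD_skewL (M N : M2) : toMD (skewL M N).1 = skL (toMD M) (toMD N) := by
  simp only [skewL, skL, toMD_sub, toMD_mul, toMD_dag]

lemma algebraMap_smul_MD (r : ℂ) (M : MD) : algebraMap ℂ Dhat r • M = r • M :=
  algebraMap_smul Dhat r M

/-- The inclusion of `V` into `D̂ ⊗ V`. -/
def iota : V →ₗ[ℂ] WD where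
  toFun v := (algebraMap ℂ Dhat v.1, algebraMap ℂ Dhat v.2.1, toMD v.2.2.1.1, toMD v.2.2.2.1.1,
    toMD v.2.2.2.2.1, toMD v.2.2.2.2.2)
  map_add' v w := by simp [toMD_add]
  map_smul' r v := by
    have h : ∀ z, algebraMap ℂ Dhat (r * z) = r • algebraMap ℂ Dhat z := fun z =>
      (Algebra.linearMap ℂ Dhat).map_smul r z
    exact Prod.ext (h _) (Prod.ext (h _) (Prod.ext (toMD_smul _ _) (Prod.ext (toMD_smul _ _)
      (Prod.ext (toMD_smul _ _) (toMD_smul _ _)))))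

lemma iota_apply (l c : ℂ) (X Y : sl2) (M N : M2) :
    iota (l, c, X, Y, M, N) = (algebraMap ℂ Dhat l, algebraMap ℂ Dhat c, toMD X.1, toMD Y.1,
      toMD M, toMD N) := rfl

lemma iota_brConst (v w : V) : iota (brConst v w) = cW (iota v) (iota w) := by
  obtain ⟨l, c, X, Y, M, N⟩ := v
  obtain ⟨l', c', X', Y', M', N'⟩ := w
  rw [cW_apply, brConst_apply]
  simp only [brConstFun, iota_apply, cFun]
  refine Prod.ext ?_ (Prod.ext ?_ (Prod.ext ?_ (Prod.ext ?_ (Prod.ext ?_ ?_))))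
  · simp only [map_mul, ← trace_toMD, toMD_mul, toMD_dag, map_ofNat]
  · simp only [map_mul, map_add, ← trace_toMD, toMD_mul, toMD_dag, map_ofNat]
  · change toMD (X.1 * X'.1 - X'.1 * X.1 - (skewR N M').1 - (skewR N' M).1) = _
    simp only [toMD_sub, toMD_mul, toMD_skewR]
  · change toMD (Y.1 * Y'.1 - Y'.1 * Y.1 + (skewL N M').1 + (skewL N' M).1) = _
    simp only [toMD_sub, toMD_add, toMD_mul, toMD_skewL]
  · simp only [toMD_sub, toMD_add, toMD_mul]
  · simp only [toMD_sub, toMD_add, toMD_mul]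

lemma iota_brPartial (v w : V) : iota (brPartial v w) = bW (iota v) (iota w) := by
  obtain ⟨l, c, X, Y, M, N⟩ := v
  obtain ⟨l', c', X', Y', M', N'⟩ := w
  rw [bW_apply, brPartial_apply]
  simp only [brPartialFun, iota_apply, bFun]
  refine Prod.ext ?_ (Prod.ext ?_ (Prod.ext ?_ (Prod.ext ?_ (Prod.ext ?_ ?_))))
  · simp only [map_mul]
  · simp only [map_mul]
  · change toMD (l • X'.1 + (skewR M M').1) = _
    simp only [toMD_add, toMD_smul, toMD_skewR, algebraMap_smul_MD]
  · change toMD (l • Y'.1 + (skewL M M').1) = _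
    simp only [toMD_add, toMD_smul, toMD_skewL, algebraMap_smul_MD]
  · simp only [toMD_sub, toMD_add, toMD_mul, toMD_smul, ← algebraMap_half_mul, algebraMap_smul_MD]
  · simp only [toMD_sub, toMD_add, toMD_mul, toMD_smul, ← algebraMap_half_mul, algebraMap_smul_MD]

lemma iota_brLambda (v w : V) :
    iota (brLambda v w) = bW (iota v) (iota w) + eW (iota v) (iota w) := by
  rw [← iota_brPartial, ← sub_eq_iff_eq_add', ← map_sub]
  obtain ⟨l, c, X, Y, M, N⟩ := v
  obtain ⟨l', c', X', Y', M', N'⟩ := w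
  rw [eW_apply, brLambda_apply, brPartial_apply]
  have e : brLambdaFun (l, c, X, Y, M, N) (l', c', X', Y', M', N')
      - brPartialFun (l, c, X, Y, M, N) (l', c', X', Y', M', N')
      = (l * l', l' * c, l' • X + skewR M M', l' • Y + skewL M M',
        (1 / 2 * l) • M' + l' • M,
        l' • N - (1 / 2 * l) • N' + c • M' - X.1 * M' - M' * Y.1) := by
    simp only [brLambdaFun, brPartialFun]
    refine Prod.ext ?_ (Prod.ext ?_ (Prod.ext ?_ (Prod.ext ?_ (Prod.ext ?_ ?_))))
    · change 2 * l * l' - l * l' = _; ring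
    · change l * c' + l' * c - l * c' = _; ring
    · change l • X' + l' • X + (2 : ℂ) • skewR M M' - (l • X' + skewR M M') = _; module
    · change l • Y' + l' • Y + (2 : ℂ) • skewL M M' - (l • Y' + skewL M M') = _; module
    · change (3 / 2 * l) • M' + (3 / 2 * l') • M - (l • M' + (1 / 2 * l') • M) = _; module
    · change (1 / 2 * l) • N' + (1 / 2 * l') • N + c • M' + c' • M
        - X.1 * M' - M' * Y.1 - X'.1 * M - M * Y'.1
        - (l • N' - (1 / 2 * l') • N + c' • M - X'.1 * M - M * Y'.1) = _
      module
  rw [e]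
  simp only [iota_apply, eFun]
  refine Prod.ext ?_ (Prod.ext ?_ (Prod.ext ?_ (Prod.ext ?_ (Prod.ext ?_ ?_))))
  · simp only [map_mul]
  · simp only [map_mul]
  · change toMD (l' • X.1 + (skewR M M').1) = _
    simp only [toMD_add, toMD_smul, toMD_skewR, algebraMap_smul_MD]
  · change toMD (l' • Y.1 + (skewL M M').1) = _
    simp only [toMD_add, toMD_smul, toMD_skewL, algebraMap_smul_MD]
  · simp only [toMD_sub, toMD_add, toMD_mul, toMD_smul, ← algebraMap_half_mul, algebraMap_smul_MD]
  · simp only [toMD_sub, toMD_add, toMD_mul, toMD_smul, ← algebraMap_half_mul, algebraMap_smul_MD]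

lemma deltaM_add (M N : MD) : deltaM (M + N) = deltaM M + deltaM N := by
  ext i j : 1; simp [deltaM]

lemma deltaM_smul (r : ℂ) (M : MD) : deltaM (r • M) = r • deltaM M := by
  ext i j : 1; simp [deltaM]

lemma deltaM_mul (M N : MD) : deltaM (M * N) = deltaM M * N + M * deltaM N := by
  ext i j : 1
  simp [deltaM, Matrix.mul_apply, Fin.sum_univ_two]
  ring

lemma deltaM_toMD (M : M2) : deltaM (toMD M) = 0 := by
  ext i j : 1; exact delta.map_algebraMap (M i j)

/-- `δ_t` applied to all entries of a tuple. -/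
def deltaW : WD →ₗ[ℂ] WD where
  toFun x := (delta x.1, delta x.2.1, deltaM x.2.2.1, deltaM x.2.2.2.1, deltaM x.2.2.2.2.1,
    deltaM x.2.2.2.2.2)
  map_add' x y := by simp [deltaM_add]
  map_smul' r x := by simp [deltaM_smul]

lemma deltaW_smul (f : Dhat) (x : WD) : deltaW (f • x) = f • deltaW x + delta f • x := by
  have hM : ∀ M : MD, deltaM (f • M) = f • deltaM M + delta f • M := fun M => by
    ext i j : 1; simp [deltaM]; ring
  have hD : ∀ d : Dhat, delta (f • d) = f • delta d + delta f • d := fun d => by simp; ring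
  exact Prod.ext (hD _) (Prod.ext (hD _) (Prod.ext (hM _) (Prod.ext (hM _)
    (Prod.ext (hM _) (hM _)))))

lemma deltaW_iota (v : V) : deltaW (iota v) = 0 := by
  have hD : ∀ z, delta (algebraMap ℂ Dhat z) = 0 := delta.map_algebraMap
  exact Prod.ext (hD _) (Prod.ext (hD _) (Prod.ext (deltaM_toMD _) (Prod.ext (deltaM_toMD _)
    (Prod.ext (deltaM_toMD _) (deltaM_toMD _)))))

/-- The polynomial in `u, w` that gives the `λ`-bracket of `∂̂ ^ i x` and `∂̂ ^ k y` up to the factor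
`u ^ i w ^ k`, where `u = -λ` and `w = ∂̂ + λ`. -/
def beta (u w : ℂ) (x y : WD) : WD :=
  cW x y + bW x (w • y - deltaW y) - eW (u • x - deltaW x) y

lemma beta_add_left (u w : ℂ) (x x' y : WD) : beta u w (x + x') y = beta u w x y + beta u w x' y := by
  simp only [beta, map_add, LinearMap.add_apply, smul_add, map_sub, LinearMap.sub_apply]; abel

lemma beta_add_right (u w : ℂ) (x y y' : WD) :
    beta u w x (y + y') = beta u w x y + beta u w x y' := by
  simp only [beta, map_add, smul_add, map_sub]; abel

lemma beta_zero_left (u w : ℂ) (y : WD) : beta u w 0 y = 0 := by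
  simp [beta]

lemma beta_zero_right (u w : ℂ) (x : WD) : beta u w x 0 = 0 := by
  simp [beta]

lemma beta_smul_iota (u w : ℂ) (f g : Dhat) (v v' : V) :
    beta u w (f • iota v) (g • iota v') = (f * g) • iota (brConst v v')
      + ((u + w) • (f * g) - delta f * g - f * delta g) • iota (brPartial v v')
      + ((-u) • (f * g) + delta f * g) • iota (brLambda v v') := by
  have h1 : w • g • iota v' - deltaW (g • iota v') = (w • g - delta g) • iota v' := by
    rw [deltaW_smul, deltaW_iota, smul_zero, zero_add, sub_smul, smul_assoc]
  have h2 : u • f • iota v - deltaW (f • iota v) = (u • f - delta f) • iota v := by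
    rw [deltaW_smul, deltaW_iota, smul_zero, zero_add, sub_smul, smul_assoc]
  rw [beta, h1, h2, iota_brConst, iota_brPartial, iota_brLambda]
  simp only [map_smul, LinearMap.smul_apply, smul_smul, Algebra.smul_def (A := Dhat) u,
    Algebra.smul_def (A := Dhat) w, Algebra.smul_def (A := Dhat) (u + w),
    Algebra.smul_def (A := Dhat) (-u), map_neg, map_add]
  module

/-! ### Evaluation of `∂̂` at a complex number -/

/-- The operator `w - δ_t` of `D̂`, by which `∂` acts when `∂̂` takes the value `w`. -/
def opw (w : ℂ) : Dhat →ₗ[ℂ] Dhat := w • LinearMap.id - (delta : Dhat →ₗ[ℂ] Dhat)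

lemma opw_apply (w : ℂ) (f : Dhat) : opw w f = w • f - delta f := rfl

/-- Evaluation at `∂̂ = w` on the coefficients: `f ⊗ p(∂) ↦ p(w - δ_t) f`. -/
def evCoeff (w : ℂ) : Dhat ⊗[ℂ] ℂ[X] →ₗ[ℂ] Dhat :=
  TensorProduct.lift (Polynomial.aeval (opw w)).toLinearMap.flip

/-- Multiplication `f ⊗ v ↦ f v`. -/
def mulIota : Dhat ⊗[ℂ] V →ₗ[ℂ] WD :=
  TensorProduct.lift (LinearMap.mk₂ ℂ (fun f v => f • iota v) (fun f g v => add_smul f g _)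
    (fun r f v => smul_assoc r f _) (fun f v w => by rw [map_add, smul_add])
    (fun r f v => by rw [map_smul, smul_comm]))

/-- Evaluation at `∂̂ = w`. Every element of `𝒜 ⊗ D̂` is a unique sum `∑ ∂̂ ^ k x_k` with
`x_k ∈ D̂ ⊗ V`, and it is sent to `∑ w ^ k x_k`. -/
def ev (w : ℂ) : Ahat →ₗ[ℂ] WD :=
  mulIota ∘ₗ (evCoeff w).rTensor V ∘ₗ (TensorProduct.assoc ℂ Dhat ℂ[X] V).symm.toLinearMap

lemma ev_tmul (w : ℂ) (f : Dhat) (p : ℂ[X]) (v : V) :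
    ev w (f ⊗ₜ[ℂ] (p ⊗ₜ[ℂ] v)) = (Polynomial.aeval (opw w) p f) • iota v := rfl

lemma ev_gen (w : ℂ) (v : V) : ev w (gen v) = iota v := by
  rw [gen, ev_tmul, map_one (Polynomial.aeval (opw w))]; exact one_smul _ _

lemma ev_smul_gen (w : ℂ) (f : Dhat) (v : V) : ev w (f • gen v) = f • iota v := by
  rw [gen, TensorProduct.smul_tmul', ev_tmul, map_one (Polynomial.aeval (opw w))]
  change (f • (1 : Dhat)) • iota v = _
  rw [smul_eq_mul, mul_one]

lemma partialHat_tmul (f : Dhat) (p : ℂ[X]) (v : V) :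
    partialHat (f ⊗ₜ[ℂ] (p ⊗ₜ[ℂ] v))
      = f ⊗ₜ[ℂ] ((Polynomial.X * p) ⊗ₜ[ℂ] v) + delta f ⊗ₜ[ℂ] (p ⊗ₜ[ℂ] v) := rfl

lemma Ahat.induction {P : Ahat → Prop} (h0 : P 0) (hadd : ∀ x y, P x → P y → P (x + y))
    (h : ∀ f p v, P (f ⊗ₜ[ℂ] (p ⊗ₜ[ℂ] v))) (x : Ahat) : P x := by
  induction x using TensorProduct.induction_on with
  | zero => exact h0
  | add x y hx hy => exact hadd _ _ hx hy
  | tmul f a =>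
    induction a using TensorProduct.induction_on with
    | zero => rw [TensorProduct.tmul_zero]; exact h0
    | add a b ha hb => rw [TensorProduct.tmul_add]; exact hadd _ _ ha hb
    | tmul p v => exact h f p v

lemma aeval_opw_X_mul (w : ℂ) (p : ℂ[X]) (f : Dhat) :
    Polynomial.aeval (opw w) (Polynomial.X * p) f = opw w (Polynomial.aeval (opw w) p f) := by
  rw [map_mul, Polynomial.aeval_X]; rfl

lemma aeval_opw_opw (w : ℂ) (p : ℂ[X]) (f : Dhat) :
    Polynomial.aeval (opw w) p (opw w f) = opw w (Polynomial.aeval (opw w) p f) := by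
  rw [← aeval_opw_X_mul, mul_comm, map_mul, Polynomial.aeval_X]; rfl

lemma aeval_opw_delta (w : ℂ) (p : ℂ[X]) (f : Dhat) :
    Polynomial.aeval (opw w) p (delta f) = delta (Polynomial.aeval (opw w) p f) := by
  have h := aeval_opw_opw w p f
  rw [opw_apply, opw_apply, map_sub, map_smul] at h
  exact sub_right_injective h

lemma ev_partialHat (w : ℂ) (x : Ahat) : ev w (partialHat x) = w • ev w x := by
  induction x using Ahat.induction with
  | h0 => simp
  | hadd x y hx hy => simp only [map_add, hx, hy, smul_add]
  | h f p v =>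
    rw [partialHat_tmul, map_add, ev_tmul, ev_tmul, ev_tmul, aeval_opw_X_mul, aeval_opw_delta,
      ← add_smul, opw_apply, sub_add_cancel, smul_assoc]

/-- The operator `δ_t` on the coefficients. -/
def deltaHat : Ahat →ₗ[ℂ] Ahat := TensorProduct.map (delta : Dhat →ₗ[ℂ] Dhat) LinearMap.id

lemma partialHat_smul (f : Dhat) (x : Ahat) :
    partialHat (f • x) = f • partialHat x + delta f • x := by
  induction x using Ahat.induction with
  | h0 => simp
  | hadd x y hx hy => simp only [map_add, hx, hy, smul_add]; abel
  | h g p v =>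
    rw [TensorProduct.smul_tmul', partialHat_tmul, partialHat_tmul, smul_add,
      TensorProduct.smul_tmul', TensorProduct.smul_tmul', TensorProduct.smul_tmul', smul_eq_mul,
      Derivation.leibniz, TensorProduct.add_tmul]
    simp only [smul_eq_mul, mul_comm (delta f)]
    abel

/-! ### Normal form of the elements of `𝒜 ⊗ D̂` -/

/-- The element `ℓ L + c U + T⁺(X) + T⁻(Y) + G(M) + Q(N)` of `𝒜 ⊗ D̂`. -/
def emb : WD →ₗ[Dhat] Ahat where
  toFun x := x.1 • genL + x.2.1 • genU + genTp x.2.2.1 + genTm x.2.2.2.1 + genG x.2.2.2.2.1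
    + genQ x.2.2.2.2.2
  map_add' x y := by
    simp [genTp, genTm, genG, genQ, Fin.sum_univ_two, add_smul]; abel
  map_smul' f x := by
    simp [genTp, genTm, genG, genQ, Fin.sum_univ_two, mul_smul]

lemma emb_apply (l c : Dhat) (X Y M N : MD) :
    emb (l, c, X, Y, M, N) = l • genL + c • genU + genTp X + genTm Y + genG M + genQ N := rfl

lemma emb_iota (v : V) : emb (iota v) = gen v := by
  obtain ⟨l, c, X, Y, M, N⟩ := v
  rw [iota_apply, emb_apply, genTp_toMD, genTm_toMD, genG_toMD, genQ_toMD]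
  have h : ∀ (z : ℂ) (v : V), algebraMap ℂ Dhat z • gen v = gen (z • v) := single_smul_gen
  rw [genL, genU, h, h, ← gen_add, ← gen_add, ← gen_add, ← gen_add, ← gen_add]
  congr 1
  simp

/-- The tuples whose matrices `X` and `Y` have trace zero. -/
def IsTl (x : WD) : Prop := x.2.2.1.trace = 0 ∧ x.2.2.2.1.trace = 0

/-- The matrix of trace zero with the same first column and the same first row. -/
def tl (X : MD) : MD := !![X 0 0, X 0 1; X 1 0, -X 0 0]

lemma trace_tl (X : MD) : (tl X).trace = 0 := by simp [tl, Matrix.trace_fin_two]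

lemma tl_add (X Y : MD) : tl (X + Y) = tl X + tl Y := by
  ext i j : 1; fin_cases i <;> fin_cases j <;> simp [tl]; abel

lemma tl_smul (f : Dhat) (X : MD) : tl (f • X) = f • tl X := by
  ext i j : 1; fin_cases i <;> fin_cases j <;> simp [tl]

lemma tl_eq_self {X : MD} (h : X.trace = 0) : tl X = X := (eq_of_trace_eq_zero h).symm

/-- The projection of `WD` to the tuples that satisfy `IsTl`. -/
def proj : WD →ₗ[Dhat] WD where
  toFun x := (x.1, x.2.1, tl x.2.2.1, tl x.2.2.2.1, x.2.2.2.2.1, x.2.2.2.2.2)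
  map_add' _ _ := Prod.ext rfl (Prod.ext rfl (Prod.ext (tl_add _ _) (Prod.ext (tl_add _ _) rfl)))
  map_smul' _ _ := Prod.ext rfl (Prod.ext rfl (Prod.ext (tl_smul _ _) (Prod.ext (tl_smul _ _) rfl)))

lemma isTl_proj (x : WD) : IsTl (proj x) := ⟨trace_tl _, trace_tl _⟩

lemma proj_eq_self {x : WD} (h : IsTl x) : proj x = x :=
  Prod.ext rfl (Prod.ext rfl (Prod.ext (tl_eq_self h.1) (Prod.ext (tl_eq_self h.2) rfl)))

lemma emb_proj (x : WD) : emb (proj x) = emb x := rfl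

lemma trace_toMD_sl2 (X : sl2) : (toMD X.1).trace = 0 := by
  have : X.1.trace = 0 := X.2
  rw [trace_toMD, this, map_zero]

lemma isTl_iota (v : V) : IsTl (iota v) := ⟨trace_toMD_sl2 _, trace_toMD_sl2 _⟩

lemma IsTl.add {x y : WD} (hx : IsTl x) (hy : IsTl y) : IsTl (x + y) := by
  constructor
  · change (x.2.2.1 + y.2.2.1).trace = 0; rw [Matrix.trace_add, hx.1, hy.1, add_zero]
  · change (x.2.2.2.1 + y.2.2.2.1).trace = 0; rw [Matrix.trace_add, hx.2, hy.2, add_zero]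

lemma IsTl.smul (f : Dhat) {x : WD} (hx : IsTl x) : IsTl (f • x) := by
  constructor
  · change (f • x.2.2.1).trace = 0; rw [Matrix.trace_smul, hx.1, smul_zero]
  · change (f • x.2.2.2.1).trace = 0; rw [Matrix.trace_smul, hx.2, smul_zero]

lemma isTl_zero : IsTl 0 := ⟨Matrix.trace_zero _ _, Matrix.trace_zero _ _⟩

lemma isTl_ev (w : ℂ) (x : Ahat) : IsTl (ev w x) := by
  induction x using Ahat.induction with
  | h0 => rw [map_zero]; exact isTl_zero
  | hadd x y hx hy => rw [map_add]; exact hx.add hy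
  | h f p v => rw [ev_tmul]; exact (isTl_iota v).smul _

/-- `emb` in coordinates. -/
lemma emb_eq (x : WD) : emb x = x.1 • gen (1, 0, 0, 0, 0, 0) + x.2.1 • gen (0, 1, 0, 0, 0, 0)
    + (x.2.2.1 0 0 • gen (0, 0, slH, 0, 0, 0) + x.2.2.1 0 1 • gen (0, 0, slE, 0, 0, 0)
      + x.2.2.1 1 0 • gen (0, 0, slF, 0, 0, 0))
    + (x.2.2.2.1 0 0 • gen (0, 0, 0, slH, 0, 0) + x.2.2.2.1 0 1 • gen (0, 0, 0, slE, 0, 0)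
      + x.2.2.2.1 1 0 • gen (0, 0, 0, slF, 0, 0))
    + (∑ i, ∑ j, x.2.2.2.2.1 i j • gen (0, 0, 0, 0, Matrix.single i j 1, 0))
    + ∑ i, ∑ j, x.2.2.2.2.2 i j • gen (0, 0, 0, 0, 0, Matrix.single i j 1) := rfl

lemma toMD_slH : toMD slH.1 = !![1, 0; 0, -1] := by
  simp only [slH, LieAlgebra.SpecialLinear.val_singleSubSingle]
  ext i j : 1; fin_cases i <;> fin_cases j <;> simp [toMD, Matrix.single] <;> rfl

lemma toMD_slE : toMD slE.1 = !![0, 1; 0, 0] := by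
  simp only [slE, LieAlgebra.SpecialLinear.val_single]
  ext i j : 1; fin_cases i <;> fin_cases j <;> simp [toMD, Matrix.single]
  rfl

lemma toMD_slF : toMD slF.1 = !![0, 0; 1, 0] := by
  simp only [slF, LieAlgebra.SpecialLinear.val_single]
  ext i j : 1; fin_cases i <;> fin_cases j <;> simp [toMD, Matrix.single]
  rfl

lemma toMD_single (i j : Fin 2) : toMD (Matrix.single i j 1) = Matrix.single i j 1 := by
  rw [toMD, Matrix.map_single]
  · rw [map_one]

lemma ev_emb (w : ℂ) (x : WD) : ev w (emb x) = proj x := by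
  rw [emb_eq]
  simp only [map_add, map_sum, ev_smul_gen, iota_apply, toMD_slH, toMD_slE, toMD_slF, toMD_single,
    toMD_zero, map_zero, map_one, ZeroMemClass.coe_zero, Fin.sum_univ_two]
  obtain ⟨l, c, X, Y, M, N⟩ := x
  have hT : ∀ X : MD, X 0 0 • !![1, 0; 0, -1] + X 0 1 • !![0, 1; 0, 0] + X 1 0 • !![0, 0; 1, 0]
      = tl X := fun X => by
    ext i j : 1; fin_cases i <;> fin_cases j <;> simp [tl]
  have hM : ∀ X : MD, X 0 0 • Matrix.single 0 0 (1 : Dhat) + X 0 1 • Matrix.single 0 1 (1 : Dhat)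
      + (X 1 0 • Matrix.single 1 0 (1 : Dhat) + X 1 1 • Matrix.single 1 1 (1 : Dhat)) = X :=
    fun X => by
      ext i j : 1; fin_cases i <;> fin_cases j <;> simp [Matrix.single]
  refine Prod.ext ?_ (Prod.ext ?_ (Prod.ext ?_ (Prod.ext ?_ (Prod.ext ?_ ?_))))
  · simp [proj]
  · simp [proj]
  · simpa [proj] using hT X
  · simpa [proj] using hT Y
  · simpa [proj] using hM M
  · simpa [proj] using hM N

/-- The map `(x_k) ↦ ∑ ∂̂ ^ k x_k`. -/
def assemble : (ℕ →₀ WD) →ₗ[ℂ] Ahat :=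
  Finsupp.lsum ℂ fun k => (partialHat ^ k) ∘ₗ emb.restrictScalars ℂ

lemma assemble_single (k : ℕ) (x : WD) :
    assemble (Finsupp.single k x) = (partialHat ^ k) (emb x) := by
  simp [assemble]

lemma deltaHat_partialHat (x : Ahat) : deltaHat (partialHat x) = partialHat (deltaHat x) := by
  induction x using Ahat.induction with
  | h0 => simp
  | hadd x y hx hy => simp only [map_add, hx, hy]
  | h f p v =>
    rw [partialHat_tmul, map_add]
    change delta f ⊗ₜ[ℂ] ((Polynomial.X * p) ⊗ₜ[ℂ] v) + delta (delta f) ⊗ₜ[ℂ] (p ⊗ₜ[ℂ] v)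
      = partialHat (delta f ⊗ₜ[ℂ] (p ⊗ₜ[ℂ] v))
    rw [partialHat_tmul]

lemma smul_gen (f : Dhat) (v : V) : f • gen v = f ⊗ₜ[ℂ] ((1 : ℂ[X]) ⊗ₜ[ℂ] v) := by
  rw [gen, TensorProduct.smul_tmul', smul_eq_mul, mul_one]

lemma deltaHat_smul_gen (f : Dhat) (v : V) : deltaHat (f • gen v) = delta f • gen v := by
  rw [smul_gen, smul_gen]; rfl

lemma deltaHat_emb (x : WD) : deltaHat (emb x) = emb (deltaW x) := by
  rw [emb_eq, emb_eq]
  simp only [map_add, map_sum, deltaHat_smul_gen]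
  rfl

lemma deltaHat_partialHat_pow (k : ℕ) (x : Ahat) :
    deltaHat ((partialHat ^ k) x) = (partialHat ^ k) (deltaHat x) := by
  induction k generalizing x with
  | zero => rfl
  | succ k ih => rw [pow_succ, Module.End.mul_apply, Module.End.mul_apply, ih, deltaHat_partialHat]

lemma assemble_surjective : Function.Surjective assemble := by
  rw [← LinearMap.range_eq_top]
  have hp : ∀ x ∈ LinearMap.range assemble, partialHat x ∈ LinearMap.range assemble := by
    rintro _ ⟨a, rfl⟩
    induction a using Finsupp.induction_linear with
    | zero => simp
    | add a b ha hb => rw [map_add, map_add]; exact add_mem ha hb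
    | single k y =>
      refine ⟨Finsupp.single (k + 1) y, ?_⟩
      rw [assemble_single, assemble_single, pow_succ']; rfl
  have hd : ∀ x ∈ LinearMap.range assemble, deltaHat x ∈ LinearMap.range assemble := by
    rintro _ ⟨a, rfl⟩
    induction a using Finsupp.induction_linear with
    | zero => simp
    | add a b ha hb => rw [map_add, map_add]; exact add_mem ha hb
    | single k y =>
      refine ⟨Finsupp.single k (deltaW y), ?_⟩
      rw [assemble_single, assemble_single, deltaHat_partialHat_pow, deltaHat_emb]
  rw [eq_top_iff]
  rintro x -
  induction x using Ahat.induction with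
  | h0 => exact zero_mem _
  | hadd x y hx hy => exact add_mem hx hy
  | h f p v =>
    induction p using Polynomial.induction_on' with
    | add p q hp hq =>
      rw [TensorProduct.add_tmul, TensorProduct.tmul_add]; exact add_mem hp hq
    | monomial n z =>
      rw [← mul_one z, ← smul_eq_mul, ← Polynomial.smul_monomial, ← TensorProduct.smul_tmul',
        TensorProduct.tmul_smul]
      refine Submodule.smul_mem _ _ ?_
      induction n with
      | zero =>
        refine ⟨Finsupp.single 0 (f • iota v), ?_⟩
        rw [assemble_single, map_smul, emb_iota, pow_zero, Module.End.one_apply, smul_gen]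
        rfl
      | succ n ih =>
        -- `∂ = ∂̂ - δ_t`
        have e : f ⊗ₜ[ℂ] ((Polynomial.monomial (n + 1) (1 : ℂ)) ⊗ₜ[ℂ] v)
            = partialHat (f ⊗ₜ[ℂ] ((Polynomial.monomial n (1 : ℂ)) ⊗ₜ[ℂ] v))
              - deltaHat (f ⊗ₜ[ℂ] ((Polynomial.monomial n (1 : ℂ)) ⊗ₜ[ℂ] v)) := by
          rw [partialHat_tmul, Polynomial.X_mul_monomial]
          exact (add_sub_cancel_right _ _).symm
        rw [e]
        exact sub_mem (hp _ ih) (hd _ ih)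

lemma ev_partialHat_pow (w : ℂ) (k : ℕ) (x : Ahat) :
    ev w ((partialHat ^ k) x) = w ^ k • ev w x := by
  induction k with
  | zero => simp
  | succ k ih => rw [pow_succ', Module.End.mul_apply, ev_partialHat, ih, smul_smul, pow_succ']

lemma ev_assemble (w : ℂ) (a : ℕ →₀ WD) :
    ev w (assemble a) = a.sum fun k x => w ^ k • proj x := by
  rw [assemble, Finsupp.lsum_apply, Finsupp.sum, map_sum]
  refine Finset.sum_congr rfl fun k _ => ?_
  change ev w ((partialHat ^ k) (emb (a k))) = _
  rw [ev_partialHat_pow, ev_emb]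

/-- A polynomial with coefficients in a complex vector space that vanishes at all complex numbers has
vanishing coefficients. -/
lemma eq_zero_of_forall_sum_pow_smul {E : Type*} [AddCommGroup E] [Module ℂ E] {s : Finset ℕ}
    {a : ℕ → E} (h : ∀ w : ℂ, ∑ k ∈ s, w ^ k • a k = 0) {k : ℕ} (hk : k ∈ s) : a k = 0 := by
  rw [← Module.forall_dual_apply_eq_zero_iff ℂ]
  intro φ
  have hP : (∑ k ∈ s, Polynomial.monomial k (φ (a k)) : ℂ[X]) = 0 := by
    refine Polynomial.funext fun w => ?_
    have := congrArg φ (h w)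
    simp only [map_sum, map_smul, smul_eq_mul, map_zero] at this
    simp only [Polynomial.eval_finsetSum, Polynomial.eval_monomial, Polynomial.eval_zero]
    rw [← this]
    exact Finset.sum_congr rfl fun k _ => mul_comm _ _
  have := congrArg (fun P : ℂ[X] => P.coeff k) hP
  simpa [Polynomial.finsetSum_coeff, Polynomial.coeff_monomial, hk] using this

/-- An element of `𝒜 ⊗ D̂` is determined by its values at `∂̂ = w`, for all complex `w`. -/
lemma eq_zero_of_ev {x : Ahat} (h : ∀ w, ev w x = 0) : x = 0 := by
  obtain ⟨a, rfl⟩ := assemble_surjective x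
  simp only [ev_assemble] at h
  rw [assemble, Finsupp.lsum_apply]
  refine Finset.sum_eq_zero fun k hk => ?_
  have := eq_zero_of_forall_sum_pow_smul (a := fun k => proj (a k)) h hk
  change (partialHat ^ k) (emb (a k)) = 0
  rw [← emb_proj, this, map_zero, map_zero]

lemma ev_ext {x y : Ahat} (h : ∀ w, ev w x = ev w y) : x = y :=
  sub_eq_zero.1 (eq_zero_of_ev fun w => by rw [map_sub, h, sub_self])

/-! ### The `λ`-bracket under evaluation -/

/-- The operator `λ + δ_t` of `D̂`, by which `λ` acts on the coefficient of the first factor. -/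
def opl (l : ℂ) : Dhat →ₗ[ℂ] Dhat := l • LinearMap.id + (delta : Dhat →ₗ[ℂ] Dhat)

lemma opl_apply (l : ℂ) (f : Dhat) : opl l f = l • f + delta f := rfl

/-- The value at `∂̂ = s` of `∑ (λ + δ_t) ^ m (f) g P_m(∂)`, for `P = ∑ P_m(∂) λ ^ m`. -/
def brCoeff (l s : ℂ) (f g : Dhat) : ℂ[X][X] →ₗ[ℂ] Dhat :=
  Polynomial.lsum fun m => (Polynomial.aeval (opw s)).toLinearMap.flip (((opl l) ^ m) f * g)

lemma brCoeff_monomial (l s : ℂ) (f g : Dhat) (m : ℕ) (p : ℂ[X]) :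
    brCoeff l s f g (Polynomial.monomial m p) = Polynomial.aeval (opw s) p (((opl l) ^ m) f * g) := by
  rw [brCoeff, Polynomial.lsum_apply, Polynomial.sum_monomial_index]
  · rfl
  · exact map_zero _

lemma brCoeff_one (l s : ℂ) (f g : Dhat) : brCoeff l s f g 1 = f * g := by
  rw [← Polynomial.monomial_zero_one, brCoeff_monomial, map_one (Polynomial.aeval (opw s))]; rfl

lemma brCoeff_lVar_mul (l s : ℂ) (f g : Dhat) (P : ℂ[X][X]) :
    brCoeff l s f g (lVar * P) = brCoeff l s (opl l f) g P := by
  induction P using Polynomial.induction_on' with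
  | add P Q hP hQ => rw [mul_add, map_add, map_add, hP, hQ]
  | monomial m p =>
    rw [lVar, Polynomial.X_mul_monomial, brCoeff_monomial, brCoeff_monomial, pow_succ]; rfl

lemma brCoeff_dVar_mul (l s : ℂ) (f g : Dhat) (P : ℂ[X][X]) :
    brCoeff l s f g (dVar * P) = opw s (brCoeff l s f g P) := by
  induction P using Polynomial.induction_on' with
  | add P Q hP hQ => rw [mul_add, map_add, map_add, map_add, hP, hQ]
  | monomial m p =>
    rw [dVar, Polynomial.C_mul_monomial, brCoeff_monomial, brCoeff_monomial, aeval_opw_X_mul]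

lemma opl_pow_delta (l : ℂ) (m : ℕ) (f : Dhat) :
    ((opl l) ^ m) (delta f) = delta (((opl l) ^ m) f) := by
  induction m generalizing f with
  | zero => rfl
  | succ m ih =>
    have h : opl l (delta f) = delta (opl l f) := by
      rw [opl_apply, opl_apply, map_add, Derivation.map_smul]
    rw [pow_succ, Module.End.mul_apply, Module.End.mul_apply, h, ih]

lemma brCoeff_delta (l s : ℂ) (f g : Dhat) (P : ℂ[X][X]) :
    delta (brCoeff l s f g P) = brCoeff l s (delta f) g P + brCoeff l s f (delta g) P := by
  induction P using Polynomial.induction_on' with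
  | add P Q hP hQ => simp only [map_add, hP, hQ]; abel
  | monomial m p =>
    rw [brCoeff_monomial, brCoeff_monomial, brCoeff_monomial, ← aeval_opw_delta, opl_pow_delta,
      ← map_add, Derivation.leibniz, smul_eq_mul, smul_eq_mul, mul_comm g, add_comm]

lemma brCoeff_add_left (l s : ℂ) (f f' g : Dhat) (P : ℂ[X][X]) :
    brCoeff l s (f + f') g P = brCoeff l s f g P + brCoeff l s f' g P := by
  induction P using Polynomial.induction_on' with
  | add P Q hP hQ => simp only [map_add, hP, hQ]; abel
  | monomial m p => simp only [brCoeff_monomial, map_add, add_mul]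

lemma brCoeff_smul_left (l s r : ℂ) (f g : Dhat) (P : ℂ[X][X]) :
    brCoeff l s (r • f) g P = r • brCoeff l s f g P := by
  induction P using Polynomial.induction_on' with
  | add P Q hP hQ => simp only [map_add, hP, hQ, smul_add]
  | monomial m p => simp only [brCoeff_monomial, map_smul, smul_mul_assoc]

lemma brCoeff_add_right (l s : ℂ) (f g g' : Dhat) (P : ℂ[X][X]) :
    brCoeff l s f (g + g') P = brCoeff l s f g P + brCoeff l s f g' P := by
  induction P using Polynomial.induction_on' with
  | add P Q hP hQ => simp only [map_add, hP, hQ]; abel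
  | monomial m p => simp only [brCoeff_monomial, map_add, mul_add]

lemma brCoeff_smul_right (l s r : ℂ) (f g : Dhat) (P : ℂ[X][X]) :
    brCoeff l s f (r • g) P = r • brCoeff l s f g P := by
  induction P using Polynomial.induction_on' with
  | add P Q hP hQ => simp only [map_add, hP, hQ, smul_add]
  | monomial m p => simp only [brCoeff_monomial, map_smul, mul_smul_comm]

lemma brCoeff_neg_lVar_mul (u s : ℂ) (f g : Dhat) (P : ℂ[X][X]) :
    brCoeff (-u) s f g (-lVar * P) = brCoeff (-u) s (opw u f) g P := by
  have : opw u f = (-1 : ℂ) • opl (-u) f := by rw [opw_apply, opl_apply]; module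
  have e : -lVar * P = (-1 : ℂ) • (lVar * P) := by rw [neg_one_smul]; ring
  rw [this, brCoeff_smul_left, ← brCoeff_lVar_mul, e, map_smul]

lemma brCoeff_dVar_add_lVar_mul (u w : ℂ) (f g : Dhat) (P : ℂ[X][X]) :
    brCoeff (-u) (u + w) f g ((dVar + lVar) * P) = brCoeff (-u) (u + w) f (opw w g) P := by
  have h1 : opw w g = w • g + (-1 : ℂ) • delta g := by rw [opw_apply]; module
  rw [add_mul, map_add, brCoeff_lVar_mul, brCoeff_dVar_mul, opw_apply, brCoeff_delta, h1,
    brCoeff_add_right, brCoeff_smul_right, brCoeff_smul_right, opl_apply, brCoeff_add_left,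
    brCoeff_smul_left]
  module

lemma brCoeff_aeval_left (u s : ℂ) (f g : Dhat) (p : ℂ[X]) (P : ℂ[X][X]) :
    brCoeff (-u) s f g (Polynomial.aeval (-lVar) p * P)
      = brCoeff (-u) s (Polynomial.aeval (opw u) p f) g P := by
  induction p using Polynomial.induction_on generalizing f with
  | C a =>
    rw [Polynomial.aeval_C, Polynomial.aeval_C, ← Algebra.smul_def, map_smul,
      Module.algebraMap_end_apply, brCoeff_smul_left]
  | add p q hp hq =>
    rw [map_add, map_add, add_mul, map_add, hp, hq, LinearMap.add_apply, brCoeff_add_left]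
  | monomial n a ih =>
    rw [pow_succ', ← mul_assoc, mul_comm (Polynomial.C a), mul_assoc,
      map_mul (Polynomial.aeval (-lVar)), Polynomial.aeval_X,
      mul_assoc, brCoeff_neg_lVar_mul, ih, aeval_opw_opw,
      aeval_opw_X_mul]

lemma brCoeff_aeval_right (u w : ℂ) (f g : Dhat) (p : ℂ[X]) (P : ℂ[X][X]) :
    brCoeff (-u) (u + w) f g (Polynomial.aeval (dVar + lVar) p * P)
      = brCoeff (-u) (u + w) f (Polynomial.aeval (opw w) p g) P := by
  induction p using Polynomial.induction_on generalizing g with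
  | C a =>
    rw [Polynomial.aeval_C, Polynomial.aeval_C, ← Algebra.smul_def, map_smul,
      Module.algebraMap_end_apply, brCoeff_smul_right]
  | add p q hp hq =>
    rw [map_add, map_add, add_mul, map_add, hp, hq, LinearMap.add_apply, brCoeff_add_right]
  | monomial n a ih =>
    rw [pow_succ', ← mul_assoc, mul_comm (Polynomial.C a), mul_assoc,
      map_mul (Polynomial.aeval (dVar + lVar)), Polynomial.aeval_X,
      mul_assoc, brCoeff_dVar_add_lVar_mul, ih, aeval_opw_opw,
      aeval_opw_X_mul]

lemma brCoeff_mul_sesqui (u w : ℂ) (f g : Dhat) (p q : ℂ[X]) (P : ℂ[X][X]) :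
    brCoeff (-u) (u + w) f g (P * sesqui p q) = brCoeff (-u) (u + w)
      (Polynomial.aeval (opw u) p f) (Polynomial.aeval (opw w) q g) P := by
  have : P * sesqui p q
      = Polynomial.aeval (-lVar) p * (Polynomial.aeval (dVar + lVar) q * P) := by
    change P * (Polynomial.aeval (-lVar) p * Polynomial.aeval (dVar + lVar) q) = _
    ring
  rw [this, brCoeff_aeval_left, brCoeff_aeval_right]

/-- The partial sum of the `λ`-bracket `∑ λ ^ n / n! x_(n) y`, at `λ = l`, with the terms
`nprodTerm n j x y` for `n, j < N`. It does not depend on `N` once `N` is large. -/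
def lam (l : ℂ) (N : ℕ) : Ahat →ₗ[ℂ] Ahat →ₗ[ℂ] Ahat :=
  ∑ n ∈ Finset.range N, ∑ j ∈ Finset.range N, (l ^ n * (n.factorial : ℂ)⁻¹) • nprodTerm n j

lemma lam_apply (l : ℂ) (N : ℕ) (x y : Ahat) : lam l N x y
    = ∑ n ∈ Finset.range N, ∑ j ∈ Finset.range N,
        (l ^ n * (n.factorial : ℂ)⁻¹) • nprodTerm n j x y := by
  simp [lam, LinearMap.sum_apply]

open Filter in
lemma eventually_nprodTerm_eq_zero (x y : Ahat) :
    ∀ᶠ N : ℕ in atTop, ∀ n j, N ≤ n + j → nprodTerm n j x y = 0 := by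
  induction x using TensorProduct.induction_on with
  | zero => simp
  | add x₁ x₂ h₁ h₂ =>
    filter_upwards [h₁, h₂] with N h₁ h₂ n j h
    rw [map_add, LinearMap.add_apply, h₁ n j h, h₂ n j h, add_zero]
  | tmul f a =>
    induction y using TensorProduct.induction_on with
    | zero => simp
    | add y₁ y₂ h₁ h₂ =>
      filter_upwards [h₁, h₂] with N h₁ h₂ n j h
      rw [map_add, h₁ n j h, h₂ n j h, add_zero]
    | tmul g b =>
      obtain ⟨K, hK⟩ := (nprod_finite a b).bddAbove
      filter_upwards [eventually_gt_atTop K] with N hN n j h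
      have : nprod (n + j) a b = 0 := by
        by_contra hne
        exact absurd (hK hne) (by omega)
      change (dividedDelta j f * g) ⊗ₜ[ℂ] (nprod (n + j) a b) = 0
      rw [this, TensorProduct.tmul_zero]

lemma nprodHat_eq_sum {x y : Ahat} {N : ℕ} (h : ∀ n j, N ≤ n + j → nprodTerm n j x y = 0) (n : ℕ) :
    nprodHat n x y = ∑ j ∈ Finset.range N, nprodTerm n j x y := by
  apply finsum_eq_sum_of_support_subset
  intro j hj
  by_contra hlt
  simp only [Finset.coe_range, Set.mem_Iio, not_lt] at hlt
  exact hj (h n j (by omega))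

lemma lam_eq_sum_nprodHat {x y : Ahat} {N : ℕ} (h : ∀ n j, N ≤ n + j → nprodTerm n j x y = 0)
    (l : ℂ) : lam l N x y
      = ∑ n ∈ Finset.range N, (l ^ n * (n.factorial : ℂ)⁻¹) • nprodHat n x y := by
  rw [lam_apply]
  refine Finset.sum_congr rfl fun n _ => ?_
  rw [nprodHat_eq_sum h, Finset.smul_sum]

lemma opl_pow_apply (l : ℂ) (m : ℕ) (f : Dhat) : ((opl l) ^ m) f
    = ∑ k ∈ Finset.range (m + 1),
        (l ^ k * (m.choose k : ℂ)) • ((delta : Dhat →ₗ[ℂ] Dhat) ^ (m - k)) f := by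
  have hc : Commute (l • (1 : Module.End ℂ Dhat)) (delta : Dhat →ₗ[ℂ] Dhat) :=
    (Commute.one_left _).smul_left l
  change ((l • (1 : Module.End ℂ Dhat) + (delta : Dhat →ₗ[ℂ] Dhat)) ^ m) f = _
  rw [hc.add_pow, LinearMap.sum_apply]
  refine Finset.sum_congr rfl fun k _ => ?_
  rw [smul_pow, one_pow, smul_mul_assoc, one_mul, ← nsmul_eq_mul', mul_comm, mul_smul]
  simp only [LinearMap.smul_apply, Nat.cast_smul_eq_nsmul]

/-- On pure tensors, `λ` acts on the first coefficient by `λ + δ_t`. -/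
lemma lam_tmul {f g : Dhat} {a b : A} {N : ℕ}
    (h : ∀ n j, N ≤ n + j → nprodTerm n j (f ⊗ₜ[ℂ] a) (g ⊗ₜ[ℂ] b) = 0) (l : ℂ) :
    lam l N (f ⊗ₜ[ℂ] a) (g ⊗ₜ[ℂ] b) = ∑ m ∈ Finset.range N,
      (((opl l) ^ m) f * g) ⊗ₜ[ℂ] lambdaCoeff m (lambdaBracket a b) := by
  have h1 : lam l N (f ⊗ₜ[ℂ] a) (g ⊗ₜ[ℂ] b) = ∑ n ∈ Finset.range N, ∑ j ∈ Finset.range (N - n),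
      (l ^ n * (n.factorial : ℂ)⁻¹) • nprodTerm n j (f ⊗ₜ[ℂ] a) (g ⊗ₜ[ℂ] b) := by
    rw [lam_apply]
    refine Finset.sum_congr rfl fun n _ => ?_
    symm
    apply Finset.sum_subset
    · intro j hj; simp only [Finset.mem_range] at hj ⊢; omega
    · intro j _ hj
      rw [h n j (by simp only [Finset.mem_range] at hj; omega), smul_zero]
  rw [h1, ← Finset.sum_range_diag_flip N fun n j =>
    (l ^ n * (n.factorial : ℂ)⁻¹) • nprodTerm n j (f ⊗ₜ[ℂ] a) (g ⊗ₜ[ℂ] b)]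
  refine Finset.sum_congr rfl fun m _ => ?_
  rw [opl_pow_apply, Finset.sum_mul, TensorProduct.sum_tmul]
  refine Finset.sum_congr rfl fun k hk => ?_
  have hkm : k ≤ m := Nat.lt_succ_iff.1 (Finset.mem_range.1 hk)
  have e : nprodTerm k (m - k) (f ⊗ₜ[ℂ] a) (g ⊗ₜ[ℂ] b)
      = (((m - k).factorial : ℂ)⁻¹ • ((delta : Dhat →ₗ[ℂ] Dhat) ^ (m - k)) f * g) ⊗ₜ[ℂ]
        ((m.factorial : ℂ) • lambdaCoeff m (lambdaBracket a b)) := by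
    have : k + (m - k) = m := by omega
    change (dividedDelta (m - k) f * g) ⊗ₜ[ℂ] (nprod (k + (m - k)) a b) = _
    rw [this]; rfl
  rw [e, smul_mul_assoc, smul_mul_assoc, ← TensorProduct.smul_tmul', ← TensorProduct.smul_tmul',
    TensorProduct.tmul_smul, smul_smul, smul_smul, Nat.cast_choose ℂ hkm]
  congr 1
  ring

open Filter in
/-- The `λ`-bracket of `𝒜 ⊗ D̂` becomes, under evaluation, the bracket `beta` of `D̂ ⊗ V`: the value
at `∂̂ = u + w` of `[x_λ y]`, for `λ = -u`, depends on the values of `x` at `u` and `y` at `w`. -/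
lemma ev_lam (u w : ℂ) (x y : Ahat) :
    ∀ᶠ N : ℕ in atTop, ev (u + w) (lam (-u) N x y) = beta u w (ev u x) (ev w y) := by
  induction x using Ahat.induction with
  | h0 => simp [beta_zero_left]
  | hadd x₁ x₂ h₁ h₂ =>
    filter_upwards [h₁, h₂] with N h₁ h₂
    rw [map_add, LinearMap.add_apply, map_add, h₁, h₂, map_add, beta_add_left]
  | h f p v =>
    induction y using Ahat.induction with
    | h0 => simp [beta_zero_right]
    | hadd y₁ y₂ h₁ h₂ =>
      filter_upwards [h₁, h₂] with N h₁ h₂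
      rw [map_add, map_add, h₁, h₂, map_add, beta_add_right]
    | h g q v' =>
      have key : ∀ (P : ℂ[X][X]) (r : V), ∀ᶠ N : ℕ in atTop, ev (u + w)
          (∑ m ∈ Finset.range N, (((opl (-u)) ^ m) f * g) ⊗ₜ[ℂ] lambdaCoeff m (P ⊗ₜ[ℂ] r))
            = brCoeff (-u) (u + w) f g P • iota r := by
        intro P r
        filter_upwards [eventually_gt_atTop P.natDegree] with N hN
        rw [map_sum, brCoeff, Polynomial.lsum_apply, Polynomial.sum_over_range' _ _ N hN,
          Finset.sum_smul]
        · rfl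
        · intro n; exact map_zero _
      filter_upwards [eventually_nprodTerm_eq_zero (f ⊗ₜ[ℂ] (p ⊗ₜ[ℂ] v)) (g ⊗ₜ[ℂ] (q ⊗ₜ[ℂ] v')),
        key (sesqui p q) (brConst v v'), key (dVar * sesqui p q) (brPartial v v'),
        key (lVar * sesqui p q) (brLambda v v')] with N hN h1 h2 h3
      have e : lambdaBracket (p ⊗ₜ[ℂ] v) (q ⊗ₜ[ℂ] v') = sesqui p q ⊗ₜ[ℂ] brConst v v'
          + (dVar * sesqui p q) ⊗ₜ[ℂ] brPartial v v' + (lVar * sesqui p q) ⊗ₜ[ℂ] brLambda v v' := rfl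
      rw [lam_tmul hN, e]
      simp only [map_add, TensorProduct.tmul_add, Finset.sum_add_distrib]
      rw [h1, h2, h3, ev_tmul, ev_tmul, beta_smul_iota]
      have c1 := brCoeff_mul_sesqui u w f g p q 1
      rw [one_mul, brCoeff_one] at c1
      have c2 := brCoeff_mul_sesqui u w f g p q dVar
      rw [← mul_one dVar, brCoeff_dVar_mul, brCoeff_one, mul_one, opw_apply, Derivation.leibniz] at c2
      have c3 := brCoeff_mul_sesqui u w f g p q lVar
      rw [← mul_one lVar, brCoeff_lVar_mul, brCoeff_one, mul_one, opl_apply, add_mul,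
        smul_mul_assoc] at c3
      rw [c1, c2, c3]
      congr 3
      simp only [smul_eq_mul]
      ring

lemma lam_eq_of_le {x y : Ahat} {N N' : ℕ} (h : ∀ n j, N ≤ n + j → nprodTerm n j x y = 0)
    (hN : N ≤ N') (l : ℂ) : lam l N x y = lam l N' x y := by
  have h' : ∀ n j, N' ≤ n + j → nprodTerm n j x y = 0 := fun n j hj => h n j (hN.trans hj)
  rw [lam_eq_sum_nprodHat h, lam_eq_sum_nprodHat h']
  apply Finset.sum_subset
  · intro j hj; simp only [Finset.mem_range] at hj ⊢; omega
  · intro n _ hn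
    rw [nprodHat_eq_sum h, Finset.sum_eq_zero, smul_zero]
    intro j _
    exact h n j (by simp only [Finset.mem_range] at hn; omega)

lemma ev_lam_of_bound {x y : Ahat} {N : ℕ} (h : ∀ n j, N ≤ n + j → nprodTerm n j x y = 0)
    (u w : ℂ) : ev (u + w) (lam (-u) N x y) = beta u w (ev u x) (ev w y) := by
  obtain ⟨N', hN', hle⟩ := ((ev_lam u w x y).and (Filter.eventually_ge_atTop N)).exists
  rw [lam_eq_of_le h hle, hN']

lemma beta_iota (u w : ℂ) (v v' : V) : beta u w (iota v) (iota v') = iota (brConst v v')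
    + (u + w) • iota (brPartial v v') - u • iota (brLambda v v') := by
  have h := beta_smul_iota u w 1 1 v v'
  simp only [one_smul, mul_one, Derivation.map_one_eq_zero, sub_zero, add_zero, zero_mul, mul_zero,
    smul_assoc, neg_smul, ← sub_eq_add_neg] at h
  exact h

/-- An automorphism `φ` is a family of maps `v ↦ ev w (φ v)` on `V`, indexed by `w ∈ ℂ`, that
intertwines the brackets. -/
lemma AutConf.beta_ev (φ : AutConf) (u w : ℂ) (v v' : V) :
    beta u w (ev u (φ.1 (gen v))) (ev w (φ.1 (gen v')))
      = ev (u + w) (φ.1 (gen (brConst v v'))) + (u + w) • ev (u + w) (φ.1 (gen (brPartial v v')))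
        - u • ev (u + w) (φ.1 (gen (brLambda v v'))) := by
  obtain ⟨_, _, hpar, hn⟩ := φ.2
  obtain ⟨N, hN, hN'⟩ := ((eventually_nprodTerm_eq_zero (gen v) (gen v')).and
    (eventually_nprodTerm_eq_zero (φ.1 (gen v)) (φ.1 (gen v')))).exists
  have hC : ∀ (z : ℂ) (x : Ahat), φ.1 (z • x) = z • φ.1 x := fun z x => by
    rw [← algebraMap_smul Dhat z x, map_smul, algebraMap_smul]
  have h1 : lam (-u) N (gen v) (gen v') = gen (brConst v v') + partialHat (gen (brPartial v v'))
      - u • gen (brLambda v v') := by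
    refine ev_ext fun s => ?_
    have := ev_lam_of_bound hN u (s - u)
    rw [add_sub_cancel] at this
    rw [this, ev_gen, ev_gen, beta_iota, map_sub, map_add, map_smul, ev_partialHat, ev_gen, ev_gen,
      ev_gen, add_sub_cancel]
  have h2 : lam (-u) N (φ.1 (gen v)) (φ.1 (gen v')) = φ.1 (lam (-u) N (gen v) (gen v')) := by
    rw [lam_eq_sum_nprodHat hN, lam_eq_sum_nprodHat hN', map_sum]
    refine Finset.sum_congr rfl fun n _ => ?_
    rw [hC, hn]
  rw [← ev_lam_of_bound hN', h2, h1, map_sub, map_add, hC, hpar, map_sub, map_add, map_smul,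
    ev_partialHat]

/-- Conversely, a map that acts on all values by one fixed map of `D̂ ⊗ V` preserves the
`n`-products as soon as that fixed map preserves `beta`. -/
lemma map_nprodHat_of_beta {F : Ahat →ₗ[ℂ] Ahat} {F₀ : WD → WD}
    (hF : ∀ w x, ev w (F x) = F₀ (ev w x))
    (hβ : ∀ u w x y, IsTl x → IsTl y → beta u w (F₀ x) (F₀ y) = F₀ (beta u w x y))
    (n : ℕ) (x y : Ahat) : F (nprodHat n x y) = nprodHat n (F x) (F y) := by
  obtain ⟨N, ⟨hN, hN'⟩, hnN⟩ := (((eventually_nprodTerm_eq_zero x y).and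
    (eventually_nprodTerm_eq_zero (F x) (F y))).and (Filter.eventually_gt_atTop n)).exists
  have h1 : ∀ l : ℂ, F (lam l N x y) = lam l N (F x) (F y) := by
    intro l
    refine ev_ext fun s => ?_
    have e1 := ev_lam_of_bound hN (-l) (s + l)
    have e2 := ev_lam_of_bound hN' (-l) (s + l)
    rw [show -l + (s + l) = s by ring, neg_neg] at e1 e2
    rw [hF, e1, e2, hF, hF, hβ _ _ _ _ (isTl_ev _ _) (isTl_ev _ _)]
  have h2 : ∀ l : ℂ, ∑ k ∈ Finset.range N, l ^ k •
      ((k.factorial : ℂ)⁻¹ • (F (nprodHat k x y) - nprodHat k (F x) (F y))) = 0 := by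
    intro l
    have := h1 l
    rw [lam_eq_sum_nprodHat hN, lam_eq_sum_nprodHat hN', map_sum, ← sub_eq_zero,
      ← Finset.sum_sub_distrib] at this
    rw [← this]
    refine Finset.sum_congr rfl fun k _ => ?_
    rw [map_smul, smul_smul, smul_sub]
  have h3 := eq_zero_of_forall_sum_pow_smul h2 (Finset.mem_range.2 hnN)
  rw [smul_eq_zero] at h3
  rcases h3 with h3 | h3
  · exact absurd h3 (inv_ne_zero (Nat.cast_ne_zero.2 n.factorial_ne_zero))
  · exact sub_eq_zero.1 h3

/-! ### Extension of maps of `D̂ ⊗ V` to `𝒜 ⊗ D̂` -/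

/-- The `D̂`-linear map of `𝒜 ⊗ D̂` that commutes with `∂̂` and restricts to `F` on `D̂ ⊗ V`. -/
def extendMap (F : WD →ₗ[Dhat] WD) : Ahat →ₗ[Dhat] Ahat :=
  LinearMap.liftBaseChange Dhat (TensorProduct.lift
    (LinearMap.compl₂ (Polynomial.aeval partialHat).toLinearMap
      ((emb ∘ₗ F).restrictScalars ℂ ∘ₗ iota)))

lemma extendMap_tmul (F : WD →ₗ[Dhat] WD) (f : Dhat) (p : ℂ[X]) (v : V) :
    extendMap F (f ⊗ₜ[ℂ] (p ⊗ₜ[ℂ] v)) = f • Polynomial.aeval partialHat p (emb (F (iota v))) := by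
  rw [extendMap, LinearMap.liftBaseChange_tmul]; rfl

lemma extendMap_partialHat (F : WD →ₗ[Dhat] WD) (x : Ahat) :
    extendMap F (partialHat x) = partialHat (extendMap F x) := by
  induction x using Ahat.induction with
  | h0 => simp
  | hadd x y hx hy => simp only [map_add, hx, hy]
  | h f p v =>
    rw [partialHat_tmul, map_add, extendMap_tmul, extendMap_tmul, extendMap_tmul, partialHat_smul,
      map_mul (Polynomial.aeval partialHat), Polynomial.aeval_X]
    rfl

lemma extendMap_smul_gen (F : WD →ₗ[Dhat] WD) (f : Dhat) (v : V) :
    extendMap F (f • gen v) = f • emb (F (iota v)) := by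
  rw [smul_gen, extendMap_tmul, map_one (Polynomial.aeval partialHat)]; rfl

lemma proj_mem_span (x : WD) : proj x ∈ Submodule.span Dhat (Set.range iota) := by
  have h : ∀ (f : Dhat) (v : V), f • iota v ∈ Submodule.span Dhat (Set.range iota) := fun f v =>
    Submodule.smul_mem _ _ (Submodule.subset_span ⟨v, rfl⟩)
  rw [← ev_emb 0, emb_eq]
  simp only [map_add, map_sum, ev_smul_gen]
  exact add_mem (add_mem (add_mem (add_mem (add_mem (h _ _) (h _ _))
    (add_mem (add_mem (h _ _) (h _ _)) (h _ _))) (add_mem (add_mem (h _ _) (h _ _)) (h _ _)))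
    (sum_mem fun i _ => sum_mem fun j _ => h _ _)) (sum_mem fun i _ => sum_mem fun j _ => h _ _)

lemma extendMap_emb (F : WD →ₗ[Dhat] WD) (x : WD) : extendMap F (emb x) = emb (F (proj x)) := by
  rw [← emb_proj x]
  have h := proj_mem_span x
  generalize proj x = y at h
  induction h using Submodule.closure_induction with
  | zero => simp
  | add y z _ _ hy hz => simp only [map_add, hy, hz]
  | smul_mem f y hy =>
    obtain ⟨v, rfl⟩ := hy
    rw [map_smul, emb_iota, extendMap_smul_gen, map_smul, map_smul]

lemma extendMap_partialHat_pow (F : WD →ₗ[Dhat] WD) (k : ℕ) (x : Ahat) :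
    extendMap F ((partialHat ^ k) x) = (partialHat ^ k) (extendMap F x) := by
  induction k with
  | zero => rfl
  | succ k ih => rw [pow_succ', Module.End.mul_apply, Module.End.mul_apply, extendMap_partialHat, ih]

lemma ev_extendMap {F : WD →ₗ[Dhat] WD} (hF : ∀ x, IsTl x → IsTl (F x)) (w : ℂ) (x : Ahat) :
    ev w (extendMap F x) = F (ev w x) := by
  obtain ⟨a, rfl⟩ := assemble_surjective x
  induction a using Finsupp.induction_linear with
  | zero => simp
  | add a b ha hb => simp only [map_add, ha, hb]
  | single k y =>
    rw [assemble_single, extendMap_partialHat_pow, ev_partialHat_pow, ev_partialHat_pow,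
      extendMap_emb, ev_emb,
      ev_emb, proj_eq_self (hF _ (isTl_proj y)), LinearMap.map_smul_of_tower]

/-- Membership in `extend W` can be tested on values. -/
lemma mem_extend_iff {W : Submodule ℂ V} {E : Type*} [AddCommGroup E] [Module Dhat E] [Module ℂ E]
    [IsScalarTower ℂ Dhat E] (T : WD →ₗ[Dhat] E) (h1 : ∀ v ∈ W, T (iota v) = 0)
    (h2 : ∀ x, T (proj x) = 0 → emb x ∈ extend W) (x : Ahat) :
    x ∈ extend W ↔ ∀ w, T (ev w x) = 0 := by
  constructor
  · intro hx w
    induction hx using Submodule.closure_induction with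
    | zero => simp
    | add y z _ _ hy hz => simp only [map_add, hy, hz, add_zero]
    | smul_mem f y hy =>
      obtain ⟨p, v, hv, rfl⟩ := hy
      rw [TensorProduct.smul_tmul', ev_tmul, map_smul, h1 v hv, smul_zero]
  · intro hx
    have hpar : ∀ y ∈ extend W, partialHat y ∈ extend W := by
      intro y hy
      induction hy using Submodule.closure_induction with
      | zero => simp
      | add y z _ _ hy hz => rw [map_add]; exact add_mem hy hz
      | smul_mem f y hy =>
        obtain ⟨p, v, hv, rfl⟩ := hy
        rw [partialHat_smul, partialHat_tmul, Derivation.map_one_eq_zero, TensorProduct.zero_tmul,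
          add_zero]
        exact add_mem (Submodule.smul_mem _ _ (Submodule.subset_span ⟨_, v, hv, rfl⟩))
          (Submodule.smul_mem _ _ (Submodule.subset_span ⟨_, v, hv, rfl⟩))
    have hk : ∀ k, ∀ y ∈ extend W, (partialHat ^ k) y ∈ extend W := by
      intro k
      induction k with
      | zero => exact fun y hy => hy
      | succ k ih => intro y hy; rw [pow_succ', Module.End.mul_apply]; exact hpar _ (ih y hy)
    obtain ⟨a, rfl⟩ := assemble_surjective x
    rw [assemble, Finsupp.lsum_apply]
    refine sum_mem fun k hks => ?_
    refine hk k _ (h2 _ ?_)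
    refine eq_zero_of_forall_sum_pow_smul (a := fun k => T (proj (a k))) (fun w => ?_) hks
    have := hx w
    rw [ev_assemble, Finsupp.sum, map_sum] at this
    rw [← this]
    exact Finset.sum_congr rfl fun k _ => (LinearMap.map_smul_of_tower T _ _).symm

/-- The projection of `WD` to the coefficients of the odd generators. -/
def oddCoords : WD →ₗ[Dhat] MD × MD where
  toFun x := (x.2.2.2.2.1, x.2.2.2.2.2)
  map_add' _ _ := rfl
  map_smul' _ _ := rfl

/-- The projection of `WD` to the coefficients of the even generators. -/
def evenCoords : WD →ₗ[Dhat] Dhat × Dhat × MD × MD where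
  toFun x := (x.1, x.2.1, x.2.2.1, x.2.2.2.1)
  map_add' _ _ := rfl
  map_smul' _ _ := rfl

lemma smul_gen_mem_extend {W : Submodule ℂ V} (f : Dhat) {v : V} (hv : v ∈ W) :
    f • gen v ∈ extend W := Submodule.smul_mem _ _ (Submodule.subset_span ⟨1, v, hv, rfl⟩)

lemma mem_evenPart_iff (x : Ahat) : x ∈ evenPart ↔ ∀ w, oddCoords (ev w x) = 0 := by
  refine mem_extend_iff oddCoords ?_ ?_ x
  · rintro ⟨l, c, X, Y, M, N⟩ ⟨hM, hN⟩
    change M = 0 at hM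
    change N = 0 at hN
    subst hM hN
    exact Prod.ext toMD_zero toMD_zero
  · rintro ⟨l, c, X, Y, M, N⟩ h
    obtain ⟨hM, hN⟩ := Prod.ext_iff.1 h
    change M = 0 at hM
    change N = 0 at hN
    subst hM hN
    rw [emb_eq]
    have h : ∀ (f : Dhat) (l c : ℂ) (X Y : sl2), f • gen (l, c, X, Y, 0, 0) ∈ extend Veven :=
      fun f l c X Y => smul_gen_mem_extend f ⟨rfl, rfl⟩
    simp only [Matrix.zero_apply, zero_smul, Finset.sum_const_zero, add_zero]
    exact add_mem (add_mem (add_mem (h _ _ _ _ _) (h _ _ _ _ _))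
      (add_mem (add_mem (h _ _ _ _ _) (h _ _ _ _ _)) (h _ _ _ _ _)))
      (add_mem (add_mem (h _ _ _ _ _) (h _ _ _ _ _)) (h _ _ _ _ _))

lemma mem_oddPart_iff (x : Ahat) : x ∈ oddPart ↔ ∀ w, evenCoords (ev w x) = 0 := by
  refine mem_extend_iff evenCoords ?_ ?_ x
  · rintro ⟨l, c, X, Y, M, N⟩ ⟨hl, hc, hX, hY⟩
    change l = 0 at hl
    change c = 0 at hc
    change X = 0 at hX
    change Y = 0 at hY
    subst hl hc hX hY
    exact Prod.ext (map_zero _) (Prod.ext (map_zero _) (Prod.ext toMD_zero toMD_zero))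
  · rintro ⟨l, c, X, Y, M, N⟩ h
    obtain ⟨hl, h⟩ := Prod.ext_iff.1 h
    obtain ⟨hc, h⟩ := Prod.ext_iff.1 h
    obtain ⟨hX, hY⟩ := Prod.ext_iff.1 h
    change l = 0 at hl
    change c = 0 at hc
    change tl X = 0 at hX
    change tl Y = 0 at hY
    subst hl hc
    rw [← emb_proj, emb_eq]
    change _ + _ + (tl X 0 0 • _ + tl X 0 1 • _ + tl X 1 0 • _)
      + (tl Y 0 0 • _ + tl Y 0 1 • _ + tl Y 1 0 • _) + _ + _ ∈ _
    rw [hX, hY]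
    have h : ∀ (f : Dhat) (M N : M2), f • gen (0, 0, 0, 0, M, N) ∈ extend Vodd :=
      fun f M N => smul_gen_mem_extend f ⟨rfl, rfl, rfl, rfl⟩
    change (0 : Dhat) • _ + (0 : Dhat) • _ + _ + _ + _ + _ ∈ _
    simp only [Matrix.zero_apply, zero_smul, zero_add, add_zero]
    exact add_mem (sum_mem fun i _ => sum_mem fun j _ => h _ _ _)
      (sum_mem fun i _ => sum_mem fun j _ => h _ _ _)

/-- The properties of a map of `D̂ ⊗ V` under which it extends to an automorphism. -/
structure IsGood (F : WD →ₗ[Dhat] WD) : Prop where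
  isTl : ∀ x, IsTl x → IsTl (F x)
  even : ∀ x, oddCoords x = 0 → oddCoords (F x) = 0
  odd : ∀ x, evenCoords x = 0 → evenCoords (F x) = 0
  beta : ∀ u w x y, IsTl x → IsTl y → beta u w (F x) (F y) = F (beta u w x y)

lemma extendMap_extendMap {F G : WD →ₗ[Dhat] WD} (hF : IsGood F) (hG : IsGood G)
    (h : ∀ x, IsTl x → F (G x) = x) (x : Ahat) : extendMap F (extendMap G x) = x :=
  ev_ext fun w => by
    rw [ev_extendMap hF.isTl, ev_extendMap hG.isTl, h _ (isTl_ev _ _)]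

/-- The automorphism of `𝒜 ⊗ D̂` given by mutually inverse maps of `D̂ ⊗ V`. -/
def autOf (F G : WD →ₗ[Dhat] WD) (hF : IsGood F) (hG : IsGood G) (h : ∀ x, IsTl x → F (G x) = x)
    (h' : ∀ x, IsTl x → G (F x) = x) : AutConf :=
  ⟨LinearEquiv.ofLinearMap (extendMap F) (extendMap G) (LinearMap.ext (extendMap_extendMap hF hG h))
      (LinearMap.ext (extendMap_extendMap hG hF h')), by
    refine ⟨fun x => ?_, fun x => ?_, fun x => extendMap_partialHat F x, fun n x y => ?_⟩
    · rw [mem_evenPart_iff, mem_evenPart_iff]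
      refine forall_congr' fun w => ?_
      change oddCoords (ev w (extendMap F x)) = 0 ↔ _
      rw [ev_extendMap hF.isTl]
      refine ⟨fun hx => ?_, hF.even _⟩
      rw [← h' _ (isTl_ev w x)]
      exact hG.even _ hx
    · rw [mem_oddPart_iff, mem_oddPart_iff]
      refine forall_congr' fun w => ?_
      change evenCoords (ev w (extendMap F x)) = 0 ↔ _
      rw [ev_extendMap hF.isTl]
      refine ⟨fun hx => ?_, hF.odd _⟩
      rw [← h' _ (isTl_ev w x)]
      exact hG.odd _ hx
    · exact map_nprodHat_of_beta (F := (extendMap F).restrictScalars ℂ) (F₀ := F)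
        (fun w x => ev_extendMap hF.isTl w x) hF.beta n x y⟩

lemma ev_autOf {F G : WD →ₗ[Dhat] WD} (hF : IsGood F) (hG : IsGood G)
    (h : ∀ x, IsTl x → F (G x) = x) (h' : ∀ x, IsTl x → G (F x) = x) (w : ℂ) (x : Ahat) :
    ev w ((autOf F G hF hG h h').1 x) = F (ev w x) := ev_extendMap hF.isTl w x

lemma autOf_emb {F G : WD →ₗ[Dhat] WD} (hF : IsGood F) (hG : IsGood G)
    (h : ∀ x, IsTl x → F (G x) = x) (h' : ∀ x, IsTl x → G (F x) = x) {x : WD} (hx : IsTl x) :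
    (autOf F G hF hG h h').1 (emb x) = emb (F x) := by
  change extendMap F (emb x) = _
  rw [extendMap_emb, proj_eq_self hx]

/-- An automorphism is determined by its values on the generators. -/
lemma AutConf.ext_gen {φ ψ : AutConf} (h : ∀ v, φ.1 (gen v) = ψ.1 (gen v)) : φ = ψ := by
  apply Subtype.ext
  apply LinearEquiv.ext
  have hk : ∀ (χ : AutConf) (k : ℕ) (x : Ahat), χ.1 ((partialHat ^ k) x) = (partialHat ^ k) (χ.1 x) := by
    intro χ k x
    induction k with
    | zero => rfl
    | succ k ih =>
      rw [pow_succ', Module.End.mul_apply, Module.End.mul_apply, χ.2.2.2.1, ih]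
  intro x
  obtain ⟨a, rfl⟩ := assemble_surjective x
  induction a using Finsupp.induction_linear with
  | zero => simp
  | add a b ha hb => simp only [map_add, ha, hb]
  | single k y =>
    rw [assemble_single, hk, hk, emb_eq]
    simp only [map_add, map_sum, map_smul, h]

/-! ### The automorphisms -/

/-- Conjugation by `(A, B)`:
`(ℓ, c, X, Y, M, N) ↦ (ℓ, c, A X A⁻¹, B Y B⁻¹, A M B⁻¹, A N B⁻¹)`. -/
def kap (A B : SLD) : WD →ₗ[Dhat] WD where
  toFun x := (x.1, x.2.1, A.1 * x.2.2.1 * (A⁻¹).1, B.1 * x.2.2.2.1 * (B⁻¹).1,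
    A.1 * x.2.2.2.2.1 * (B⁻¹).1, A.1 * x.2.2.2.2.2 * (B⁻¹).1)
  map_add' x y := by
    simp only [Prod.fst_add, Prod.snd_add, Matrix.mul_add, Matrix.add_mul, Prod.mk_add_mk]
  map_smul' f x := by
    simp only [Prod.smul_fst, Prod.smul_snd, Matrix.mul_smul, Matrix.smul_mul, Prod.smul_mk,
      RingHom.id_apply]

/-- The map `L ↦ L + f U + T⁺(a) + T⁻(b)`, `G(M) ↦ G(M) + Q(f M - a M - M b)` that fixes the other
generators. -/
def nu (a b : MD) (f : Dhat) : WD →ₗ[Dhat] WD where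
  toFun x := (x.1, x.2.1 + x.1 * f, x.2.2.1 + x.1 • a, x.2.2.2.1 + x.1 • b, x.2.2.2.2.1,
    x.2.2.2.2.2 + f • x.2.2.2.2.1 - a * x.2.2.2.2.1 - x.2.2.2.2.1 * b)
  map_add' x y := by
    refine Prod.ext ?_ (Prod.ext ?_ (Prod.ext ?_ (Prod.ext ?_ (Prod.ext ?_ ?_)))) <;>
    simp [Matrix.mul_add, Matrix.add_mul] <;> first | ring1 | module
  map_smul' f x := by
    refine Prod.ext ?_ (Prod.ext ?_ (Prod.ext ?_ (Prod.ext ?_ (Prod.ext ?_ ?_)))) <;>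
    simp <;> first | ring1 | module

/-- The derivation `(ℓ, c, X, Y, M, N) ↦ (0, 0, [a, X], [b, Y], a M - M b, a N - N b)`. -/
def adj (a b : MD) (x : WD) : WD :=
  (0, 0, a * x.2.2.1 - x.2.2.1 * a, b * x.2.2.2.1 - x.2.2.2.1 * b,
    a * x.2.2.2.2.1 - x.2.2.2.2.1 * b, a * x.2.2.2.2.2 - x.2.2.2.2.2 * b)

/-- The derivative of the family `nu` along `δ_t`. -/
def nuDelta (a b : MD) (f : Dhat) (x : WD) : WD :=
  (0, x.1 * delta f, x.1 • deltaM a, x.1 • deltaM b, 0,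
    delta f • x.2.2.2.2.1 - deltaM a * x.2.2.2.2.1 - x.2.2.2.2.1 * deltaM b)

lemma dag_conj (A B : SLD) (M : MD) : dag (A.1 * M * (B⁻¹).1) = B.1 * dag M * (A⁻¹).1 := by
  rw [Matrix.SpecialLinearGroup.coe_inv, Matrix.SpecialLinearGroup.coe_inv]
  ext i j : 1; fin_cases i <;> fin_cases j <;>
    simp [dag, Matrix.mul_apply, Fin.sum_univ_two, Matrix.adjugate_fin_two] <;> ring

lemma SLD.inv_mul_cancel_assoc (A : SLD) (M : MD) : (A⁻¹).1 * (A.1 * M) = M := by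
  rw [← Matrix.mul_assoc, SLD.inv_mul_coe, Matrix.one_mul]

lemma SLD.mul_inv_cancel_assoc (A : SLD) (M : MD) : A.1 * ((A⁻¹).1 * M) = M := by
  rw [← Matrix.mul_assoc, SLD.mul_inv_coe, Matrix.one_mul]

lemma skR_conj (A B : SLD) (M N : MD) : skR (A.1 * M * (B⁻¹).1) (A.1 * N * (B⁻¹).1)
    = A.1 * skR M N * (A⁻¹).1 := by
  simp only [skR, dag_conj]
  simp only [Matrix.mul_sub, Matrix.sub_mul, Matrix.mul_assoc, SLD.inv_mul_cancel_assoc]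

lemma skL_conj (A B : SLD) (M N : MD) : skL (A.1 * M * (B⁻¹).1) (A.1 * N * (B⁻¹).1)
    = B.1 * skL M N * (B⁻¹).1 := by
  simp only [skL, dag_conj]
  simp only [Matrix.mul_sub, Matrix.sub_mul, Matrix.mul_assoc, SLD.inv_mul_cancel_assoc]

lemma trace_conj (A : SLD) (M : MD) : (A.1 * M * (A⁻¹).1).trace = M.trace := by
  rw [Matrix.mul_assoc, Matrix.trace_mul_comm, Matrix.mul_assoc, SLD.inv_mul_coe, Matrix.mul_one]

lemma trace_conj_dag (A B : SLD) (M N : MD) :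
    (A.1 * M * (B⁻¹).1 * dag (A.1 * N * (B⁻¹).1)).trace = (M * dag N).trace := by
  rw [dag_conj, ← trace_conj A (M * dag N)]
  simp only [Matrix.mul_assoc, SLD.inv_mul_cancel_assoc]

lemma cW_kap (A B : SLD) (x y : WD) : cW (kap A B x) (kap A B y) = kap A B (cW x y) := by
  simp only [cW_apply]
  obtain ⟨l, c, X, Y, M, N⟩ := x
  obtain ⟨l', c', X', Y', M', N'⟩ := y
  simp only [kap, LinearMap.coe_mk, AddHom.coe_mk, cFun, trace_conj_dag, skR_conj, skL_conj]
  simp only [Matrix.mul_sub, Matrix.sub_mul, Matrix.mul_add, Matrix.add_mul, Matrix.mul_assoc,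
    SLD.inv_mul_cancel_assoc]

lemma bW_kap (A B : SLD) (x y : WD) : bW (kap A B x) (kap A B y) = kap A B (bW x y) := by
  simp only [bW_apply]
  obtain ⟨l, c, X, Y, M, N⟩ := x
  obtain ⟨l', c', X', Y', M', N'⟩ := y
  simp only [kap, LinearMap.coe_mk, AddHom.coe_mk, bFun, skR_conj, skL_conj]
  simp only [Matrix.mul_sub, Matrix.sub_mul, Matrix.mul_add, Matrix.add_mul, Matrix.mul_assoc,
    SLD.inv_mul_cancel_assoc, Matrix.mul_smul, Matrix.smul_mul]

lemma eW_kap (A B : SLD) (x y : WD) : eW (kap A B x) (kap A B y) = kap A B (eW x y) := by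
  simp only [eW_apply]
  obtain ⟨l, c, X, Y, M, N⟩ := x
  obtain ⟨l', c', X', Y', M', N'⟩ := y
  simp only [kap, LinearMap.coe_mk, AddHom.coe_mk, eFun, skR_conj, skL_conj]
  simp only [Matrix.mul_sub, Matrix.sub_mul, Matrix.mul_add, Matrix.add_mul, Matrix.mul_assoc,
    SLD.inv_mul_cancel_assoc, Matrix.mul_smul, Matrix.smul_mul]

lemma exists_eq_two_mul (f : Dhat) : ∃ r, f = 2 * r :=
  ⟨half * f, by rw [← mul_assoc, two_mul_half, one_mul]⟩

lemma half_mul_two_mul (f : Dhat) : half * (2 * f) = f := by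
  rw [← mul_assoc, mul_comm half, two_mul_half, one_mul]

lemma bW_nu (a b : MD) (f : Dhat) (x y : WD) :
    bW (nu a b f x) (nu a b f y) = nu a b f (bW x y) := by
  simp only [bW_apply]
  obtain ⟨l, c, X, Y, M, N⟩ := x
  obtain ⟨l', c', X', Y', M', N'⟩ := y
  simp only [nu, LinearMap.coe_mk, AddHom.coe_mk, bFun, Prod.mk.injEq]
  obtain ⟨r, rfl⟩ := exists_eq_two_mul l'
  rw [half_mul_two_mul]
  refine ⟨trivial, by ring, by module, by module, trivial, ?_⟩
  simp only [Matrix.mul_add, Matrix.add_mul, Matrix.mul_smul, Matrix.smul_mul]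
  module

lemma eW_nu (a b : MD) (f : Dhat) (x y : WD) :
    eW (nu a b f x) (nu a b f y) = nu a b f (eW x y) := by
  simp only [eW_apply]
  obtain ⟨l, c, X, Y, M, N⟩ := x
  obtain ⟨l', c', X', Y', M', N'⟩ := y
  simp only [nu, LinearMap.coe_mk, AddHom.coe_mk, eFun, Prod.mk.injEq]
  obtain ⟨r, rfl⟩ := exists_eq_two_mul l
  rw [half_mul_two_mul]
  refine ⟨trivial, by ring, by module, by module, trivial, ?_⟩
  simp only [Matrix.mul_add, Matrix.add_mul, Matrix.mul_smul, Matrix.smul_mul]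
  module

lemma skR_sub_left (M M' N : MD) : skR (M - M') N = skR M N - skR M' N := by
  rw [eq_sub_iff_add_eq, ← skR_add_left, sub_add_cancel]

lemma skR_sub_right (M N N' : MD) : skR M (N - N') = skR M N - skR M N' := by
  rw [eq_sub_iff_add_eq, ← skR_add_right, sub_add_cancel]

lemma skR_swap (M N : MD) : skR N M = -skR M N := by simp [skR]

lemma skL_sub_left (M M' N : MD) : skL (M - M') N = skL M N - skL M' N := by
  rw [eq_sub_iff_add_eq, ← skL_add_left, sub_add_cancel]

lemma skL_sub_right (M N N' : MD) : skL M (N - N') = skL M N - skL M N' := by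
  rw [eq_sub_iff_add_eq, ← skL_add_right, sub_add_cancel]

lemma skL_swap (M N : MD) : skL N M = -skL M N := by simp [skL]

/-- `M N† + N M†` is a scalar matrix. -/
lemma mul_dag_add (M N : MD) : M * dag N + N * dag M = (M * dag N).trace • (1 : MD) := by
  ext i j : 1; fin_cases i <;> fin_cases j <;>
    simp [dag, Matrix.mul_apply, Fin.sum_univ_two, Matrix.trace_fin_two, Matrix.vecMul, dotProduct] <;>
    ring

lemma dag_mul_add (M N : MD) : dag M * N + dag N * M = (M * dag N).trace • (1 : MD) := by
  ext i j : 1; fin_cases i <;> fin_cases j <;>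
    simp [dag, Matrix.mul_apply, Fin.sum_univ_two, Matrix.trace_fin_two, Matrix.vecMul, dotProduct] <;>
    ring

lemma dag_mul_of_trace_eq_zero {a : MD} (ha : a.trace = 0) (M : MD) :
    dag (a * M) = -(dag M * a) := by
  rw [eq_of_trace_eq_zero ha]
  ext i j : 1; fin_cases i <;> fin_cases j <;>
    simp [dag, Matrix.mul_apply, Fin.sum_univ_two] <;> ring

lemma dag_mul_of_trace_eq_zero' {b : MD} (hb : b.trace = 0) (M : MD) :
    dag (M * b) = -(b * dag M) := by
  rw [eq_of_trace_eq_zero hb]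
  ext i j : 1; fin_cases i <;> fin_cases j <;>
    simp [dag, Matrix.mul_apply, Fin.sum_univ_two] <;> ring

lemma skR_mul_left {a : MD} (ha : a.trace = 0) (M N : MD) :
    skR (a * M) N + skR (a * N) M = (2 * (M * dag N).trace) • a := by
  calc skR (a * M) N + skR (a * N) M
      = a * (M * dag N + N * dag M) + (M * dag N + N * dag M) * a := by
        simp only [skR, dag_mul_of_trace_eq_zero ha]; noncomm_ring
    _ = _ := by
        rw [mul_dag_add, Matrix.mul_smul, Matrix.smul_mul, Matrix.mul_one, Matrix.one_mul]; module

lemma skR_mul_right {b : MD} (hb : b.trace = 0) (M N : MD) : skR (M * b) N = skR (N * b) M := by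
  simp only [skR, dag_mul_of_trace_eq_zero' hb]; noncomm_ring

lemma skL_mul_right {b : MD} (hb : b.trace = 0) (M N : MD) :
    skL (M * b) N + skL (N * b) M = -(2 * (M * dag N).trace) • b := by
  calc skL (M * b) N + skL (N * b) M
      = -(b * (dag M * N + dag N * M) + (dag M * N + dag N * M) * b) := by
        simp only [skL, dag_mul_of_trace_eq_zero' hb]; noncomm_ring
    _ = _ := by
        rw [dag_mul_add, Matrix.mul_smul, Matrix.smul_mul, Matrix.mul_one, Matrix.one_mul]; module

lemma skL_mul_left {a : MD} (ha : a.trace = 0) (M N : MD) : skL (a * M) N = skL (a * N) M := by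
  simp only [skL, dag_mul_of_trace_eq_zero ha]; noncomm_ring

lemma trace_mul_dag_comm (M N : MD) : (M * dag N).trace = (N * dag M).trace := by
  simp [dag, Matrix.mul_apply, Fin.sum_univ_two, Matrix.trace_fin_two]; ring

lemma trace_mul_mul_dag {a : MD} (ha : a.trace = 0) (M N : MD) :
    (a * M * dag N).trace + (a * N * dag M).trace = 0 := by
  rw [← Matrix.trace_add, Matrix.mul_assoc, Matrix.mul_assoc, ← Matrix.mul_add, mul_dag_add,
    Matrix.mul_smul, Matrix.trace_smul, Matrix.mul_one, ha, smul_zero]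

lemma trace_mul_mul_dag' {b : MD} (hb : b.trace = 0) (M N : MD) :
    (M * b * dag N).trace + (N * b * dag M).trace = 0 := by
  have h : ∀ M N : MD, (M * b * dag N).trace = (b * (dag N * M)).trace := fun M N => by
    rw [Matrix.mul_assoc, Matrix.trace_mul_comm, Matrix.mul_assoc]
  rw [h, h, ← Matrix.trace_add, ← Matrix.mul_add, dag_mul_add,
    Matrix.mul_smul, Matrix.trace_smul, Matrix.mul_one, hb, smul_zero]

/-- The failure of `nu` to preserve `cW` is made up for by the derivatives of `nu` and of the
conjugation that precedes it. -/
lemma cW_nu {a b : MD} (ha : a.trace = 0) (hb : b.trace = 0) (f : Dhat) (x y : WD) :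
    cW (nu a b f x) (nu a b f y)
      - bW (nu a b f x) (nu a b f (adj a b y) + nuDelta a b f y)
      + eW (nu a b f (adj a b x) + nuDelta a b f x) (nu a b f y) = nu a b f (cW x y) := by
  simp only [cW_apply, bW_apply, eW_apply]
  obtain ⟨l, c, X, Y, M, N⟩ := x
  obtain ⟨l', c', X', Y', M', N'⟩ := y
  simp only [nu, adj, nuDelta, LinearMap.coe_mk, AddHom.coe_mk, cFun, bFun, eFun, Prod.mk_add_mk,
    Prod.mk_sub_mk, Prod.mk.injEq, mul_zero, zero_mul, zero_smul, add_zero, zero_add]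
  refine ⟨by ring, ?_, ?_, ?_, ?_, ?_⟩
  · have h1 := trace_mul_mul_dag ha M M'
    have h2 := trace_mul_mul_dag' hb M M'
    have h3 := trace_mul_dag_comm M M'
    simp only [Matrix.add_mul, Matrix.sub_mul, Matrix.trace_add, Matrix.trace_sub, Matrix.smul_mul,
      Matrix.trace_smul, smul_eq_mul]
    linear_combination (-2) * h1 - 2 * h2 - 2 * f * h3
  · simp only [skR_add_left, skR_sub_left, skR_sub_right, skR_smul_left, Matrix.mul_add,
      Matrix.add_mul, Matrix.mul_smul, Matrix.smul_mul]
    rw [eq_sub_of_add_eq (skR_mul_left ha M M'), skR_mul_right hb M M', skR_swap (a * M') M,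
      skR_swap (M' * b) M, skR_swap M M']
    module
  · simp only [skL_add_left, skL_sub_left, skL_sub_right, skL_smul_left, Matrix.mul_add,
      Matrix.add_mul, Matrix.mul_smul, Matrix.smul_mul]
    rw [eq_sub_of_add_eq (skL_mul_right hb M M'), skL_mul_left ha M M', skL_swap (a * M') M,
      skL_swap (M' * b) M, skL_swap M M']
    module
  · simp only [Matrix.mul_add, Matrix.add_mul, Matrix.mul_sub, Matrix.sub_mul, Matrix.mul_smul,
      Matrix.smul_mul]
    module
  · simp only [Matrix.mul_add, Matrix.add_mul, Matrix.mul_sub, Matrix.sub_mul, Matrix.mul_smul,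
      Matrix.smul_mul, Matrix.mul_assoc, smul_add, smul_sub]
    module

/-- The logarithmic derivative `δ_t(A) A⁻¹`. -/
def logDer (A : SLD) : MD := deltaM A.1 * (A⁻¹).1

lemma deltaM_coe (A : SLD) : deltaM A.1 = logDer A * A.1 := by
  rw [logDer, Matrix.mul_assoc, SLD.inv_mul_coe, Matrix.mul_one]

lemma deltaM_one : deltaM 1 = 0 := by
  ext i j : 1; fin_cases i <;> fin_cases j <;> simp [deltaM]

lemma deltaM_inv (A : SLD) : deltaM (A⁻¹).1 = -((A⁻¹).1 * logDer A) := by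
  have h : deltaM ((A⁻¹).1 * A.1) = 0 := by rw [SLD.inv_mul_coe, deltaM_one]
  rw [deltaM_mul] at h
  have h2 := congrArg (· * (A⁻¹).1) h
  simp only [Matrix.add_mul, Matrix.mul_assoc, SLD.mul_inv_coe, Matrix.mul_one,
    Matrix.zero_mul] at h2
  exact eq_neg_of_add_eq_zero_left h2

/-- As `det A = 1`, the logarithmic derivative of `A` lies in `sl₂`. -/
lemma trace_logDer (A : SLD) : (logDer A).trace = 0 := by
  have h : delta A.1.det = 0 := by rw [A.2]; exact delta.map_one_eq_zero
  rw [Matrix.det_fin_two] at h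
  simp only [map_sub, Derivation.leibniz, smul_eq_mul] at h
  rw [logDer, Matrix.SpecialLinearGroup.coe_inv, Matrix.adjugate_fin_two]
  simp [Matrix.trace_fin_two, Matrix.mul_apply, Fin.sum_univ_two, deltaM]
  linear_combination h

lemma logDer_mul (A A' : SLD) :
    logDer (A * A') = logDer A + A.1 * logDer A' * (A⁻¹).1 := by
  rw [logDer, mul_inv_rev, Matrix.SpecialLinearGroup.coe_mul, Matrix.SpecialLinearGroup.coe_mul,
    deltaM_mul, logDer, logDer]
  simp only [Matrix.add_mul, Matrix.mul_assoc, SLD.mul_inv_cancel_assoc]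

lemma logDer_one : logDer 1 = 0 := by
  rw [logDer, Matrix.SpecialLinearGroup.coe_one, deltaM_one, Matrix.zero_mul]

/-- Differentiating a conjugation adds the commutator with the logarithmic derivatives. -/
lemma deltaW_kap (A B : SLD) (x : WD) : deltaW (kap A B x)
    = kap A B (deltaW x) + adj (logDer A) (logDer B) (kap A B x) := by
  have h : ∀ (A B : SLD) (M : MD), deltaM (A.1 * M * (B⁻¹).1) = A.1 * deltaM M * (B⁻¹).1
      + (logDer A * (A.1 * M * (B⁻¹).1) - A.1 * M * (B⁻¹).1 * logDer B) := fun A B M => by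
    rw [deltaM_mul, deltaM_mul, deltaM_coe, deltaM_inv]
    simp only [Matrix.add_mul, Matrix.mul_neg, Matrix.mul_assoc]
    abel
  obtain ⟨l, c, X, Y, M, N⟩ := x
  refine Prod.ext ?_ (Prod.ext ?_ (Prod.ext ?_ (Prod.ext ?_ (Prod.ext ?_ ?_))))
  · exact (add_zero _).symm
  · exact (add_zero _).symm
  · exact h A A X
  · exact h B B Y
  · exact h A B M
  · exact h A B N

lemma deltaW_nu (a b : MD) (f : Dhat) (x : WD) :
    deltaW (nu a b f x) = nu a b f (deltaW x) + nuDelta a b f x := by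
  obtain ⟨l, c, X, Y, M, N⟩ := x
  have hs : ∀ (g : Dhat) (M : MD), deltaM (g • M) = g • deltaM M + delta g • M := fun g M => by
    ext i j : 1; simp [deltaM]; ring
  have hsub : ∀ M N : MD, deltaM (M - N) = deltaM M - deltaM N := fun M N => by
    ext i j : 1; simp [deltaM]
  simp only [deltaW, nu, nuDelta, LinearMap.coe_mk, AddHom.coe_mk, Prod.mk_add_mk, Prod.mk.injEq,
    add_zero, deltaM_add, hs, hsub, deltaM_mul, map_add, Derivation.leibniz, smul_eq_mul]
  refine ⟨trivial, by ring, by abel, by abel, trivial, by abel⟩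

/-- The map of `D̂ ⊗ V` that restricts `θ_{A,B} τ_f`. -/
def xi (A B : SLD) (f : Dhat) : WD →ₗ[Dhat] WD := nu (logDer A) (logDer B) f ∘ₗ kap A B

lemma xi_apply (A B : SLD) (f : Dhat) (x : WD) :
    xi A B f x = nu (logDer A) (logDer B) f (kap A B x) := rfl

/-- `xi A B f` preserves the bracket: by `deltaW_kap` and `deltaW_nu` it commutes with `δ_t` up to the
terms that `cW_nu` accounts for. -/
lemma beta_xi (A B : SLD) (f : Dhat) (u w : ℂ) (x y : WD) :
    beta u w (xi A B f x) (xi A B f y) = xi A B f (beta u w x y) := by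
  have key : ∀ (z : ℂ) (x : WD), z • xi A B f x - deltaW (xi A B f x)
      = xi A B f (z • x - deltaW x)
        - (nu (logDer A) (logDer B) f (adj (logDer A) (logDer B) (kap A B x))
          + nuDelta (logDer A) (logDer B) f (kap A B x)) := fun z x => by
    rw [map_sub, LinearMap.map_smul_of_tower, xi_apply, xi_apply, deltaW_nu, deltaW_kap, map_add]
    abel
  have hc := cW_nu (trace_logDer A) (trace_logDer B) f (kap A B x) (kap A B y)
  rw [cW_kap, ← xi_apply, ← xi_apply, ← xi_apply] at hc
  have hb : ∀ x y, bW (xi A B f x) (xi A B f y) = xi A B f (bW x y) := fun x y => by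
    rw [xi_apply, xi_apply, bW_nu, bW_kap, xi_apply]
  have he : ∀ x y, eW (xi A B f x) (xi A B f y) = xi A B f (eW x y) := fun x y => by
    rw [xi_apply, xi_apply, eW_nu, eW_kap, xi_apply]
  rw [beta, key, key, beta]
  generalize w • y - deltaW y = y'
  generalize u • x - deltaW x = x'
  rw [map_sub (bW _), map_sub eW, LinearMap.sub_apply, hb, he, map_sub (xi A B f),
    map_add (xi A B f), ← hc]
  abel

lemma isGood_xi (A B : SLD) (f : Dhat) : IsGood (xi A B f) where
  isTl := by
    rintro ⟨l, c, X, Y, M, N⟩ ⟨hX, hY⟩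
    constructor
    · change (A.1 * X * (A⁻¹).1 + l • logDer A).trace = 0
      rw [Matrix.trace_add, trace_conj, Matrix.trace_smul, trace_logDer, smul_zero, add_zero]
      exact hX
    · change (B.1 * Y * (B⁻¹).1 + l • logDer B).trace = 0
      rw [Matrix.trace_add, trace_conj, Matrix.trace_smul, trace_logDer, smul_zero, add_zero]
      exact hY
  even := by
    rintro ⟨l, c, X, Y, M, N⟩ h
    obtain ⟨hM, hN⟩ := Prod.ext_iff.1 h
    change M = 0 at hM
    change N = 0 at hN
    subst hM hN
    simp [xi, nu, kap, oddCoords]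
  odd := by
    rintro ⟨l, c, X, Y, M, N⟩ h
    obtain ⟨hl, h⟩ := Prod.ext_iff.1 h
    obtain ⟨hc, h⟩ := Prod.ext_iff.1 h
    obtain ⟨hX, hY⟩ := Prod.ext_iff.1 h
    change l = 0 at hl
    change c = 0 at hc
    change X = 0 at hX
    change Y = 0 at hY
    subst hl hc hX hY
    simp [xi, nu, kap, evenCoords]
  beta u w x y _ _ := beta_xi A B f u w x y

lemma xi_mul (A B A' B' : SLD) (f f' : Dhat) (x : WD) :
    xi A B f (xi A' B' f' x) = xi (A * A') (B * B') (f + f') x := by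
  obtain ⟨l, c, X, Y, M, N⟩ := x
  simp only [xi, nu, kap, LinearMap.coe_comp, Function.comp_apply, LinearMap.coe_mk, AddHom.coe_mk,
    Prod.mk.injEq, logDer_mul, mul_inv_rev, Matrix.SpecialLinearGroup.coe_mul]
  simp only [Matrix.mul_add, Matrix.add_mul, Matrix.mul_sub, Matrix.sub_mul, Matrix.mul_smul,
    Matrix.smul_mul, Matrix.mul_assoc, SLD.inv_mul_cancel_assoc]
  refine ⟨trivial, by ring, by module, by module, trivial, by module⟩

lemma xi_one (x : WD) : xi 1 1 0 x = x := by
  obtain ⟨l, c, X, Y, M, N⟩ := x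
  simp [xi, nu, kap, logDer_one]

/-- The automorphism `θ_{A,B} τ_f`. -/
def xiAut (A B : SLD) (f : Dhat) : AutConf :=
  autOf (xi A B f) (xi A⁻¹ B⁻¹ (-f)) (isGood_xi _ _ _) (isGood_xi _ _ _)
    (fun x _ => by rw [xi_mul, mul_inv_cancel, mul_inv_cancel, add_neg_cancel, xi_one])
    (fun x _ => by rw [xi_mul, inv_mul_cancel, inv_mul_cancel, neg_add_cancel, xi_one])

lemma ev_xiAut (A B : SLD) (f : Dhat) (w : ℂ) (x : Ahat) :
    ev w ((xiAut A B f).1 x) = xi A B f (ev w x) := ev_autOf _ _ _ _ w x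

lemma xiAut_emb (A B : SLD) (f : Dhat) {x : WD} (hx : IsTl x) :
    (xiAut A B f).1 (emb x) = emb (xi A B f x) := autOf_emb _ _ _ _ hx

lemma AutConf.ext_ev {φ ψ : AutConf} (h : ∀ w x, ev w (φ.1 x) = ev w (ψ.1 x)) : φ = ψ :=
  AutConf.ext_gen fun _ => LargeN4.ev_ext fun w => h w _

lemma xiAut_mul (A B A' B' : SLD) (f f' : Dhat) :
    xiAut A B f * xiAut A' B' f' = xiAut (A * A') (B * B') (f + f') :=
  AutConf.ext_ev fun w x => by
    change ev w ((xiAut A B f).1 ((xiAut A' B' f').1 x)) = _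
    rw [ev_xiAut, ev_xiAut, ev_xiAut, xi_mul]

lemma xiAut_one : xiAut 1 1 0 = 1 :=
  AutConf.ext_ev fun w x => by rw [ev_xiAut, xi_one]; rfl

/-- The map of `D̂ ⊗ V` that restricts `ω`. -/
def om : WD →ₗ[Dhat] WD where
  toFun x := (x.1, -x.2.1, x.2.2.2.1, x.2.2.1, dag x.2.2.2.2.1, -dag x.2.2.2.2.2)
  map_add' x y := by simp [dag_add']; constructor <;> abel
  map_smul' f x := by simp [dag_smul']

lemma dag_zero {R : Type*} [CommRing R] : dag (0 : Matrix (Fin 2) (Fin 2) R) = 0 := by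
  ext i j : 1; fin_cases i <;> fin_cases j <;> simp [dag]

lemma dag_dag {R : Type*} [CommRing R] (M : Matrix (Fin 2) (Fin 2) R) : dag (dag M) = M := by
  ext i j : 1; fin_cases i <;> fin_cases j <;> simp [dag]

lemma dag_neg (M : MD) : dag (-M) = -dag M := by
  ext i j : 1; fin_cases i <;> fin_cases j <;> simp [dag]

lemma dag_sub (M N : MD) : dag (M - N) = dag M - dag N := by
  rw [sub_eq_add_neg, dag_add', dag_neg, ← sub_eq_add_neg]

lemma deltaM_dag (M : MD) : deltaM (dag M) = dag (deltaM M) := by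
  ext i j : 1; fin_cases i <;> fin_cases j <;> simp [dag, deltaM]

lemma skR_dag (M N : MD) : skR (dag M) (dag N) = skL M N := by simp [skR, skL, dag_dag]

lemma skL_dag (M N : MD) : skL (dag M) (dag N) = skR M N := by simp [skR, skL, dag_dag]

lemma deltaW_om (x : WD) : deltaW (om x) = om (deltaW x) := by
  have hn : ∀ M : MD, deltaM (-M) = -deltaM M := fun M => by ext i j : 1; simp [deltaM]
  simp [deltaW, om, deltaM_dag, hn]

lemma trace_dag_mul_dag_dag (M N : MD) : (dag M * dag (dag N)).trace = (M * dag N).trace := by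
  simp [dag, Matrix.mul_apply, Fin.sum_univ_two, Matrix.trace_fin_two]; ring

lemma om_om (x : WD) : om (om x) = x := by
  obtain ⟨l, c, X, Y, M, N⟩ := x
  simp [om, dag_dag, dag_neg]

lemma skR_neg_left (M N : MD) : skR (-M) N = -skR M N := by
  rw [eq_neg_iff_add_eq_zero, ← skR_add_left, neg_add_cancel]; simp [skR, dag_zero]

lemma skL_neg_left (M N : MD) : skL (-M) N = -skL M N := by
  rw [eq_neg_iff_add_eq_zero, ← skL_add_left, neg_add_cancel]; simp [skL, dag_zero]

lemma IsTl.sub {x y : WD} (hx : IsTl x) (hy : IsTl y) : IsTl (x - y) := by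
  rw [sub_eq_add_neg, ← neg_one_smul Dhat]; exact hx.add (hy.smul _)

lemma isTl_deltaW {x : WD} (hx : IsTl x) : IsTl (deltaW x) := by
  have h : ∀ X : MD, X.trace = 0 → (deltaM X).trace = 0 := fun X hX => by
    rw [Matrix.trace_fin_two] at hX ⊢
    change delta (X 0 0) + delta (X 1 1) = 0
    rw [← map_add, hX, map_zero]
  exact ⟨h _ hx.1, h _ hx.2⟩

lemma cW_om {x y : WD} (hx : IsTl x) (hy : IsTl y) : cW (om x) (om y) = om (cW x y) := by
  simp only [cW_apply]
  obtain ⟨l, c, X, Y, M, N⟩ := x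
  obtain ⟨l', c', X', Y', M', N'⟩ := y
  obtain ⟨hX, hY⟩ := hx
  obtain ⟨hX', hY'⟩ := hy
  dsimp only at hX hY hX' hY'
  simp only [om, LinearMap.coe_mk, AddHom.coe_mk, cFun, trace_dag_mul_dag_dag, Prod.mk.injEq,
    skR_dag, skL_dag, skR_neg_left, skL_neg_left, dag_add', dag_sub, Matrix.neg_mul,
    Matrix.trace_neg, dag_mul_of_trace_eq_zero hX, dag_mul_of_trace_eq_zero hX',
    dag_mul_of_trace_eq_zero' hY, dag_mul_of_trace_eq_zero' hY', Matrix.mul_neg]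
  refine ⟨trivial, by ring, by abel, by abel, by abel, by abel⟩

lemma bW_om (x : WD) {y : WD} (hy : IsTl y) : bW (om x) (om y) = om (bW x y) := by
  simp only [bW_apply]
  obtain ⟨l, c, X, Y, M, N⟩ := x
  obtain ⟨l', c', X', Y', M', N'⟩ := y
  obtain ⟨hX', hY'⟩ := hy
  dsimp only at hX' hY'
  simp only [om, LinearMap.coe_mk, AddHom.coe_mk, bFun, Prod.mk.injEq,
    skR_dag, skL_dag, dag_add', dag_sub, dag_smul', dag_mul_of_trace_eq_zero hX',
    dag_mul_of_trace_eq_zero' hY']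
  refine ⟨trivial, by ring, trivial, trivial, trivial, by module⟩

lemma eW_om {x : WD} (hx : IsTl x) (y : WD) : eW (om x) (om y) = om (eW x y) := by
  simp only [eW_apply]
  obtain ⟨l, c, X, Y, M, N⟩ := x
  obtain ⟨l', c', X', Y', M', N'⟩ := y
  obtain ⟨hX, hY⟩ := hx
  dsimp only at hX hY
  simp only [om, LinearMap.coe_mk, AddHom.coe_mk, eFun, Prod.mk.injEq,
    skR_dag, skL_dag, dag_add', dag_sub, dag_smul', dag_mul_of_trace_eq_zero hX,
    dag_mul_of_trace_eq_zero' hY]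
  refine ⟨trivial, by ring, trivial, trivial, trivial, by module⟩

lemma isTl_smul_sub_deltaW (z : ℂ) {x : WD} (hx : IsTl x) : IsTl (z • x - deltaW x) := by
  rw [← algebraMap_smul Dhat z x]
  exact (hx.smul _).sub (isTl_deltaW hx)

lemma isGood_om : IsGood om where
  isTl x hx := ⟨hx.2, hx.1⟩
  even := by
    rintro ⟨l, c, X, Y, M, N⟩ h
    obtain ⟨hM, hN⟩ := Prod.ext_iff.1 h
    change M = 0 at hM
    change N = 0 at hN
    subst hM hN
    simp [om, oddCoords, dag_zero]
  odd := by
    rintro ⟨l, c, X, Y, M, N⟩ h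
    obtain ⟨hl, h⟩ := Prod.ext_iff.1 h
    obtain ⟨hc, h⟩ := Prod.ext_iff.1 h
    obtain ⟨hX, hY⟩ := Prod.ext_iff.1 h
    change l = 0 at hl
    change c = 0 at hc
    change X = 0 at hX
    change Y = 0 at hY
    subst hl hc hX hY
    simp [om, evenCoords]
  beta u w x y hx hy := by
    have key : ∀ (z : ℂ) (x : WD), z • om x - deltaW (om x) = om (z • x - deltaW x) := fun z x => by
      rw [map_sub, LinearMap.map_smul_of_tower, deltaW_om]
    rw [beta, key, key, cW_om hx hy, bW_om _ (isTl_smul_sub_deltaW w hy),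
      eW_om (isTl_smul_sub_deltaW u hx), beta, map_sub om, map_add om]

/-- The automorphism `ω`. -/
def omAut : AutConf := autOf om om isGood_om isGood_om (fun x _ => om_om x) (fun x _ => om_om x)

lemma ev_omAut (w : ℂ) (x : Ahat) : ev w (omAut.1 x) = om (ev w x) := ev_autOf _ _ _ _ w x

lemma omAut_emb {x : WD} (hx : IsTl x) : omAut.1 (emb x) = emb (om x) := autOf_emb _ _ _ _ hx

lemma omAut_mul_self : omAut * omAut = 1 :=
  AutConf.ext_ev fun w x => by
    change ev w (omAut.1 (omAut.1 x)) = _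
    rw [ev_omAut, ev_omAut, om_om]; rfl

lemma om_xi (A B : SLD) (f : Dhat) (x : WD) : om (xi A B f x) = xi B A (-f) (om x) := by
  obtain ⟨l, c, X, Y, M, N⟩ := x
  have hd : ∀ (A B : SLD) (M : MD), dag (logDer A * M) = -(dag M * logDer A) := fun A B M =>
    dag_mul_of_trace_eq_zero (trace_logDer A) M
  have hd' : ∀ (A : SLD) (M : MD), dag (M * logDer A) = -(logDer A * dag M) := fun A M =>
    dag_mul_of_trace_eq_zero' (trace_logDer A) M
  simp only [om, xi, nu, kap, LinearMap.coe_comp, Function.comp_apply, LinearMap.coe_mk,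
    AddHom.coe_mk, Prod.mk.injEq, dag_sub, dag_add', dag_smul',
    dag_mul_of_trace_eq_zero (trace_logDer A), dag_mul_of_trace_eq_zero' (trace_logDer B), dag_conj]
  refine ⟨trivial, by ring, trivial, trivial, trivial, ?_⟩
  simp only [Matrix.mul_neg, Matrix.neg_mul]
  module

lemma omAut_mul_xiAut (A B : SLD) (f : Dhat) : omAut * xiAut A B f = xiAut B A (-f) * omAut :=
  AutConf.ext_ev fun w x => by
    change ev w (omAut.1 ((xiAut A B f).1 x)) = ev w ((xiAut B A (-f)).1 (omAut.1 x))
    rw [ev_omAut, ev_xiAut, ev_xiAut, ev_omAut, om_xi]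

/-! ### The formulas on generators -/

lemma genL_eq : genL = emb (1, 0, 0, 0, 0, 0) := by simp [emb_apply, genTp, genTm, genG, genQ]
lemma genU_eq : genU = emb (0, 1, 0, 0, 0, 0) := by simp [emb_apply, genTp, genTm, genG, genQ]
lemma genTp_eq (X : MD) : genTp X = emb (0, 0, X, 0, 0, 0) := by
  simp [emb_apply, genTp, genTm, genG, genQ]
lemma genTm_eq (X : MD) : genTm X = emb (0, 0, 0, X, 0, 0) := by
  simp [emb_apply, genTp, genTm, genG, genQ]
lemma genG_eq (X : MD) : genG X = emb (0, 0, 0, 0, X, 0) := by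
  simp [emb_apply, genTp, genTm, genG, genQ]
lemma genQ_eq (X : MD) : genQ X = emb (0, 0, 0, 0, 0, X) := by
  simp [emb_apply, genTp, genTm, genG, genQ]

/-- An automorphism is determined by its values on `L`, `U`, `T^±(X)`, `G(M)` and `Q(M)`. -/
lemma AutConf.ext_generators {φ ψ : AutConf} (hL : φ.1 genL = ψ.1 genL) (hU : φ.1 genU = ψ.1 genU)
    (hTp : ∀ X : sl2, φ.1 (genTp (toMD X.1)) = ψ.1 (genTp (toMD X.1)))
    (hTm : ∀ X : sl2, φ.1 (genTm (toMD X.1)) = ψ.1 (genTm (toMD X.1)))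
    (hG : ∀ M : M2, φ.1 (genG (toMD M)) = ψ.1 (genG (toMD M)))
    (hQ : ∀ M : M2, φ.1 (genQ (toMD M)) = ψ.1 (genQ (toMD M))) : φ = ψ := by
  refine AutConf.ext_gen fun v => ?_
  obtain ⟨l, c, X, Y, M, N⟩ := v
  rw [← emb_iota, iota_apply, emb_apply]
  simp only [map_add, map_smul, hL, hU, hTp, hTm, hG, hQ]

lemma isTl_mk {X Y : MD} (hX : X.trace = 0) (hY : Y.trace = 0) (l c : Dhat) (M N : MD) :
    IsTl (l, c, X, Y, M, N) := ⟨hX, hY⟩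

lemma isTl_mk_zero (l c : Dhat) (M N : MD) : IsTl (l, c, 0, 0, M, N) :=
  isTl_mk (Matrix.trace_zero _ _) (Matrix.trace_zero _ _) _ _ _ _

lemma isTl_Tp (X : sl2) : IsTl (0, 0, toMD X.1, 0, 0, 0) :=
  isTl_mk (trace_toMD_sl2 X) (Matrix.trace_zero _ _) _ _ _ _

lemma isTl_Tm (X : sl2) : IsTl (0, 0, 0, toMD X.1, 0, 0) :=
  isTl_mk (Matrix.trace_zero _ _) (trace_toMD_sl2 X) _ _ _ _

lemma xi_mk (A B : SLD) (f l c : Dhat) (X Y M N : MD) : xi A B f (l, c, X, Y, M, N)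
    = (l, c + l * f, A.1 * X * (A⁻¹).1 + l • logDer A, B.1 * Y * (B⁻¹).1 + l • logDer B,
      A.1 * M * (B⁻¹).1, A.1 * N * (B⁻¹).1 + f • (A.1 * M * (B⁻¹).1)
        - logDer A * (A.1 * M * (B⁻¹).1) - A.1 * M * (B⁻¹).1 * logDer B) := rfl

lemma om_mk (l c : Dhat) (X Y M N : MD) :
    om (l, c, X, Y, M, N) = (l, -c, Y, X, dag M, -dag N) := rfl

lemma isTheta_xiAut (A B : SLD) : IsTheta A B (xiAut A B 0) where
  map_L := by
    rw [genL_eq, xiAut_emb _ _ _ (isTl_mk_zero _ _ _ _), genTp_eq, genTm_eq, ← map_add, ← map_add,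
      xi_mk]
    refine congrArg emb ?_
    simp [logDer]
  map_U := by
    rw [genU_eq, xiAut_emb _ _ _ (isTl_mk_zero _ _ _ _), xi_mk]
    simp
  map_Tp X := by
    rw [genTp_eq, xiAut_emb _ _ _ (isTl_Tp X), genTp_eq, xi_mk]
    simp
  map_Tm X := by
    rw [genTm_eq, xiAut_emb _ _ _ (isTl_Tm X), genTm_eq, xi_mk]
    simp
  map_G M := by
    rw [genG_eq, xiAut_emb _ _ _ (isTl_mk_zero _ _ _ _), genG_eq, genQ_eq, ← map_sub, xi_mk,
      deltaM_inv, deltaM_coe]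
    refine congrArg emb ?_
    refine Prod.ext ?_ (Prod.ext ?_ (Prod.ext ?_ (Prod.ext ?_ (Prod.ext ?_ ?_))))
    · simp
    · simp
    · simp
    · simp
    · simp
    · change A.1 * 0 * (B⁻¹).1 + (0 : Dhat) • (A.1 * toMD M * (B⁻¹).1)
        - logDer A * (A.1 * toMD M * (B⁻¹).1) - A.1 * toMD M * (B⁻¹).1 * logDer B
        = 0 - (logDer A * A.1 * toMD M * (B⁻¹).1 - A.1 * toMD M * -((B⁻¹).1 * logDer B))
      simp only [Matrix.mul_zero, Matrix.zero_mul, zero_smul, Matrix.mul_neg, Matrix.mul_assoc]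
      abel
  map_Q M := by
    rw [genQ_eq, xiAut_emb _ _ _ (isTl_mk_zero _ _ _ _), genQ_eq, xi_mk]
    simp

lemma isTau_xiAut (f : Dhat) : IsTau f (xiAut 1 1 f) where
  map_L := by
    rw [genL_eq, xiAut_emb _ _ _ (isTl_mk_zero _ _ _ _), genU_eq, ← map_smul, ← map_add, xi_mk]
    refine congrArg emb ?_
    simp [logDer_one]
  map_U := by
    rw [genU_eq, xiAut_emb _ _ _ (isTl_mk_zero _ _ _ _), xi_mk]
    simp
  map_Tp X := by
    rw [genTp_eq, xiAut_emb _ _ _ (isTl_Tp X), xi_mk]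
    simp
  map_Tm X := by
    rw [genTm_eq, xiAut_emb _ _ _ (isTl_Tm X), xi_mk]
    simp
  map_G M := by
    rw [genG_eq, xiAut_emb _ _ _ (isTl_mk_zero _ _ _ _), genQ_eq, ← map_add, xi_mk]
    refine congrArg emb ?_
    simp [logDer_one]
  map_Q M := by
    rw [genQ_eq, xiAut_emb _ _ _ (isTl_mk_zero _ _ _ _), xi_mk]
    simp

lemma isOmega_omAut : IsOmega omAut where
  map_L := by
    rw [genL_eq, omAut_emb (isTl_mk_zero _ _ _ _), om_mk]
    simp [dag_zero]
  map_U := by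
    rw [genU_eq, omAut_emb (isTl_mk_zero _ _ _ _), ← map_neg, om_mk]
    refine congrArg emb ?_
    simp [dag_zero]
  map_Tp X := by
    rw [genTp_eq, omAut_emb (isTl_Tp X), genTm_eq, om_mk]
    simp [dag_zero]
  map_Tm X := by
    rw [genTm_eq, omAut_emb (isTl_Tm X), genTp_eq, om_mk]
    simp [dag_zero]
  map_G M := by
    rw [genG_eq, omAut_emb (isTl_mk_zero _ _ _ _), genG_eq, toMD_dag, om_mk]
    simp [dag_zero]
  map_Q M := by
    rw [genQ_eq, omAut_emb (isTl_mk_zero _ _ _ _), genQ_eq, toMD_dag, ← map_neg, om_mk]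
    refine congrArg emb ?_
    simp [dag_zero]

/-! ### Polynomial functions with values in `D̂` -/

/-- The functions of a complex variable given by a polynomial with coefficients in `D̂`. -/
def IsPoly (g : ℂ → Dhat) : Prop := ∃ P : Dhat[X], ∀ w, g w = P.eval (algebraMap ℂ Dhat w)

lemma polynomial_ext {P Q : Dhat[X]}
    (h : ∀ w : ℂ, P.eval (algebraMap ℂ Dhat w) = Q.eval (algebraMap ℂ Dhat w)) : P = Q := by
  refine Polynomial.eq_of_infinite_eval_eq _ _ ?_
  refine (Set.infinite_range_of_injective (FaithfulSMul.algebraMap_injective ℂ Dhat)).mono ?_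
  rintro _ ⟨w, rfl⟩
  exact h w

lemma IsPoly.add {g h : ℂ → Dhat} (hg : IsPoly g) (hh : IsPoly h) : IsPoly fun w => g w + h w := by
  obtain ⟨P, hP⟩ := hg
  obtain ⟨Q, hQ⟩ := hh
  exact ⟨P + Q, fun w => by simp only [hP, hQ, Polynomial.eval_add]⟩

lemma IsPoly.mul {g h : ℂ → Dhat} (hg : IsPoly g) (hh : IsPoly h) : IsPoly fun w => g w * h w := by
  obtain ⟨P, hP⟩ := hg
  obtain ⟨Q, hQ⟩ := hh
  exact ⟨P * Q, fun w => by simp only [hP, hQ, Polynomial.eval_mul]⟩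

lemma isPoly_const (c : Dhat) : IsPoly fun _ => c :=
  ⟨Polynomial.C c, fun w => by rw [Polynomial.eval_C]⟩

/-- Every coordinate of the value at `∂̂ = w` is polynomial in `w`. -/
lemma isPoly_ev (T : WD →ₗ[ℂ] Dhat) (x : Ahat) : IsPoly fun w => T (ev w x) := by
  obtain ⟨a, rfl⟩ := assemble_surjective x
  refine ⟨a.sum fun k x => Polynomial.monomial k (T (proj x)), fun w => ?_⟩
  dsimp only
  rw [ev_assemble, Finsupp.sum, Finsupp.sum, map_sum, Polynomial.eval_finsetSum]
  refine Finset.sum_congr rfl fun k _ => ?_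
  rw [map_smul, Polynomial.eval_monomial, Algebra.smul_def, map_pow, mul_comm]

/-- Multiplication by `w` raises the degree in `w`, while `δ_t` does not. -/
lemma IsPoly.eq_zero_of_smul_eq {g : ℂ → Dhat} (hg : IsPoly g) {a b : Dhat} (ha : a ≠ 0)
    (h : ∀ w : ℂ, w • (a * g w) = b * g w + a * delta (g w)) (w : ℂ) : g w = 0 := by
  obtain ⟨P, hP⟩ := hg
  obtain ⟨Q, hQ, hQd⟩ : ∃ Q : Dhat[X], (∀ w : ℂ, delta (g w) = Q.eval (algebraMap ℂ Dhat w)) ∧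
      Q.coeff (P.natDegree + 1) = 0 := by
    refine ⟨∑ k ∈ Finset.range (P.natDegree + 1), Polynomial.monomial k (delta (P.coeff k)),
      fun w => ?_, ?_⟩
    · rw [hP, Polynomial.eval_eq_sum_range, map_sum, Polynomial.eval_finsetSum]
      refine Finset.sum_congr rfl fun k _ => ?_
      rw [Polynomial.eval_monomial, Derivation.leibniz, ← map_pow, delta.map_algebraMap, smul_zero,
        zero_add, smul_eq_mul, mul_comm]
    · rw [Polynomial.finsetSum_coeff]
      refine Finset.sum_eq_zero fun k hk => ?_
      rw [Polynomial.coeff_monomial, if_neg (Finset.mem_range.1 hk).ne]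
  have key : Polynomial.C a * (P * Polynomial.X) = Polynomial.C b * P + Polynomial.C a * Q := by
    refine polynomial_ext fun w => ?_
    have := h w
    rw [hQ, hP, Algebra.smul_def] at this
    simp only [Polynomial.eval_add, Polynomial.eval_mul, Polynomial.eval_C, Polynomial.eval_X]
    rw [← this]; ring
  have hc := congrArg (fun R => R.coeff (P.natDegree + 1)) key
  simp only [Polynomial.coeff_add, Polynomial.coeff_C_mul, Polynomial.coeff_mul_X, hQd, mul_zero,
    add_zero, Polynomial.coeff_eq_zero_of_natDegree_lt (Nat.lt_succ_self P.natDegree)] at hc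
  have hP0 : P = 0 := Polynomial.leadingCoeff_eq_zero.1 ((mul_eq_zero.1 hc).resolve_left ha)
  rw [hP, hP0, Polynomial.eval_zero]

/-- A polynomial function `s` with `s(u) s(-u) = 1` is a unit of `D̂[u]`, hence constant. -/
lemma IsPoly.eq_one_of_mul {s : ℂ → Dhat} (hs : IsPoly s) (h : ∀ u, s u * s (-u) = 1)
    (h0 : s 0 = 1) (w : ℂ) : s w = 1 := by
  obtain ⟨S, hS⟩ := hs
  have key : S * S.comp (-Polynomial.X) = 1 := by
    refine polynomial_ext fun w => ?_
    rw [Polynomial.eval_mul, Polynomial.eval_comp, Polynomial.eval_neg, Polynomial.eval_X,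
      ← map_neg, ← hS, ← hS, h, Polynomial.eval_one]
  obtain ⟨r, -, hr⟩ := Polynomial.isUnit_iff.1 (IsUnit.of_mul_eq_one _ key)
  rw [hS, ← hr, Polynomial.eval_C] at h0 ⊢
  exact h0

/-- On trace zero `2 × 2` matrices, `(ad h)³ = -4 det(h) ad h`. -/
lemma ad_cube {h : MD} (th : h.trace = 0) (e : MD) :
    h * (h * (h * e - e * h) - (h * e - e * h) * h) - (h * (h * e - e * h) - (h * e - e * h) * h) * h
      = (4 * (h 0 0 * h 0 0 + h 0 1 * h 1 0)) • (h * e - e * h) := by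
  have h2 : h * h = (h 0 0 * h 0 0 + h 0 1 * h 1 0) • (1 : MD) := by
    have := eq_of_trace_eq_zero th
    rw [this]
    ext i j : 1; fin_cases i <;> fin_cases j <;>
      simp [Matrix.mul_apply, Fin.sum_univ_two] <;> ring
  generalize h 0 0 * h 0 0 + h 0 1 * h 1 0 = s at h2
  have e1 : h * (h * e - e * h) - (h * e - e * h) * h = (2 * s) • e - (2 : Dhat) • (h * e * h) := by
    calc _ = (h * h) * e + e * (h * h) - (2 : Dhat) • (h * e * h) := by
          simp only [Matrix.mul_sub, Matrix.sub_mul, Matrix.mul_assoc]; module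
      _ = _ := by
          rw [h2, Matrix.smul_mul, Matrix.mul_smul, Matrix.one_mul, Matrix.mul_one]; module
  rw [e1]
  have e2 : h * (h * e * h) = s • (e * h) := by
    rw [Matrix.mul_assoc, ← Matrix.mul_assoc, h2, Matrix.smul_mul, Matrix.one_mul]
  have e3 : (h * e * h) * h = s • (h * e) := by
    rw [Matrix.mul_assoc, h2, Matrix.mul_smul, Matrix.mul_one]
  simp only [Matrix.mul_sub, Matrix.sub_mul, Matrix.mul_smul, Matrix.smul_mul, e2, e3]
  module

/-- If `[h(u), e(w)] = ± 2 e(u + w)` for polynomial families of matrices of trace zero, then `e` is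
constant: by `ad_cube`, `e(2u + w) = -det(h(u)) e(w)`. -/
lemma family_const {h e : ℂ → MD} (th : ∀ u, (h u).trace = 0) (ph : ∀ i j, IsPoly fun u => h u i j)
    {c : Dhat} (hc : c * c = 4) (H : ∀ u w, h u * e w - e w * h u = c • e (u + w)) (w : ℂ) :
    e w = e 0 := by
  set s : ℂ → Dhat := fun u => h u 0 0 * h u 0 0 + h u 0 1 * h u 1 0 with hsdef
  have ps : IsPoly s := ((ph 0 0).mul (ph 0 0)).add ((ph 0 1).mul (ph 1 0))
  have four : (4 : Dhat) ≠ 0 := by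
    rw [show (4 : Dhat) = 2 * 2 by norm_num]; exact mul_ne_zero Dhat.two_ne_zero Dhat.two_ne_zero
  have hc0 : c ≠ 0 := by rintro rfl; rw [mul_zero] at hc; exact four hc.symm
  have h3 : ∀ u w, e (u + (u + w)) = s u • e w := by
    intro u w
    have hsub : w = u + (w - u) := by ring
    have := ad_cube (th u) (e (w - u))
    rw [H, Matrix.mul_smul, Matrix.smul_mul, ← smul_sub, H, smul_smul, Matrix.mul_smul,
      Matrix.smul_mul, ← smul_sub, H, smul_smul, hc, smul_smul, mul_assoc, mul_smul,
      mul_smul (4 : Dhat)] at this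
    have h1 := smul_right_injective _ four this
    rw [mul_comm _ c, mul_smul, ← hsub] at h1
    exact smul_right_injective _ hc0 h1
  by_cases h0 : ∃ w₀, e w₀ ≠ 0
  · obtain ⟨w₀, hw₀⟩ := h0
    have inj : ∀ a b : Dhat, a • e w₀ = b • e w₀ → a = b := fun a b hab =>
      smul_left_injective _ hw₀ hab
    have s0 : s 0 = 1 := inj _ _ (by rw [← h3, zero_add, zero_add, one_smul])
    have s1 : ∀ u, s u * s (-u) = 1 := fun u => inj _ _ (by
      rw [mul_smul, ← h3, ← h3, one_smul]; congr 1; ring)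
    have := h3 (w / 2) 0
    rw [ps.eq_one_of_mul s1 s0, one_smul] at this
    rw [← this]; congr 1; ring
  · push Not at h0
    rw [h0, h0]

/-- A matrix of trace zero that commutes with `E₁₂` and `E₂₁` vanishes. -/
lemma eq_zero_of_commute {X : MD} (tX : X.trace = 0)
    (hE : X * !![0, 1; 0, 0] = !![0, 1; 0, 0] * X) (hF : X * !![0, 0; 1, 0] = !![0, 0; 1, 0] * X) :
    X = 0 := by
  rw [eq_of_trace_eq_zero tX] at hE hF ⊢
  have e1 := congrFun (congrFun hE 0) 0
  have e2 := congrFun (congrFun hE 0) 1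
  have e3 := congrFun (congrFun hF 0) 0
  simp [Matrix.mul_apply, Fin.sum_univ_two] at e1 e2 e3
  have : X 0 0 = 0 := by
    have : (2 : Dhat) * X 0 0 = 0 := by linear_combination e2
    exact (mul_eq_zero.1 this).resolve_left Dhat.two_ne_zero
  ext i j : 1; fin_cases i <;> fin_cases j <;> simp [← e1, e3, this]

lemma toMD_one : toMD (1 : M2) = 1 := by
  rw [toMD, Matrix.map_one _ (map_zero _) (map_one _)]

/-- A map that commutes with the left and the right multiplications by `sl₂(ℂ)` is a homothety. -/
lemma exists_smul_of_equivariant (F : M2 →ₗ[ℂ] MD)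
    (hl : ∀ (X : sl2) (M : M2), F (X.1 * M) = toMD X.1 * F M)
    (hr : ∀ (X : sl2) (M : M2), F (M * X.1) = F M * toMD X.1) :
    ∃ γ : Dhat, ∀ M, F M = γ • toMD M := by
  have hc : ∀ X : sl2, F 1 * toMD X.1 = toMD X.1 * F 1 := fun X => by
    rw [← hl, ← hr, Matrix.one_mul, Matrix.mul_one]
  have hE := hc slE
  have hF := hc slF
  rw [toMD_slE] at hE
  rw [toMD_slF] at hF
  have h1 : F 1 = F 1 0 0 • (1 : MD) := by
    have e1 := congrFun (congrFun hE 0) 0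
    have e2 := congrFun (congrFun hE 0) 1
    have e3 := congrFun (congrFun hF 0) 0
    simp [Matrix.mul_apply, Fin.sum_univ_two] at e1 e2 e3
    ext i j : 1; fin_cases i <;> fin_cases j <;> simp [← e1, ← e2, e3]
  refine ⟨F 1 0 0, fun M => ?_⟩
  have hM : (M - (M.trace / 2) • (1 : M2)).trace = 0 := by
    simp [Matrix.trace_fin_two]
  have h2 := hr ⟨M - (M.trace / 2) • (1 : M2), hM⟩ 1
  dsimp only at h2
  rw [Matrix.one_mul, map_sub, map_smul, h1, Matrix.smul_mul, Matrix.one_mul, toMD_sub, toMD_smul,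
    sub_eq_iff_eq_add] at h2
  rw [h2, toMD_one, smul_sub, smul_comm (F 1 0 0) (M.trace / 2), sub_add_cancel]

/-! ### The bilinear maps in coordinates -/

lemma deltaM_zero : deltaM 0 = 0 := by ext i j : 1; simp [deltaM]

lemma skewR_zero_left (M : M2) : skewR 0 M = 0 := Subtype.ext (by simp [skewR, dag_zero])

lemma skewL_zero_left (M : M2) : skewL 0 M = 0 := Subtype.ext (by simp [skewL, dag_zero])

lemma skewR_zero_right (M : M2) : skewR M 0 = 0 := Subtype.ext (by simp [skewR, dag_zero])

lemma skewL_zero_right (M : M2) : skewL M 0 = 0 := Subtype.ext (by simp [skewL, dag_zero])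

lemma beta_even_even (u w : ℂ) (l c l' c' : Dhat) (X Y X' Y' : MD) :
    beta u w (l, c, X, Y, 0, 0) (l', c', X', Y', 0, 0)
      = (l * (w • l' - delta l') - (u • l - delta l) * l',
        l * (w • c' - delta c') - l' * (u • c - delta c),
        X * X' - X' * X + l • (w • X' - deltaM X') - l' • (u • X - deltaM X),
        Y * Y' - Y' * Y + l • (w • Y' - deltaM Y') - l' • (u • Y - deltaM Y), 0, 0) := by
  have s1 : skR 0 0 = 0 := by simp [skR]
  have s2 : skL 0 0 = 0 := by simp [skL]
  rw [beta, cW_apply, bW_apply, eW_apply]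
  simp only [deltaW, LinearMap.coe_mk, AddHom.coe_mk, Prod.smul_mk, Prod.mk_sub_mk, cFun, bFun, eFun,
    Prod.mk_add_mk, deltaM_zero, s1, s2, smul_zero, sub_zero, add_zero, Matrix.zero_mul, Matrix.mul_zero,
    Matrix.trace_zero, mul_zero, zero_add, zero_sub, neg_zero]

lemma beta_even_odd (u w : ℂ) (l c : Dhat) (X Y M N : MD) :
    beta u w (l, c, X, Y, 0, 0) (0, 0, 0, 0, M, N)
      = (0, 0, 0, 0,
        X * M - M * Y + l • (w • M - deltaM M) - (half * (u • l - delta l)) • M,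
        X * N - N * Y + l • (w • N - deltaM N) + (half * (u • l - delta l)) • N
          - (u • c - delta c) • M + (u • X - deltaM X) * M + M * (u • Y - deltaM Y)) := by
  have s1 : ∀ M, skR 0 M = 0 := fun M => by simp [skR, dag_zero]
  have s2 : ∀ M, skL 0 M = 0 := fun M => by simp [skL, dag_zero]
  have s3 : ∀ M, skR M 0 = 0 := fun M => by simp [skR, dag_zero]
  have s4 : ∀ M, skL M 0 = 0 := fun M => by simp [skL, dag_zero]
  rw [beta, cW_apply, bW_apply, eW_apply]
  simp only [deltaW, LinearMap.coe_mk, AddHom.coe_mk, Prod.smul_mk, Prod.mk_sub_mk, cFun, bFun, eFun,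
    Prod.mk_add_mk, deltaM_zero, s1, s2, s3, s4, smul_zero, sub_zero, add_zero, Matrix.zero_mul,
    Matrix.mul_zero, Matrix.trace_zero, mul_zero, zero_add, zero_sub, neg_zero, zero_mul, zero_smul,
    map_zero, dag_zero, Prod.mk.injEq, true_and]
  abel

lemma beta_Q_odd (u w : ℂ) (N M' N' : MD) :
    (beta u w (0, 0, 0, 0, 0, N) (0, 0, 0, 0, M', N')).2.1 = 2 * (N * dag M').trace := by
  rw [beta, cW_apply, bW_apply, eW_apply]
  simp [deltaW, cFun, bFun, eFun, dag_zero]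

lemma brConst_even (l c l' c' : ℂ) (X Y X' Y' : sl2) :
    brConst (l, c, X, Y, 0, 0) (l', c', X', Y', 0, 0) = (0, 0, ⁅X, X'⁆, ⁅Y, Y'⁆, 0, 0) := by
  rw [brConst_apply]
  simp [brConstFun, skewR_zero_left, skewL_zero_left]

lemma brPartial_even (l c l' c' : ℂ) (X Y X' Y' : sl2) :
    brPartial (l, c, X, Y, 0, 0) (l', c', X', Y', 0, 0) = (l * l', l * c', l • X', l • Y', 0, 0) := by
  rw [brPartial_apply]
  simp [brPartialFun, skewR_zero_left, skewL_zero_left]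

lemma brLambda_even (l c l' c' : ℂ) (X Y X' Y' : sl2) :
    brLambda (l, c, X, Y, 0, 0) (l', c', X', Y', 0, 0)
      = (2 * l * l', l * c' + l' * c, l • X' + l' • X, l • Y' + l' • Y, 0, 0) := by
  rw [brLambda_apply]
  simp [brLambdaFun, skewR_zero_left, skewL_zero_left]

lemma brConst_even_odd (l c : ℂ) (X Y : sl2) (M N : M2) :
    brConst (l, c, X, Y, 0, 0) (0, 0, 0, 0, M, N)
      = (0, 0, 0, 0, X.1 * M - M * Y.1, X.1 * N - N * Y.1) := by
  rw [brConst_apply]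
  simp [brConstFun, skewR_zero_left, skewL_zero_left, skewR_zero_right, skewL_zero_right, dag_zero]

lemma brPartial_even_odd (l c : ℂ) (X Y : sl2) (M N : M2) :
    brPartial (l, c, X, Y, 0, 0) (0, 0, 0, 0, M, N) = (0, 0, 0, 0, l • M, l • N) := by
  rw [brPartial_apply]
  simp [brPartialFun, skewR_zero_left, skewL_zero_left]

lemma brLambda_even_odd (l c : ℂ) (X Y : sl2) (M N : M2) :
    brLambda (l, c, X, Y, 0, 0) (0, 0, 0, 0, M, N)
      = (0, 0, 0, 0, (3 / 2 * l) • M, (1 / 2 * l) • N + c • M - X.1 * M - M * Y.1) := by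
  rw [brLambda_apply]
  simp [brLambdaFun, skewR_zero_left, skewL_zero_left]

/-! ### Values of an automorphism on the generators -/

/-- The map `v ↦ φ(v)`, evaluated at `∂̂ = w`. -/
def genVal (φ : AutConf) (w : ℂ) : V →ₗ[ℂ] WD where
  toFun v := ev w (φ.1 (gen v))
  map_add' v v' := by rw [gen_add, map_add, map_add]
  map_smul' r v := by
    have h : gen (r • v) = algebraMap ℂ Dhat r • gen v := (single_smul_gen r v).symm
    rw [h, map_smul, algebraMap_smul, map_smul, RingHom.id_apply]

lemma iota_injective : Function.Injective iota := by
  rw [← LinearMap.ker_eq_bot, LinearMap.ker_eq_bot']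
  rintro ⟨l, c, X, Y, M, N⟩ h
  have inj := FaithfulSMul.algebraMap_injective ℂ Dhat
  have hM : ∀ M : M2, toMD M = 0 → M = 0 := fun M hM => by
    ext i j : 1
    exact inj ((congrFun (congrFun hM i) j).trans (map_zero _).symm)
  rw [iota_apply] at h
  obtain ⟨h1, h⟩ := Prod.ext_iff.1 h
  obtain ⟨h2, h⟩ := Prod.ext_iff.1 h
  obtain ⟨h3, h⟩ := Prod.ext_iff.1 h
  obtain ⟨h4, h⟩ := Prod.ext_iff.1 h
  obtain ⟨h5, h6⟩ := Prod.ext_iff.1 h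
  exact Prod.ext (inj (h1.trans (map_zero _).symm)) (Prod.ext (inj (h2.trans (map_zero _).symm))
    (Prod.ext (Subtype.ext (hM _ h3)) (Prod.ext (Subtype.ext (hM _ h4))
      (Prod.ext (hM _ h5) (hM _ h6)))))

lemma eq_zero_of_genVal (φ : AutConf) {v : V} (h : ∀ w, genVal φ w v = 0) : v = 0 := by
  have h1 : φ.1 (gen v) = 0 := eq_zero_of_ev h
  rw [LinearEquiv.map_eq_zero_iff] at h1
  have h2 := ev_gen 0 v
  rw [h1, map_zero] at h2
  exact iota_injective (by rw [← h2, map_zero])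

lemma genVal_even (φ : AutConf) (w : ℂ) (l c : ℂ) (X Y : sl2) :
    genVal φ w (l, c, X, Y, 0, 0) = ((genVal φ w (l, c, X, Y, 0, 0)).1,
      (genVal φ w (l, c, X, Y, 0, 0)).2.1,
      (genVal φ w (l, c, X, Y, 0, 0)).2.2.1, (genVal φ w (l, c, X, Y, 0, 0)).2.2.2.1, 0, 0) := by
  have h : gen (l, c, X, Y, 0, 0) ∈ evenPart := (mem_evenPart_iff _).2 fun w => by
    rw [ev_gen, iota_apply, toMD_zero]; rfl
  have h2 := (mem_evenPart_iff _).1 ((φ.2.1 _).2 h) w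
  exact Prod.ext rfl (Prod.ext rfl (Prod.ext rfl (Prod.ext rfl h2)))

lemma genVal_odd (φ : AutConf) (w : ℂ) (M N : M2) :
    genVal φ w (0, 0, 0, 0, M, N) = (0, 0, 0, 0, (genVal φ w (0, 0, 0, 0, M, N)).2.2.2.2.1,
      (genVal φ w (0, 0, 0, 0, M, N)).2.2.2.2.2) := by
  have h : gen (0, 0, 0, 0, M, N) ∈ oddPart := (mem_oddPart_iff _).2 fun w => by
    rw [ev_gen, iota_apply, map_zero, ZeroMemClass.coe_zero, toMD_zero]; rfl
  have h2 := (mem_oddPart_iff _).1 ((φ.2.2.1 _).2 h) w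
  obtain ⟨h3, h2⟩ := Prod.ext_iff.1 h2
  obtain ⟨h4, h2⟩ := Prod.ext_iff.1 h2
  obtain ⟨h5, h6⟩ := Prod.ext_iff.1 h2
  exact Prod.ext h3 (Prod.ext h4 (Prod.ext h5 (Prod.ext h6 rfl)))

lemma trace_genVal (φ : AutConf) (w : ℂ) (v : V) :
    (genVal φ w v).2.2.1.trace = 0 ∧ (genVal φ w v).2.2.2.1.trace = 0 := isTl_ev _ _

lemma genVal_bracket_even (φ : AutConf) (u w : ℂ) (l c l' c' : ℂ) (X Y X' Y' : sl2)
    {L C L' C' : Dhat} {P Q P' Q' : MD} (h : genVal φ u (l, c, X, Y, 0, 0) = (L, C, P, Q, 0, 0))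
    (h' : genVal φ w (l', c', X', Y', 0, 0) = (L', C', P', Q', 0, 0)) :
    (L * (w • L' - delta L') - (u • L - delta L) * L',
      L * (w • C' - delta C') - L' * (u • C - delta C),
      P * P' - P' * P + L • (w • P' - deltaM P') - L' • (u • P - deltaM P),
      Q * Q' - Q' * Q + L • (w • Q' - deltaM Q') - L' • (u • Q - deltaM Q), 0, 0)
    = genVal φ (u + w) (0, 0, ⁅X, X'⁆, ⁅Y, Y'⁆, 0, 0)
      + (u + w) • genVal φ (u + w) (l * l', l * c', l • X', l • Y', 0, 0)
      - u • genVal φ (u + w) (2 * l * l', l * c' + l' * c, l • X' + l' • X, l • Y' + l' • Y, 0, 0) := by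
  rw [← beta_even_even, ← h, ← h']
  have := AutConf.beta_ev φ u w (l, c, X, Y, 0, 0) (l', c', X', Y', 0, 0)
  rw [brConst_even, brPartial_even, brLambda_even] at this
  exact this

/-- The coefficient of `L` vanishes in the image of a generator `v` with `[v _λ v] = 0`. -/
lemma genVal_fst (φ : AutConf) (c : ℂ) (X Y : sl2) (w : ℂ) :
    (genVal φ w (0, c, X, Y, 0, 0)).1 = 0 := by
  by_contra h0
  have hp : IsPoly fun w => (genVal φ w (0, c, X, Y, 0, 0)).1 :=
    isPoly_ev (LinearMap.fst ℂ _ _) _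
  refine h0 (hp.eq_zero_of_smul_eq h0 (b := w • (genVal φ w (0, c, X, Y, 0, 0)).1
    - delta (genVal φ w (0, c, X, Y, 0, 0)).1) (fun z => ?_) w)
  have h := genVal_bracket_even φ w z _ _ _ _ _ _ _ _ (genVal_even φ w 0 c X Y)
    (genVal_even φ z 0 c X Y)
  have z0 : ((0, 0, 0, 0, 0, 0) : V) = 0 := rfl
  simp only [lie_self, mul_zero, zero_mul, zero_smul, add_zero, z0, map_zero, smul_zero,
    sub_zero] at h
  have h1 := congrArg Prod.fst h
  change _ - _ = (0 : Dhat) at h1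
  rw [← mul_smul_comm]
  linear_combination h1

lemma slH_val : slH.1 = !![1, 0; 0, -1] := by
  simp only [slH, LieAlgebra.SpecialLinear.val_singleSubSingle]
  ext i j : 1; fin_cases i <;> fin_cases j <;> simp [Matrix.single]

lemma slE_val : slE.1 = !![0, 1; 0, 0] := by
  simp only [slE, LieAlgebra.SpecialLinear.val_single]
  ext i j : 1; fin_cases i <;> fin_cases j <;> simp [Matrix.single]

lemma slF_val : slF.1 = !![0, 0; 1, 0] := by
  simp only [slF, LieAlgebra.SpecialLinear.val_single]
  ext i j : 1; fin_cases i <;> fin_cases j <;> simp [Matrix.single]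

lemma lie_slH_slE : ⁅slH, slE⁆ = (2 : ℂ) • slE := by
  apply Subtype.ext
  change slH.1 * slE.1 - slE.1 * slH.1 = (2 : ℂ) • slE.1
  rw [slH_val, slE_val]
  ext i j : 1; fin_cases i <;> fin_cases j <;> simp [Matrix.mul_apply, Fin.sum_univ_two]
  norm_num

lemma lie_slH_slF : ⁅slH, slF⁆ = (-2 : ℂ) • slF := by
  apply Subtype.ext
  change slH.1 * slF.1 - slF.1 * slH.1 = (-2 : ℂ) • slF.1
  rw [slH_val, slF_val]
  ext i j : 1; fin_cases i <;> fin_cases j <;> simp [Matrix.mul_apply, Fin.sum_univ_two]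
  norm_num

lemma lie_slE_slF : ⁅slE, slF⁆ = slH := by
  apply Subtype.ext
  change slE.1 * slF.1 - slF.1 * slE.1 = slH.1
  rw [slH_val, slE_val, slF_val]
  ext i j : 1; fin_cases i <;> fin_cases j <;> simp [Matrix.mul_apply, Fin.sum_univ_two]

/-- The coordinate `X` of a tuple. -/
def coordTp : WD →ₗ[ℂ] MD where
  toFun x := x.2.2.1
  map_add' _ _ := rfl
  map_smul' _ _ := rfl

/-- The coordinate `Y` of a tuple. -/
def coordTm : WD →ₗ[ℂ] MD where
  toFun x := x.2.2.2.1
  map_add' _ _ := rfl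
  map_smul' _ _ := rfl

/-- A matrix entry, as a linear map. -/
def entry (i j : Fin 2) : MD →ₗ[ℂ] Dhat where
  toFun X := X i j
  map_add' _ _ := rfl
  map_smul' _ _ := rfl

/-- The vector `T⁺(a(X)) + T⁻(b(X))`, for endomorphisms `a` and `b` of `sl₂(ℂ)`. -/
def inT (a b : sl2 →ₗ⁅ℂ⁆ sl2) : sl2 →ₗ[ℂ] V where
  toFun X := (0, 0, a X, b X, 0, 0)
  map_add' X Y := by simp
  map_smul' r X := by simp

lemma inT_apply (a b : sl2 →ₗ⁅ℂ⁆ sl2) (X : sl2) : inT a b X = (0, 0, a X, b X, 0, 0) := rfl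

lemma genVal_inT (φ : AutConf) (a b : sl2 →ₗ⁅ℂ⁆ sl2) (w : ℂ) (X : sl2) :
    genVal φ w (inT a b X) = (0, (genVal φ w (inT a b X)).2.1, (genVal φ w (inT a b X)).2.2.1,
      (genVal φ w (inT a b X)).2.2.2.1, 0, 0) := by
  have h := genVal_even φ w 0 0 (a X) (b X)
  rw [genVal_fst φ] at h
  exact h

lemma genVal_inT_lie (φ : AutConf) (a b : sl2 →ₗ⁅ℂ⁆ sl2) (u w : ℂ) (X X' : sl2) :
    genVal φ (u + w) (inT a b ⁅X, X'⁆) = (0, 0,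
      (genVal φ u (inT a b X)).2.2.1 * (genVal φ w (inT a b X')).2.2.1
        - (genVal φ w (inT a b X')).2.2.1 * (genVal φ u (inT a b X)).2.2.1,
      (genVal φ u (inT a b X)).2.2.2.1 * (genVal φ w (inT a b X')).2.2.2.1
        - (genVal φ w (inT a b X')).2.2.2.1 * (genVal φ u (inT a b X)).2.2.2.1, 0, 0) := by
  have h := genVal_bracket_even φ u w _ _ _ _ _ _ _ _ (genVal_inT φ a b u X) (genVal_inT φ a b w X')
  have z0 : ((0, 0, 0, 0, 0, 0) : V) = 0 := rfl
  simp only [mul_zero, zero_mul, zero_smul, add_zero, z0, map_zero, smul_zero, sub_zero] at h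
  rw [inT_apply, LieHom.map_lie, LieHom.map_lie]
  exact h.symm

/-- Families that satisfy the relations of `sl₂` in the shape `[x(u), y(w)] = [x, y](u + w)` are
constant. -/
lemma triple_const {h e f : ℂ → MD} (th : ∀ u, (h u).trace = 0)
    (ph : ∀ i j, IsPoly fun u => h u i j)
    (he : ∀ u w, h u * e w - e w * h u = (2 : ℂ) • e (u + w))
    (hf : ∀ u w, h u * f w - f w * h u = (-2 : ℂ) • f (u + w))
    (hef : ∀ u w, e u * f w - f w * e u = h (u + w)) (w : ℂ) :
    h w = h 0 ∧ e w = e 0 ∧ f w = f 0 := by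
  have he' : ∀ w, e w = e 0 := family_const (c := 2) th ph (by norm_num) fun u w => by
    rw [he, ← algebraMap_smul_MD, map_ofNat]
  have hf' : ∀ w, f w = f 0 := family_const (c := -2) th ph (by norm_num) fun u w => by
    rw [hf, ← algebraMap_smul_MD, map_neg, map_ofNat]
  refine ⟨?_, he' w, hf' w⟩
  have h1 := hef w 0
  have h2 := hef 0 0
  rw [add_zero] at h1 h2
  rw [← h1, ← h2, he' w]

lemma sl2_induction {p : sl2 → Prop} (hH : p slH) (hE : p slE) (hF : p slF)
    (add : ∀ X Y, p X → p Y → p (X + Y)) (smul : ∀ (r : ℂ) X, p X → p (r • X)) (X : sl2) : p X := by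
  rw [sl2_eq X]
  exact add _ _ (add _ _ (smul _ _ hH) (smul _ _ hE)) (smul _ _ hF)

/-- The `ℂ`-linear Lie homomorphisms from `sl₂(ℂ)` to `sl₂(D̂)`, as maps to all matrices. -/
structure IsSlMap (P : sl2 →ₗ[ℂ] MD) : Prop where
  trace : ∀ X, (P X).trace = 0
  lie : ∀ X Y, P ⁅X, Y⁆ = P X * P Y - P Y * P X

/-- The images of `T⁺(sl₂)` and `T⁻(sl₂)` have no component along `U`, and they do not depend on
`w`, that is, they do not involve `∂̂`. -/
lemma genVal_inT_const (φ : AutConf) (a b : sl2 →ₗ⁅ℂ⁆ sl2) (w : ℂ) (X : sl2) :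
    genVal φ w (inT a b X) = genVal φ 0 (inT a b X) ∧ (genVal φ w (inT a b X)).2.1 = 0 := by
  have hp1 : ∀ i j, IsPoly fun u => (genVal φ u (inT a b slH)).2.2.1 i j := fun i j =>
    isPoly_ev (entry i j ∘ₗ coordTp) _
  have hp2 : ∀ i j, IsPoly fun u => (genVal φ u (inT a b slH)).2.2.2.1 i j := fun i j =>
    isPoly_ev (entry i j ∘ₗ coordTm) _
  have he := fun u w => genVal_inT_lie φ a b u w slH slE
  have hf := fun u w => genVal_inT_lie φ a b u w slH slF
  have hef := fun u w => genVal_inT_lie φ a b u w slE slF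
  simp only [lie_slH_slE, lie_slH_slF, lie_slE_slF, map_smul] at he hf hef
  have t1 := triple_const (fun u => (trace_genVal φ u _).1) hp1
    (fun u w => (congrArg (fun x : WD => x.2.2.1) (he u w)).symm)
    (fun u w => (congrArg (fun x : WD => x.2.2.1) (hf u w)).symm)
    (fun u w => (congrArg (fun x : WD => x.2.2.1) (hef u w)).symm)
  have t2 := triple_const (fun u => (trace_genVal φ u _).2) hp2
    (fun u w => (congrArg (fun x : WD => x.2.2.2.1) (he u w)).symm)
    (fun u w => (congrArg (fun x : WD => x.2.2.2.1) (hf u w)).symm)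
    (fun u w => (congrArg (fun x : WD => x.2.2.2.1) (hef u w)).symm)
  have c1 : ∀ w, (genVal φ w (inT a b slH)).2.1 = 0 := fun w => by
    have := congrArg (fun x : WD => x.2.1) (hef w 0)
    rwa [add_zero] at this
  have c2 : ∀ w, (genVal φ w (inT a b slE)).2.1 = 0 := fun w => by
    have := congrArg (fun x : WD => x.2.1) (he w 0)
    rw [add_zero] at this
    change (2 : ℂ) • (genVal φ w (inT a b slE)).2.1 = 0 at this
    exact (smul_eq_zero.1 this).resolve_left (by norm_num)
  have c3 : ∀ w, (genVal φ w (inT a b slF)).2.1 = 0 := fun w => by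
    have := congrArg (fun x : WD => x.2.1) (hf w 0)
    rw [add_zero] at this
    change (-2 : ℂ) • (genVal φ w (inT a b slF)).2.1 = 0 at this
    exact (smul_eq_zero.1 this).resolve_left (by norm_num)
  have comb : ∀ X : sl2, (∀ w, (genVal φ w (inT a b X)).2.1 = 0) →
      (genVal φ w (inT a b X)).2.2.1 = (genVal φ 0 (inT a b X)).2.2.1 →
      (genVal φ w (inT a b X)).2.2.2.1 = (genVal φ 0 (inT a b X)).2.2.2.1 →
      genVal φ w (inT a b X) = genVal φ 0 (inT a b X) ∧ (genVal φ w (inT a b X)).2.1 = 0 :=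
    fun X h1 h2 h3 => by
      refine ⟨?_, h1 w⟩
      rw [genVal_inT φ a b w, genVal_inT φ a b 0, h1, h1, h2, h3]
  refine sl2_induction (p := fun X => genVal φ w (inT a b X) = genVal φ 0 (inT a b X) ∧
    (genVal φ w (inT a b X)).2.1 = 0) (comb _ c1 (t1 w).1 (t2 w).1) (comb _ c2 (t1 w).2.1 (t2 w).2.1)
    (comb _ c3 (t1 w).2.2 (t2 w).2.2) (fun X Y hX hY => ?_) (fun r X hX => ?_) X
  · rw [map_add, map_add, map_add, hX.1, hY.1]
    rw [hX.1] at hX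
    rw [hY.1] at hY
    exact ⟨rfl, by rw [Prod.snd_add, Prod.fst_add, hX.2, hY.2, add_zero]⟩
  · rw [map_smul, map_smul, map_smul, hX.1]
    rw [hX.1] at hX
    exact ⟨rfl, by rw [Prod.smul_snd, Prod.smul_fst, hX.2, smul_zero]⟩

lemma exists_slMap (φ : AutConf) (a b : sl2 →ₗ⁅ℂ⁆ sl2) :
    ∃ P Q : sl2 →ₗ[ℂ] MD, IsSlMap P ∧ IsSlMap Q ∧
      ∀ w X, genVal φ w (inT a b X) = (0, 0, P X, Q X, 0, 0) := by
  refine ⟨coordTp ∘ₗ genVal φ 0 ∘ₗ inT a b, coordTm ∘ₗ genVal φ 0 ∘ₗ inT a b,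
    ⟨fun X => (trace_genVal φ 0 _).1, fun X Y => ?_⟩,
    ⟨fun X => (trace_genVal φ 0 _).2, fun X Y => ?_⟩, fun w X => ?_⟩
  · have := congrArg (fun x : WD => x.2.2.1) (genVal_inT_lie φ a b 0 0 X Y)
    rwa [add_zero] at this
  · have := congrArg (fun x : WD => x.2.2.2.1) (genVal_inT_lie φ a b 0 0 X Y)
    rwa [add_zero] at this
  · have h := congrArg (fun x : WD => x.2.2.2.2) (genVal_inT φ a b 0 X)
    rw [(genVal_inT_const φ a b w X).1]
    exact Prod.ext (genVal_fst φ _ _ _ _) (Prod.ext (genVal_inT_const φ a b 0 X).2 (Prod.ext rfl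
      (Prod.ext rfl h)))

lemma IsSlMap.eq_zero_or_conj {P : sl2 →ₗ[ℂ] MD} (hP : IsSlMap P) :
    P = 0 ∨ ∃ A : SLD, ∀ X, P X = A.1 * toMD X.1 * (A⁻¹).1 := by
  have he := hP.lie slH slE
  have hf := hP.lie slH slF
  have hef := hP.lie slE slF
  rw [lie_slH_slE, map_smul] at he
  rw [lie_slH_slF, map_smul] at hf
  rw [lie_slE_slF] at hef
  by_cases h0 : P slE = 0
  · left
    have hH : P slH = 0 := by rw [hef, h0, Matrix.zero_mul, Matrix.mul_zero, sub_zero]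
    have hF : P slF = 0 := by
      rw [hH, Matrix.zero_mul, Matrix.mul_zero, sub_zero] at hf
      exact (smul_eq_zero.1 hf).resolve_left (by norm_num)
    refine LinearMap.ext fun X => ?_
    exact sl2_induction (p := fun X => P X = 0) hH h0 hF
      (fun X Y hX hY => by rw [map_add, hX, hY, add_zero])
      (fun r X hX => by rw [map_smul, hX, smul_zero]) X
  · right
    obtain ⟨A, e1, e2, e3⟩ := exists_conj_of_sl2_triple (hP.trace slE) (hP.trace slH) (hP.trace slF)
      (by rw [← he, ← algebraMap_smul_MD, map_ofNat])
      (by rw [← hf, ← algebraMap_smul_MD, map_neg, map_ofNat]) hef.symm h0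
    refine ⟨A, fun X => ?_⟩
    exact sl2_induction (p := fun X => P X = A.1 * toMD X.1 * (A⁻¹).1)
      (by rw [e2, toMD_slH]) (by rw [e1, toMD_slE]) (by rw [e3, toMD_slF])
      (fun X Y hX hY => by
        change P (X + Y) = A.1 * toMD (X.1 + Y.1) * (A⁻¹).1
        rw [map_add, hX, hY, toMD_add, Matrix.mul_add, Matrix.add_mul])
      (fun r X hX => by
        change P (r • X) = A.1 * toMD (r • X.1) * (A⁻¹).1
        rw [map_smul, hX, toMD_smul, Matrix.mul_smul, Matrix.smul_mul]) X

lemma eq_zero_of_commute_toMD {X : MD} (tX : X.trace = 0)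
    (h : ∀ Y : sl2, X * toMD Y.1 = toMD Y.1 * X) : X = 0 :=
  eq_zero_of_commute tX (by rw [← toMD_slE, h]) (by rw [← toMD_slF, h])

/-- The centralizer of a conjugate of `sl₂(ℂ)` in `sl₂(D̂)` is zero. -/
lemma IsSlMap.eq_zero_of_commute {P Q : sl2 →ₗ[ℂ] MD} (hQ : IsSlMap Q) {A : SLD}
    (hP : ∀ X, P X = A.1 * toMD X.1 * (A⁻¹).1) (h : ∀ X Y, P X * Q Y = Q Y * P X) : Q = 0 := by
  refine LinearMap.ext fun Y => ?_
  have h1 : (A⁻¹).1 * Q Y * A.1 = 0 := by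
    refine eq_zero_of_commute_toMD ?_ fun X => ?_
    · rw [Matrix.trace_mul_comm, ← Matrix.mul_assoc, SLD.mul_inv_coe, Matrix.one_mul]
      exact hQ.trace Y
    · have h2 := congrArg (fun Z => (A⁻¹).1 * Z * A.1) (h X Y)
      simp only [hP, Matrix.mul_assoc, SLD.inv_mul_cancel_assoc, SLD.inv_mul_coe,
        Matrix.mul_one] at h2 ⊢
      exact h2.symm
  have h2 := congrArg (fun Z => A.1 * Z * (A⁻¹).1) h1
  simp only [Matrix.mul_assoc, SLD.mul_inv_cancel_assoc, SLD.mul_inv_coe, Matrix.mul_one,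
    Matrix.mul_zero, Matrix.zero_mul] at h2
  exact h2

/-- An automorphism maps each of `T⁺(sl₂)` and `T⁻(sl₂)` onto a conjugate of itself, or it swaps them
up to conjugation. -/
lemma genVal_T (φ : AutConf) :
    (∃ A B : SLD, ∀ w X Y, genVal φ w (0, 0, X, Y, 0, 0)
      = (0, 0, A.1 * toMD X.1 * (A⁻¹).1, B.1 * toMD Y.1 * (B⁻¹).1, 0, 0)) ∨
    (∃ A B : SLD, ∀ w X Y, genVal φ w (0, 0, X, Y, 0, 0)
      = (0, 0, A.1 * toMD Y.1 * (A⁻¹).1, B.1 * toMD X.1 * (B⁻¹).1, 0, 0)) := by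
  obtain ⟨P₁, Q₁, hP₁, hQ₁, h₁⟩ := exists_slMap φ LieHom.id 0
  obtain ⟨P₂, Q₂, hP₂, hQ₂, h₂⟩ := exists_slMap φ 0 LieHom.id
  have h₁' : ∀ w X, genVal φ w (0, 0, X, 0, 0, 0) = (0, 0, P₁ X, Q₁ X, 0, 0) := h₁
  have h₂' : ∀ w X, genVal φ w (0, 0, 0, X, 0, 0) = (0, 0, P₂ X, Q₂ X, 0, 0) := h₂
  have hadd : ∀ w X Y, genVal φ w (0, 0, X, Y, 0, 0) = (0, 0, P₁ X + P₂ Y, Q₁ X + Q₂ Y, 0, 0) :=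
    fun w X Y => by
      have : ((0, 0, X, Y, 0, 0) : V) = (0, 0, X, 0, 0, 0) + (0, 0, 0, Y, 0, 0) := by simp
      rw [this, map_add, h₁', h₂']; simp
  have hcomm : ∀ X Y, P₁ X * P₂ Y = P₂ Y * P₁ X ∧ Q₁ X * Q₂ Y = Q₂ Y * Q₁ X := fun X Y => by
    have h := genVal_bracket_even φ 0 0 _ _ _ _ _ _ _ _ (h₁' 0 X) (h₂' 0 Y)
    have z0 : ((0, 0, 0, 0, 0, 0) : V) = 0 := rfl
    simp only [lie_zero, zero_lie, mul_zero, zero_mul, zero_smul, add_zero, z0, map_zero, smul_zero,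
      sub_zero] at h
    exact ⟨sub_eq_zero.1 (congrArg (fun x : WD => x.2.2.1) h),
      sub_eq_zero.1 (congrArg (fun x : WD => x.2.2.2.1) h)⟩
  have hE : slE ≠ 0 := fun h => by
    have := congrFun (congrFun (congrArg Subtype.val h) 0) 1
    rw [slE_val] at this
    simp at this
  have ne₁ : ¬ (P₁ = 0 ∧ Q₁ = 0) := fun ⟨h, h'⟩ => hE (by
    have := eq_zero_of_genVal φ (v := (0, 0, slE, 0, 0, 0)) fun w => by rw [h₁', h, h']; rfl
    exact congrArg (fun x : V => x.2.2.1) this)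
  have ne₂ : ¬ (P₂ = 0 ∧ Q₂ = 0) := fun ⟨h, h'⟩ => hE (by
    have := eq_zero_of_genVal φ (v := (0, 0, 0, slE, 0, 0)) fun w => by rw [h₂', h, h']; rfl
    exact congrArg (fun x : V => x.2.2.2.1) this)
  rcases hP₁.eq_zero_or_conj with p0 | ⟨A, hA⟩
  · obtain ⟨B, hB⟩ := hQ₁.eq_zero_or_conj.resolve_left fun h => ne₁ ⟨p0, h⟩
    have q0 := hQ₂.eq_zero_of_commute hB fun X Y => (hcomm X Y).2
    obtain ⟨A, hA⟩ := hP₂.eq_zero_or_conj.resolve_left fun h => ne₂ ⟨h, q0⟩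
    refine Or.inr ⟨A, B, fun w X Y => ?_⟩
    rw [hadd, p0, q0, hA, hB, LinearMap.zero_apply, LinearMap.zero_apply, zero_add, add_zero]
  · have p0 := hP₂.eq_zero_of_commute hA fun X Y => (hcomm X Y).1
    obtain ⟨B, hB⟩ := hQ₂.eq_zero_or_conj.resolve_left fun h => ne₂ ⟨p0, h⟩
    have q0 := hQ₁.eq_zero_of_commute hB fun X Y => (hcomm Y X).2.symm
    refine Or.inl ⟨A, B, fun w X Y => ?_⟩
    rw [hadd, p0, q0, hA, hB, LinearMap.zero_apply, LinearMap.zero_apply, zero_add, add_zero]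

/-! ### Automorphisms that fix `T⁺` and `T⁻` -/

lemma genVal_bracket_even_odd (φ : AutConf) (u w : ℂ) (l c : ℂ) (X Y : sl2) (M N : M2)
    {L C : Dhat} {P Q M' N' : MD} (h : genVal φ u (l, c, X, Y, 0, 0) = (L, C, P, Q, 0, 0))
    (h' : genVal φ w (0, 0, 0, 0, M, N) = (0, 0, 0, 0, M', N')) :
    (0, 0, 0, 0,
        P * M' - M' * Q + L • (w • M' - deltaM M') - (half * (u • L - delta L)) • M',
        P * N' - N' * Q + L • (w • N' - deltaM N') + (half * (u • L - delta L)) • N'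
          - (u • C - delta C) • M' + (u • P - deltaM P) * M' + M' * (u • Q - deltaM Q))
    = genVal φ (u + w) (0, 0, 0, 0, X.1 * M - M * Y.1, X.1 * N - N * Y.1)
      + (u + w) • genVal φ (u + w) (0, 0, 0, 0, l • M, l • N)
      - u • genVal φ (u + w) (0, 0, 0, 0, (3 / 2 * l) • M,
        (1 / 2 * l) • N + c • M - X.1 * M - M * Y.1) := by
  rw [← beta_even_odd, ← h, ← h']
  have := AutConf.beta_ev φ u w (l, c, X, Y, 0, 0) (0, 0, 0, 0, M, N)
  rw [brConst_even_odd, brPartial_even_odd, brLambda_even_odd] at this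
  exact this

/-- The coordinate `M` of a tuple. -/
def coordG : WD →ₗ[ℂ] MD where
  toFun x := x.2.2.2.2.1
  map_add' _ _ := rfl
  map_smul' _ _ := rfl

/-- The coordinate `N` of a tuple. -/
def coordQ : WD →ₗ[ℂ] MD where
  toFun x := x.2.2.2.2.2
  map_add' _ _ := rfl
  map_smul' _ _ := rfl

/-- The vector `G(M)`. -/
def inG : M2 →ₗ[ℂ] V where
  toFun M := (0, 0, 0, 0, M, 0)
  map_add' M N := by simp
  map_smul' r M := by simp

/-- The vector `Q(M)`. -/
def inQ : M2 →ₗ[ℂ] V where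
  toFun M := (0, 0, 0, 0, 0, M)
  map_add' M N := by simp
  map_smul' r M := by simp

/-- A family of maps that commutes with `sl₂(ℂ) × sl₂(ℂ)` up to a shift of the parameter is constant,
and a homothety. -/
lemma exists_smul_of_equivariant_family (F : ℂ → M2 →ₗ[ℂ] MD)
    (h : ∀ u w (X Y : sl2) M, F (u + w) (X.1 * M - M * Y.1) = toMD X.1 * F w M - F w M * toMD Y.1) :
    ∃ γ : Dhat, ∀ w M, F w M = γ • toMD M := by
  have hl : ∀ u w (X : sl2) M, F (u + w) (X.1 * M) = toMD X.1 * F w M := fun u w X M => by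
    have := h u w X 0 M
    rwa [ZeroMemClass.coe_zero, toMD_zero, Matrix.mul_zero, Matrix.mul_zero, sub_zero,
      sub_zero] at this
  have hr : ∀ u w (X : sl2) M, F (u + w) (M * X.1) = F w M * toMD X.1 := fun u w X M => by
    have := h u w 0 X M
    rwa [ZeroMemClass.coe_zero, toMD_zero, Matrix.zero_mul, Matrix.zero_mul, zero_sub,
      zero_sub, map_neg, neg_inj] at this
  obtain ⟨γ, hγ⟩ := exists_smul_of_equivariant (F 0)
    (fun X M => by have := hl 0 0 X M; rwa [zero_add] at this)
    (fun X M => by have := hr 0 0 X M; rwa [zero_add] at this)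
  have hH : slH.1 * slH.1 = 1 := by
    rw [slH_val]
    ext i j : 1; fin_cases i <;> fin_cases j <;> simp [Matrix.mul_apply, Fin.sum_univ_two]
  refine ⟨γ, fun w M => ?_⟩
  have h1 := hl w 0 slH (slH.1 * M)
  rw [add_zero, hγ, Matrix.mul_smul, ← toMD_mul, ← Matrix.mul_assoc, hH, Matrix.one_mul] at h1
  exact h1

lemma toMD_slE_ne_zero : toMD slE.1 ≠ 0 := fun h => by
  have := congrFun (congrFun h 0) 1
  rw [toMD_slE] at this
  exact one_ne_zero this

/-- The automorphisms that fix all `T⁺(X)` and all `T⁻(Y)`. -/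
def FixesT (φ : AutConf) : Prop :=
  ∀ w X Y, genVal φ w (0, 0, X, Y, 0, 0) = (0, 0, toMD X.1, toMD Y.1, 0, 0)

/-- The image of `L` is `L` up to a multiple of `U`: by `[L_λ T^±(X)]`, its components along `T^±`
centralize `sl₂(ℂ)`. -/
lemma genVal_L_of_fixesT {φ : AutConf} (hT : FixesT φ) (w : ℂ) :
    genVal φ w (1, 0, 0, 0, 0, 0) = (1, (genVal φ w (1, 0, 0, 0, 0, 0)).2.1, 0, 0, 0, 0) := by
  have hT' : ∀ w X Y, genVal φ w (0, 0, X, Y, 0, 0) = (0, 0, toMD X.1, toMD Y.1, 0, 0) := hT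
  have key : ∀ (z : ℂ) (X Y : sl2), _ := fun z X Y =>
    genVal_bracket_even φ w z _ _ _ _ _ _ _ _ (genVal_even φ w 1 0 0 0) (hT z X Y)
  have hr : ∀ (z : ℂ) (X Y : sl2), (w + z) • ((0, 0, toMD X.1, toMD Y.1, 0, 0) : WD)
      - w • ((0, 0, toMD X.1, toMD Y.1, 0, 0) : WD) = z • (0, 0, toMD X.1, toMD Y.1, 0, 0) :=
    fun z X Y => by rw [← sub_smul, add_sub_cancel_left]
  have z0 : ((0, 0, 0, 0, 0, 0) : V) = 0 := rfl
  simp only [zero_lie, mul_zero, mul_one, zero_mul, one_smul, zero_smul, add_zero, z0, map_zero,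
    smul_zero, sub_zero, zero_add, hT', deltaM_toMD, hr] at key
  set E := genVal φ w (1, 0, 0, 0, 0, 0) with hE
  have kX : ∀ z (X : sl2), E.2.2.1 * toMD X.1 - toMD X.1 * E.2.2.1 + E.1 • z • toMD X.1
      = z • toMD X.1 := fun z X => congrArg coordTp (key z X 0)
  have kY : ∀ z (Y : sl2), E.2.2.2.1 * toMD Y.1 - toMD Y.1 * E.2.2.2.1 + E.1 • z • toMD Y.1
      = z • toMD Y.1 := fun z Y => congrArg coordTm (key z 0 Y)
  have hX : E.2.2.1 = 0 := eq_zero_of_commute_toMD (trace_genVal φ w _).1 fun X => by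
    have := kX 0 X
    rwa [zero_smul, smul_zero, add_zero, sub_eq_zero] at this
  have hY : E.2.2.2.1 = 0 := eq_zero_of_commute_toMD (trace_genVal φ w _).2 fun X => by
    have := kY 0 X
    rwa [zero_smul, smul_zero, add_zero, sub_eq_zero] at this
  have h1 : E.1 = 1 := by
    have := kX 1 slE
    rw [hX, Matrix.zero_mul, Matrix.mul_zero, sub_zero, zero_add, one_smul] at this
    exact smul_left_injective _ toMD_slE_ne_zero (this.trans (one_smul _ _).symm)
  rw [hE, genVal_even φ w 1 0 0 0, ← hE, h1, hX, hY]

lemma genVal_U_of_fixesT {φ : AutConf} (hT : FixesT φ) (w : ℂ) :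
    genVal φ w (0, 1, 0, 0, 0, 0) = (0, (genVal φ w (0, 1, 0, 0, 0, 0)).2.1, 0, 0, 0, 0) := by
  have hE0 := genVal_even φ w 0 1 0 0
  rw [genVal_fst] at hE0
  have key : ∀ (X Y : sl2), _ := fun X Y =>
    genVal_bracket_even φ w 0 _ _ _ _ _ _ _ _ hE0 (hT 0 X Y)
  have z0 : ((0, 0, 0, 0, 0, 0) : V) = 0 := rfl
  simp only [zero_lie, mul_zero, zero_mul, zero_smul, add_zero, z0, map_zero,
    smul_zero, sub_zero, zero_add] at key
  have hX := eq_zero_of_commute_toMD (trace_genVal φ w (0, 1, 0, 0, 0, 0)).1 fun X =>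
    sub_eq_zero.1 (congrArg coordTp (key X 0))
  have hY := eq_zero_of_commute_toMD (trace_genVal φ w (0, 1, 0, 0, 0, 0)).2 fun X =>
    sub_eq_zero.1 (congrArg coordTm (key 0 X))
  rw [hX, hY] at hE0
  exact hE0

/-- The brackets of `T^±` with the odd generators, for an automorphism that fixes `T^±`. -/
lemma genVal_T_odd_of_fixesT {φ : AutConf} (hT : FixesT φ) (u w : ℂ)
    (X Y : sl2) (M N : M2) {M' N' : MD}
    (h' : genVal φ w (0, 0, 0, 0, M, N) = (0, 0, 0, 0, M', N')) :
    (0, 0, 0, 0, toMD X.1 * M' - M' * toMD Y.1,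
      toMD X.1 * N' - N' * toMD Y.1 + u • (toMD X.1 * M' + M' * toMD Y.1))
    = genVal φ (u + w) (0, 0, 0, 0, X.1 * M - M * Y.1, X.1 * N - N * Y.1)
      + u • genVal φ (u + w) (inQ (X.1 * M + M * Y.1)) := by
  have key := genVal_bracket_even_odd φ u w _ _ _ _ _ _ (hT u X Y) h'
  have z0 : ((0, 0, 0, 0, 0, 0) : V) = 0 := rfl
  have e : ((0, 0, 0, 0, 0, -(X.1 * M) - M * Y.1) : V) = -inQ (X.1 * M + M * Y.1) := by
    rw [← map_neg, neg_add']; rfl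
  simp only [mul_zero, zero_mul, zero_smul, add_zero, z0, map_zero, smul_zero, sub_zero, zero_add,
    deltaM_toMD, zero_sub, sub_self, e, map_neg, smul_neg, sub_neg_eq_add] at key
  rw [← key, Matrix.smul_mul, Matrix.mul_smul, smul_add, add_assoc]

/-- `δ_t` does not change the degree in `u`, so that `u g(u) = δ_t g(u)` only for `g = 0`. -/
lemma eq_zero_of_smul_eq_delta {g : ℂ → Dhat} (hg : IsPoly g) (h : ∀ u, u • g u = delta (g u))
    (u : ℂ) : g u = 0 :=
  hg.eq_zero_of_smul_eq (a := 1) (b := 0) one_ne_zero (fun w => by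
    rw [one_mul, zero_mul, zero_add, one_mul, h]) u

/-- On the odd generators, an automorphism that fixes `T⁺` and `T⁻` acts by scalars of `D̂`. -/
lemma exists_genVal_odd_of_fixesT {φ : AutConf} (hT : FixesT φ) :
    ∃ s κ : Dhat, (∀ w M, genVal φ w (inQ M) = (0, 0, 0, 0, 0, s • toMD M)) ∧
      ∀ w M, genVal φ w (inG M) = (0, 0, 0, 0, s • toMD M, κ • toMD M) := by
  have oQ : ∀ w M, genVal φ w (inQ M) = (0, 0, 0, 0, coordG (genVal φ w (inQ M)),
      coordQ (genVal φ w (inQ M))) := fun w M => genVal_odd φ w 0 M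
  have oG : ∀ w M, genVal φ w (inG M) = (0, 0, 0, 0, coordG (genVal φ w (inG M)),
      coordQ (genVal φ w (inG M))) := fun w M => genVal_odd φ w M 0
  have kQ : ∀ u w (X Y : sl2) M, _ := fun u w X Y M =>
    genVal_T_odd_of_fixesT hT u w X Y 0 M (oQ w M)
  have kG : ∀ u w (X Y : sl2) M, _ := fun u w X Y M =>
    genVal_T_odd_of_fixesT hT u w X Y M 0 (oG w M)
  have eQ : ∀ M : M2, ((0, 0, 0, 0, 0, M) : V) = inQ M := fun _ => rfl
  have eG : ∀ M : M2, ((0, 0, 0, 0, M, 0) : V) = inG M := fun _ => rfl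
  simp only [Matrix.mul_zero, Matrix.zero_mul, sub_zero, add_zero, map_zero, smul_zero, eQ,
    eG] at kQ kG
  -- The component of `Q(M)` along `G`.
  obtain ⟨g, hg⟩ := exists_smul_of_equivariant_family (fun w => coordG ∘ₗ genVal φ w ∘ₗ inQ)
    fun u w X Y M => (congrArg coordG (kQ u w X Y M)).symm
  have hg' : ∀ w M, coordG (genVal φ w (inQ M)) = g • toMD M := hg
  have g0 : g = 0 := by
    by_contra hg0
    have hU : ∀ u, (genVal φ u (0, 1, 0, 0, 0, 0)).2.1 = 0 := by
      refine eq_zero_of_smul_eq_delta (isPoly_ev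
        (LinearMap.fst ℂ Dhat (MD × MD × MD × MD) ∘ₗ LinearMap.snd ℂ Dhat _) _) fun u => ?_
      have h := genVal_bracket_even_odd φ u 0 _ _ _ _ _ _ (genVal_U_of_fixesT hT u) (oQ 0 1)
      have z0 : ((0, 0, 0, 0, 0, 0) : V) = 0 := rfl
      simp only [ZeroMemClass.coe_zero, Matrix.mul_zero, Matrix.zero_mul, mul_zero, zero_smul,
        smul_zero, map_zero, sub_zero, add_zero, zero_add, zero_sub, z0, deltaM_zero,
        hg', toMD_one] at h
      have h1 := congrFun (congrFun (congrArg coordQ h) 0) 0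
      change -((_ - _) * (g * 1)) = (0 : Dhat) at h1
      rw [mul_one, neg_eq_zero, mul_eq_zero, or_iff_left hg0, sub_eq_zero] at h1
      exact h1
    have := eq_zero_of_genVal φ (v := (0, 1, 0, 0, 0, 0)) fun w => by
      rw [genVal_U_of_fixesT hT, hU]; rfl
    exact one_ne_zero (congrArg (fun x : V => x.2.1) this)
  simp only [g0, zero_smul] at hg'
  simp only [hg', Matrix.mul_zero, Matrix.zero_mul, smul_zero, add_zero, sub_zero] at kQ
  -- The component of `Q(M)` along `Q`.
  obtain ⟨s, hs⟩ := exists_smul_of_equivariant_family (fun w => coordQ ∘ₗ genVal φ w ∘ₗ inQ)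
    fun u w X Y M => (congrArg coordQ (kQ u w X Y M)).symm
  have hs' : ∀ w M, coordQ (genVal φ w (inQ M)) = s • toMD M := hs
  have hQ : ∀ w M, genVal φ w (inQ M) = (0, 0, 0, 0, 0, s • toMD M) := fun w M => by
    rw [oQ, hg', hs']
  simp only [hQ] at kG
  -- The component of `G(M)` along `G`.
  obtain ⟨γ, hγ⟩ := exists_smul_of_equivariant_family (fun w => coordG ∘ₗ genVal φ w ∘ₗ inG)
    fun u w X Y M => by
      have := congrArg coordG (kG u w X Y M)
      rw [map_add, map_smul] at this
      exact (this.trans ((congrArg _ (smul_zero u)).trans (add_zero _))).symm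
  have hγ' : ∀ w M, coordG (genVal φ w (inG M)) = γ • toMD M := hγ
  simp only [hγ'] at kG
  -- The component of `G(M)` along `Q`.
  have kq : ∀ u w (X Y : sl2) M, toMD X.1 * coordQ (genVal φ w (inG M))
      - coordQ (genVal φ w (inG M)) * toMD Y.1
      + u • (toMD X.1 * (γ • toMD M) + γ • toMD M * toMD Y.1)
      = coordQ (genVal φ (u + w) (inG (X.1 * M - M * Y.1)))
        + u • (s • toMD (X.1 * M + M * Y.1)) := fun u w X Y M => by
    have := congrArg coordQ (kG u w X Y M)
    rw [map_add, map_smul] at this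
    exact this
  have hγs : γ = s := by
    have h1 : ∀ u, _ := fun u => kq u 0 slH 0 1
    have h2 : ∀ u, _ := fun u => kq u 0 0 (-slH) 1
    have hn : (-slH).1 = -slH.1 := rfl
    have tn : toMD (-slH.1) = -toMD slH.1 := by rw [← zero_sub, toMD_sub, toMD_zero, zero_sub]
    simp only [hn, tn, ZeroMemClass.coe_zero, toMD_zero, toMD_one, Matrix.mul_zero, Matrix.zero_mul,
      Matrix.mul_one, Matrix.one_mul, Matrix.mul_neg, Matrix.neg_mul, Matrix.smul_mul,
      Matrix.mul_smul, sub_zero, zero_sub, sub_neg_eq_add, add_zero, zero_add, neg_neg,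
      smul_neg] at h1 h2
    have h10 := h1 0
    have h20 := h2 0
    simp only [zero_smul, neg_zero, add_zero] at h10 h20
    have h3 : (2 : Dhat) • ((γ - s) • toMD slH.1) = 0 := by
      have h11 := h1 1
      have h21 := h2 1
      rw [one_smul, one_smul] at h11 h21
      rw [h10.trans h20.symm] at h11
      linear_combination (norm := module) h11 - h21
    have h4 := congrFun (congrFun h3 0) 0
    rw [toMD_slH] at h4
    change 2 * ((γ - s) * 1) = (0 : Dhat) at h4
    rw [mul_one, mul_eq_zero, or_iff_right Dhat.two_ne_zero, sub_eq_zero] at h4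
    exact h4
  obtain ⟨κ, hκ⟩ := exists_smul_of_equivariant_family (fun w => coordQ ∘ₗ genVal φ w ∘ₗ inG)
    fun u w X Y M => by
      have := kq u w X Y M
      rw [hγs, toMD_add, toMD_mul, toMD_mul, Matrix.mul_smul, Matrix.smul_mul, ← smul_add,
        add_left_inj] at this
      exact this.symm
  have hκ' : ∀ w M, coordQ (genVal φ w (inG M)) = κ • toMD M := hκ
  exact ⟨s, κ, hQ, fun w M => by rw [oG, hγ', hκ', hγs]⟩

lemma skewR_self (M : M2) : skewR M M = 0 := Subtype.ext (sub_self _)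

lemma skewL_self (M : M2) : skewL M M = 0 := Subtype.ext (sub_self _)

lemma trace_one_mul_dag_one {R : Type*} [CommRing R] :
    ((1 : Matrix (Fin 2) (Fin 2) R) * dag 1).trace = -2 := by
  rw [Matrix.one_mul]
  simp [dag, Matrix.trace_fin_two]; ring

/-- The scalar by which an automorphism acts on `U` is the square of its scalar on `Q(M)`, because of
the bracket `[Q(M) _λ G(N)]`. -/
lemma genVal_U_eq_mul_self {φ : AutConf} {s κ : Dhat}
    (hQ : ∀ w M, genVal φ w (inQ M) = (0, 0, 0, 0, 0, s • toMD M))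
    (hG : ∀ w M, genVal φ w (inG M) = (0, 0, 0, 0, s • toMD M, κ • toMD M)) (w : ℂ) :
    (genVal φ w (0, 1, 0, 0, 0, 0)).2.1 = s * s := by
  have h := AutConf.beta_ev φ w 0 (inQ 1) (inG 1)
  have b1 : brConst (inQ 1) (inG 1) = (-4 : ℂ) • (0, 1, 0, 0, 0, 0) := by
    rw [brConst_apply]
    simp [brConstFun, inQ, inG, skewR_self, skewL_self, dag_zero]
    rw [← Matrix.one_mul (dag 1), trace_one_mul_dag_one]; norm_num
  have b2 : brPartial (inQ 1) (inG 1) = 0 := by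
    rw [brPartial_apply]
    simp [brPartialFun, inQ, inG, skewR_zero_left, skewL_zero_left]
  have b3 : brLambda (inQ 1) (inG 1) = 0 := by
    rw [brLambda_apply]
    simp [brLambdaFun, inQ, inG, skewR_zero_left, skewL_zero_left]
  have g0 : gen 0 = 0 := by simp [gen]
  rw [b1, b2, b3, g0, map_zero, map_zero, smul_zero, smul_zero, add_zero, sub_zero, add_zero] at h
  change beta w 0 (genVal φ w (inQ 1)) (genVal φ 0 (inG 1)) = genVal φ w _ at h
  rw [hQ, hG, map_smul] at h
  have h1 := congrArg (fun x : WD => x.2.1) h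
  simp only [beta_Q_odd] at h1
  rw [toMD_one, dag_smul', Matrix.smul_mul, Matrix.mul_smul, Matrix.trace_smul, Matrix.trace_smul,
    trace_one_mul_dag_one] at h1
  change 2 * (s * (s * -2)) = (-4 : ℂ) • (genVal φ w (0, 1, 0, 0, 0, 0)).2.1 at h1
  have h4 : (-4 : ℂ) • (s * s) = (-4 : ℂ) • (genVal φ w (0, 1, 0, 0, 0, 0)).2.1 := by
    rw [← h1, Algebra.smul_def, map_neg, map_ofNat]; ring
  exact (smul_right_injective Dhat (by norm_num : (-4 : ℂ) ≠ 0) h4).symm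

/-- The bracket `[U _λ G(M)] = λ Q(M)` forces the scalar on `Q(M)` to be a sign. -/
lemma mul_self_eq_one_of_fixesT {φ : AutConf} (hT : FixesT φ) {s κ : Dhat}
    (hQ : ∀ w M, genVal φ w (inQ M) = (0, 0, 0, 0, 0, s • toMD M))
    (hG : ∀ w M, genVal φ w (inG M) = (0, 0, 0, 0, s • toMD M, κ • toMD M)) : s * s = 1 := by
  have hU : ∀ w, genVal φ w (0, 1, 0, 0, 0, 0) = (0, s * s, 0, 0, 0, 0) := fun w => by
    rw [genVal_U_of_fixesT hT, genVal_U_eq_mul_self hQ hG]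
  have s0 : s ≠ 0 := by
    rintro rfl
    have := eq_zero_of_genVal φ (v := (0, 1, 0, 0, 0, 0)) fun w => by
      rw [hU, mul_zero]; rfl
    exact one_ne_zero (congrArg (fun x : V => x.2.1) this)
  have hQ' : ∀ w M, genVal φ w (0, 0, 0, 0, 0, M) = (0, 0, 0, 0, 0, s • toMD M) := hQ
  have z0 : ((0, 0, 0, 0, 0, 0) : V) = 0 := rfl
  have h' : ∀ u : ℂ, -((u • (s * s) - delta (s * s)) * s) = -(u • s) := fun u => by
    have h1 := genVal_bracket_even_odd φ u 0 _ _ _ _ _ _ (hU u) (hG 0 1)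
    simp only [ZeroMemClass.coe_zero, Matrix.mul_zero, Matrix.zero_mul, mul_zero, zero_smul,
      smul_zero, map_zero, sub_zero, add_zero, zero_add, zero_sub, one_smul, z0, hQ',
      deltaM_zero, neg_zero, toMD_one] at h1
    have h2 := congrFun (congrFun (congrArg coordQ h1) 0) 0
    change -((u • (s * s) - delta (s * s)) * (s * 1)) = -(u • (s * 1)) at h2
    rwa [mul_one] at h2
  have h0 := h' 0
  have h1 := h' 1
  rw [zero_smul, zero_smul, neg_zero, neg_eq_zero, mul_eq_zero, or_iff_left s0, zero_sub,
    neg_eq_zero] at h0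
  rw [h0, one_smul, one_smul, sub_zero, neg_inj] at h1
  exact mul_right_cancel₀ s0 (h1.trans (one_mul s).symm)

/-- The component along `U` of the image of `L` is read off from the bracket `[L_λ G(M)]`. -/
lemma genVal_L_eq_of_fixesT {φ : AutConf} (hT : FixesT φ) {s κ : Dhat} (hs : s * s = 1)
    (hG : ∀ w M, genVal φ w (inG M) = (0, 0, 0, 0, s • toMD M, κ • toMD M)) (w : ℂ) :
    genVal φ w (1, 0, 0, 0, 0, 0) = (1, s * κ, 0, 0, 0, 0) := by
  have ds : delta s = 0 := by
    rcases mul_self_eq_one_iff.1 hs with rfl | rfl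
    · exact delta.map_one_eq_zero
    · rw [map_neg, delta.map_one_eq_zero, neg_zero]
  have hG' : ∀ w M, genVal φ w (0, 0, 0, 0, M, 0) = (0, 0, 0, 0, s • toMD M, κ • toMD M) := hG
  have hC : ∀ u, s * (genVal φ u (1, 0, 0, 0, 0, 0)).2.1 - κ = 0 := by
    have hp : IsPoly fun u => s * (genVal φ u (1, 0, 0, 0, 0, 0)).2.1 - κ := by
      have := ((isPoly_const s).mul (isPoly_ev (LinearMap.fst ℂ Dhat (MD × MD × MD × MD)
        ∘ₗ LinearMap.snd ℂ Dhat _) (φ.1 (gen (1, 0, 0, 0, 0, 0))))).add (isPoly_const (-κ))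
      simp only [sub_eq_add_neg]
      exact this
    refine eq_zero_of_smul_eq_delta hp fun u => ?_
    have h := genVal_bracket_even_odd φ u 0 _ _ _ _ _ _ (genVal_L_of_fixesT hT u) (hG' 0 1)
    have d1 : deltaM (κ • (1 : MD)) 0 0 = delta κ := by simp [deltaM]
    have e3 : algebraMap ℂ Dhat (3 / 2) = 3 * half := by
      rw [half, ← map_ofNat (algebraMap ℂ Dhat) 3, ← map_mul]; norm_num
    generalize (genVal φ u (1, 0, 0, 0, 0, 0)).2.1 = C at h ⊢
    simp only [ZeroMemClass.coe_zero, Matrix.mul_zero, Matrix.zero_mul, mul_zero, zero_smul,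
      smul_zero, map_zero, sub_zero, add_zero, zero_add, zero_sub, one_smul, mul_one, deltaM_zero,
      Derivation.map_one_eq_zero, hG', toMD_one, toMD_smul, toMD_zero] at h
    have h2 := congrFun (congrFun (congrArg coordQ h) 0) 0
    simp only [coordQ, LinearMap.coe_mk, AddHom.coe_mk, Prod.mk_sub_mk, Prod.smul_mk,
      Prod.mk_add_mk, zero_add, Matrix.add_apply, Matrix.sub_apply, Matrix.smul_apply,
      Matrix.neg_apply, Matrix.one_apply_eq, d1] at h2
    simp only [smul_eq_mul, mul_one, Algebra.smul_def, e3] at h2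
    simp only [map_sub, Derivation.leibniz, ds, smul_eq_mul, mul_zero, add_zero, Algebra.smul_def]
    linear_combination -h2 + 2 * algebraMap ℂ Dhat u * κ * two_mul_half
  rw [genVal_L_of_fixesT hT, ← sub_eq_zero.1 (hC w), ← mul_assoc, hs, one_mul]

/-- An automorphism that fixes `T⁺` and `T⁻` is `τ_f`, up to the sign of its action on the odd
generators. -/
lemma exists_genVal_of_fixesT {φ : AutConf} (hT : FixesT φ) :
    ∃ s f : Dhat, (s = 1 ∨ s = -1) ∧ ∀ w l c X Y M N, genVal φ w (l, c, X, Y, M, N)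
      = (algebraMap ℂ Dhat l, algebraMap ℂ Dhat c + algebraMap ℂ Dhat l * f, toMD X.1, toMD Y.1,
        s • toMD M, s • toMD N + f • s • toMD M) := by
  obtain ⟨s, κ, hQ, hG⟩ := exists_genVal_odd_of_fixesT hT
  have ss := mul_self_eq_one_of_fixesT hT hQ hG
  refine ⟨s, s * κ, mul_self_eq_one_iff.1 ss, fun w l c X Y M N => ?_⟩
  have e : ((l, c, X, Y, M, N) : V) = l • (1, 0, 0, 0, 0, 0) + c • (0, 1, 0, 0, 0, 0)
      + (0, 0, X, Y, 0, 0) + inG M + inQ N := by simp [inG, inQ]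
  have hTw : genVal φ w (0, 0, X, Y, 0, 0) = (0, 0, toMD X.1, toMD Y.1, 0, 0) := hT w X Y
  rw [e, map_add, map_add, map_add, map_add, map_smul, map_smul, genVal_L_eq_of_fixesT hT ss hG,
    genVal_U_of_fixesT hT, genVal_U_eq_mul_self hQ hG, hTw, hG, hQ, ss, smul_smul, mul_right_comm,
    ss, one_mul]
  refine Prod.ext ?_ (Prod.ext ?_ (Prod.ext ?_ (Prod.ext ?_ (Prod.ext ?_ ?_))))
  · simp [Algebra.smul_def (A := Dhat)]
  · simp [Algebra.smul_def (A := Dhat)]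
    rw [add_comm]
  · simp
  · simp
  · simp
  · simp
    rw [add_comm]

lemma deltaM_neg_one : deltaM (-1) = 0 := by
  ext i j : 1; fin_cases i <;> fin_cases j <;> simp [deltaM]

/-- The automorphisms that fix `T⁺` and `T⁻` are the `θ_{±1, 1} τ_f`. -/
lemma exists_eq_xiAut_of_fixesT {φ : AutConf} (hT : FixesT φ) :
    ∃ (A : SLD) (f : Dhat), φ = xiAut A 1 f := by
  obtain ⟨s, f, hs, h⟩ := exists_genVal_of_fixesT hT
  obtain ⟨A, hA, hA', hd⟩ : ∃ A : SLD, A.1 = s • (1 : MD) ∧ (A⁻¹).1 = s • (1 : MD) ∧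
      logDer A = 0 := by
    rcases hs with rfl | rfl
    · exact ⟨1, by simp, by simp, logDer_one⟩
    · refine ⟨-1, by simp, by simp, ?_⟩
      rw [logDer, Matrix.SpecialLinearGroup.coe_neg, Matrix.SpecialLinearGroup.coe_one,
        deltaM_neg_one, Matrix.zero_mul]
  have ss : s * s = 1 := mul_self_eq_one_iff.2 hs
  refine ⟨A, f, AutConf.ext_gen fun v => LargeN4.ev_ext fun w => ?_⟩
  obtain ⟨l, c, X, Y, M, N⟩ := v
  rw [ev_xiAut, ev_gen, iota_apply, xi_mk, hA, hA', hd, logDer_one]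
  refine (h w l c X Y M N).trans ?_
  simp [smul_smul, ss]

/-- Every automorphism is of the form `ω ^ e θ_{A,B} τ_f`. -/
theorem AutConf.exists_eq (φ : AutConf) :
    ∃ (A B : SLD) (f : Dhat), φ = xiAut A B f ∨ φ = omAut * xiAut A B f := by
  have key : ∀ (φ : AutConf) (A B : SLD), (∀ w X Y, genVal φ w (0, 0, X, Y, 0, 0)
      = (0, 0, A.1 * toMD X.1 * (A⁻¹).1, B.1 * toMD Y.1 * (B⁻¹).1, 0, 0)) →
      ∃ (A B : SLD) (f : Dhat), φ = xiAut A B f := fun φ A B h => by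
    obtain ⟨S, f, hS⟩ := exists_eq_xiAut_of_fixesT (φ := xiAut A⁻¹ B⁻¹ 0 * φ) fun w X Y => by
      have e : genVal (xiAut A⁻¹ B⁻¹ 0 * φ) w (0, 0, X, Y, 0, 0)
          = xi A⁻¹ B⁻¹ 0 (genVal φ w (0, 0, X, Y, 0, 0)) := ev_xiAut _ _ _ w _
      rw [e, h, xi_mk, inv_inv, inv_inv]
      simp only [Matrix.mul_assoc, SLD.inv_mul_cancel_assoc, SLD.inv_mul_coe, Matrix.mul_one]
      simp
    refine ⟨A * S, B, f, ?_⟩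
    have h1 : xiAut A B 0 * (xiAut A⁻¹ B⁻¹ 0 * φ) = φ := by
      rw [← mul_assoc, xiAut_mul, mul_inv_cancel, mul_inv_cancel, add_zero, xiAut_one, one_mul]
    rw [← h1, hS, xiAut_mul, mul_one, zero_add]
  rcases genVal_T φ with ⟨A, B, h⟩ | ⟨A, B, h⟩
  · obtain ⟨A, B, f, h1⟩ := key φ A B h
    exact ⟨A, B, f, Or.inl h1⟩
  · obtain ⟨A, B, f, h1⟩ := key (omAut * φ) B A fun w X Y => by
      have e : genVal (omAut * φ) w (0, 0, X, Y, 0, 0)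
          = om (genVal φ w (0, 0, X, Y, 0, 0)) := ev_omAut w _
      rw [e, h, om_mk]
      simp [dag_zero]
    exact ⟨A, B, f, Or.inr (by rw [← h1, ← mul_assoc, omAut_mul_self, one_mul])⟩

/-! ### The group isomorphism -/

/-- The homomorphism `(A, B) ↦ θ_{A,B}`. -/
def thetaHom : SLD × SLD →* AutConf where
  toFun g := xiAut g.1 g.2 0
  map_one' := xiAut_one
  map_mul' g h := by rw [xiAut_mul, add_zero]; rfl

/-- The homomorphism `f ↦ τ_f`. -/
def tauHom : Multiplicative Dhat →* AutConf where
  toFun f := xiAut 1 1 f.toAdd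
  map_one' := xiAut_one
  map_mul' f g := by rw [xiAut_mul, mul_one]; rfl

lemma xiAut_neg_one : xiAut (-1) (-1) 0 = 1 := by
  have h : logDer (-1) = 0 := by
    rw [logDer, Matrix.SpecialLinearGroup.coe_neg, Matrix.SpecialLinearGroup.coe_one,
      deltaM_neg_one, Matrix.zero_mul]
  refine AutConf.ext_ev fun w x => ?_
  rw [ev_xiAut]
  change _ = ev w x
  obtain ⟨l, c, X, Y, M, N⟩ := ev w x
  rw [xi_mk, h]
  simp

/-- The homomorphism `([A, B], f) ↦ θ_{A,B} τ_f`. -/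
def normalHom : NormalPart →* AutConf :=
  MonoidHom.noncommCoprod
    (QuotientGroup.lift negI thetaHom (by
      rw [negI, Subgroup.zpowers_le]
      exact xiAut_neg_one)) tauHom
    (by
      rintro x f
      obtain ⟨⟨A, B⟩, rfl⟩ := QuotientGroup.mk_surjective x
      change xiAut A B 0 * xiAut 1 1 f.toAdd = xiAut 1 1 f.toAdd * xiAut A B 0
      rw [xiAut_mul, xiAut_mul, add_comm]
      simp only [mul_one, one_mul])

lemma normalHom_mk (A B : SLD) (f : Dhat) :
    normalHom (QuotientGroup.mk (A, B), Multiplicative.ofAdd f) = xiAut A B f := by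
  change xiAut A B 0 * xiAut 1 1 f = _
  rw [xiAut_mul, mul_one, mul_one, zero_add]

lemma exists_normalPart_eq (x : NormalPart) :
    ∃ (A B : SLD) (f : Dhat), x = (QuotientGroup.mk (A, B), Multiplicative.ofAdd f) := by
  obtain ⟨⟨A, B⟩, h⟩ := QuotientGroup.mk_surjective x.1
  exact ⟨A, B, x.2.toAdd, Prod.ext h.symm rfl⟩

/-- The homomorphism `ℤ/2ℤ → Aut` that maps the generator to `ω`. -/
def omHom : Multiplicative (ZMod 2) →* AutConf where
  toFun e := omAut ^ (Multiplicative.toAdd e).val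
  map_one' := by simp
  map_mul' a b := by
    rw [toAdd_mul, ZMod.val_add, ← pow_add]
    exact (pow_eq_pow_mod _ (by rw [sq, omAut_mul_self])).symm

lemma omHom_generator : omHom (Multiplicative.ofAdd 1) = omAut := pow_one omAut

lemma eq_one_or_eq_generator (e : Multiplicative (ZMod 2)) :
    e = 1 ∨ e = Multiplicative.ofAdd 1 := by
  revert e; decide

lemma normalHom_sigma (x : NormalPart) :
    normalHom (sigma x) = omAut * normalHom x * omAut⁻¹ := by
  obtain ⟨A, B, f, rfl⟩ := exists_normalPart_eq x
  refine (congrArg normalHom (sigma_apply A B f)).trans ?_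
  rw [normalHom_mk A B f, omAut_mul_xiAut, mul_inv_cancel_right]
  exact normalHom_mk B A (-f)

lemma normalHom_action_apply (e : Multiplicative (ZMod 2)) (x : NormalPart) :
    normalHom (action e x) = omHom e * normalHom x * (omHom e)⁻¹ := by
  rcases eq_one_or_eq_generator e with rfl | rfl
  · have h1 : action 1 x = x := by rw [map_one action, MulAut.one_apply]
    have h2 : omHom 1 = 1 := map_one omHom
    rw [h1, h2, one_mul, inv_one, mul_one]
  · have h1 : action (Multiplicative.ofAdd 1) x = sigma x :=
      congrArg (fun g : MulAut NormalPart => g x) action_generator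
    exact (congrArg normalHom h1).trans ((normalHom_sigma x).trans
      (congrArg (fun g => g * normalHom x * g⁻¹) omHom_generator.symm))

/-- The homomorphism `([A, B], f, e) ↦ θ_{A,B} τ_f ω ^ e`. -/
def targetHom : TargetGroup →* AutConf :=
  SemidirectProduct.lift normalHom omHom fun e => MonoidHom.ext (normalHom_action_apply e)

lemma targetHom_targetSL (A B : SLD) : targetHom (targetSL A B) = xiAut A B 0 := by
  rw [targetHom, targetSL, SemidirectProduct.lift_inl]
  exact normalHom_mk A B 0

lemma targetHom_targetAdd (f : Dhat) : targetHom (targetAdd f) = xiAut 1 1 f := by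
  rw [targetHom, targetAdd, SemidirectProduct.lift_inl]
  exact normalHom_mk 1 1 f

lemma targetHom_targetInv : targetHom targetInv = omAut := by
  rw [targetHom, targetInv, SemidirectProduct.lift_inr, omHom_generator]

lemma targetHom_surjective : Function.Surjective targetHom := by
  intro φ
  have h : ∀ A B f, targetHom (SemidirectProduct.inl (QuotientGroup.mk (A, B),
      Multiplicative.ofAdd f)) = xiAut A B f := fun A B f => by
    rw [targetHom, SemidirectProduct.lift_inl, normalHom_mk]
  obtain ⟨A, B, f, rfl | rfl⟩ := AutConf.exists_eq φ
  · exact ⟨_, h A B f⟩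
  · exact ⟨targetInv * SemidirectProduct.inl (QuotientGroup.mk (A, B), Multiplicative.ofAdd f), by
      rw [map_mul, targetHom_targetInv, h A B f]⟩

/-- If `θ_{A,B} τ_f` is the identity, then `f = 0` and `(A, B) = ± (1, 1)`. -/
lemma mem_negI_of_xiAut_eq_one {A B : SLD} {f : Dhat} (h : xiAut A B f = 1) :
    f = 0 ∧ (A, B) ∈ negI := by
  have hx : ∀ v : V, xi A B f (iota v) = iota v := fun v => by
    have := ev_xiAut A B f 0 (gen v)
    rw [h, ev_gen] at this
    exact this.symm.trans (ev_gen 0 v)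
  have hf : f = 0 := by
    have h1 := congrArg (fun x : WD => x.2.1) (hx (1, 0, 0, 0, 0, 0))
    change algebraMap ℂ Dhat 0 + algebraMap ℂ Dhat 1 * f = algebraMap ℂ Dhat 0 at h1
    rwa [map_zero, map_one, one_mul, zero_add] at h1
  refine ⟨hf, ?_⟩
  -- `A` commutes with `sl₂`, and `A = B`.
  have hA : ∀ X : sl2, A.1 * toMD X.1 = toMD X.1 * A.1 := fun X => by
    have h1 := congrArg coordTp (hx (0, 0, X, 0, 0, 0))
    change A.1 * toMD X.1 * (A⁻¹).1 + algebraMap ℂ Dhat 0 • logDer A = toMD X.1 at h1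
    rw [map_zero, zero_smul, add_zero] at h1
    have h2 := congrArg (· * A.1) h1
    simp only [Matrix.mul_assoc, SLD.inv_mul_coe, Matrix.mul_one] at h2
    exact h2
  have hB : A = B := by
    have h1 := congrArg coordG (hx (0, 0, 0, 0, 1, 0))
    change A.1 * toMD 1 * (B⁻¹).1 = toMD 1 at h1
    rw [toMD_one, Matrix.mul_one] at h1
    have h2 : A * B⁻¹ = 1 := Subtype.ext h1
    exact mul_inv_eq_one.1 h2
  have hE := hA slE
  have hF := hA slF
  rw [toMD_slE] at hE
  rw [toMD_slF] at hF
  have e1 := congrFun (congrFun hE 0) 0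
  have e2 := congrFun (congrFun hE 0) 1
  have e3 := congrFun (congrFun hF 0) 0
  simp [Matrix.mul_apply, Fin.sum_univ_two] at e1 e2 e3
  have hd := A.2
  rw [Matrix.det_fin_two] at hd
  have hs : A.1 0 0 = 1 ∨ A.1 0 0 = -1 := mul_self_eq_one_iff.1 (by
    linear_combination hd + A.1 0 0 * e2 - A.1 0 1 * e1)
  have hA' : A = 1 ∨ A = -1 := by
    refine hs.imp (fun hs => ?_) (fun hs => ?_) <;>
    · apply Subtype.ext
      ext i j : 1
      fin_cases i <;> fin_cases j <;> simp [← e2, ← e1, e3, hs]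
  rw [← hB]
  rcases hA' with rfl | rfl
  · exact one_mem _
  · exact Subgroup.mem_zpowers _

lemma omAut_ne_xiAut (A B : SLD) (f : Dhat) : xiAut A B f * omAut ≠ 1 := fun h => by
  have h1 : xi A B f (om (iota (0, 1, 0, 0, 0, 0))) = iota (0, 1, 0, 0, 0, 0) := by
    have h2 : ev 0 ((xiAut A B f * omAut).1 (gen (0, 1, 0, 0, 0, 0)))
        = xi A B f (om (iota (0, 1, 0, 0, 0, 0))) := by
      refine (ev_xiAut A B f 0 _).trans (congrArg _ ?_)
      exact (ev_omAut 0 _).trans (congrArg _ (ev_gen 0 _))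
    rw [← h2, h]
    exact ev_gen 0 _
  have h3 := congrArg (fun x : WD => x.2.1) h1
  change -algebraMap ℂ Dhat 1 + algebraMap ℂ Dhat 0 * f = algebraMap ℂ Dhat 1 at h3
  rw [map_zero, zero_mul, add_zero, map_one] at h3
  exact Dhat.two_ne_zero (by linear_combination -h3)

lemma targetHom_injective : Function.Injective targetHom := by
  rw [injective_iff_map_eq_one]
  rintro ⟨n, e⟩ h
  change normalHom n * omHom e = 1 at h
  obtain ⟨A, B, f, rfl⟩ := exists_normalPart_eq n
  rw [normalHom_mk] at h
  rcases eq_one_or_eq_generator e with rfl | rfl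
  · have h2 : omHom 1 = 1 := map_one omHom
    rw [h2, mul_one] at h
    obtain ⟨rfl, hm⟩ := mem_negI_of_xiAut_eq_one h
    have h3 : (QuotientGroup.mk (A, B) : SLQuot) = 1 := (QuotientGroup.eq_one_iff _).2 hm
    rw [h3]
    rfl
  · exact absurd h (omAut_ne_xiAut A B f)

/-- The isomorphism of the semidirect product with the automorphism group. -/
def targetEquiv : TargetGroup ≃* AutConf :=
  MulEquiv.ofBijective targetHom ⟨targetHom_injective, targetHom_surjective⟩

lemma targetEquiv_apply (g : TargetGroup) : targetEquiv g = targetHom g := rfl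

lemma isTheta_iff (A B : SLD) (φ : AutConf) : IsTheta A B φ ↔ φ = xiAut A B 0 := by
  have h' := isTheta_xiAut A B
  refine ⟨fun h => AutConf.ext_generators (h.map_L.trans h'.map_L.symm)
    (h.map_U.trans h'.map_U.symm) (fun X => (h.map_Tp X).trans (h'.map_Tp X).symm)
    (fun X => (h.map_Tm X).trans (h'.map_Tm X).symm)
    (fun M => (h.map_G M).trans (h'.map_G M).symm)
    (fun M => (h.map_Q M).trans (h'.map_Q M).symm), ?_⟩
  rintro rfl
  exact h'

lemma isTau_iff (f : Dhat) (φ : AutConf) : IsTau f φ ↔ φ = xiAut 1 1 f := by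
  have h' := isTau_xiAut f
  refine ⟨fun h => AutConf.ext_generators (h.map_L.trans h'.map_L.symm)
    (h.map_U.trans h'.map_U.symm) (fun X => (h.map_Tp X).trans (h'.map_Tp X).symm)
    (fun X => (h.map_Tm X).trans (h'.map_Tm X).symm)
    (fun M => (h.map_G M).trans (h'.map_G M).symm)
    (fun M => (h.map_Q M).trans (h'.map_Q M).symm), ?_⟩
  rintro rfl
  exact h'

lemma isOmega_iff (φ : AutConf) : IsOmega φ ↔ φ = omAut := by
  have h' := isOmega_omAut
  refine ⟨fun h => AutConf.ext_generators (h.map_L.trans h'.map_L.symm)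
    (h.map_U.trans h'.map_U.symm) (fun X => (h.map_Tp X).trans (h'.map_Tp X).symm)
    (fun X => (h.map_Tm X).trans (h'.map_Tm X).symm)
    (fun M => (h.map_G M).trans (h'.map_G M).symm)
    (fun M => (h.map_Q M).trans (h'.map_Q M).symm), ?_⟩
  rintro rfl
  exact h'

lemma closure_generators : Subgroup.closure
    ({φ : AutConf | ∃ A B : SLD, IsTheta A B φ} ∪ {φ : AutConf | ∃ f : Dhat, IsTau f φ} ∪
      {φ : AutConf | IsOmega φ}) = ⊤ := by
  rw [eq_top_iff]
  rintro φ -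
  have hx : ∀ A B f, xiAut A B f ∈ Subgroup.closure
      ({φ : AutConf | ∃ A B : SLD, IsTheta A B φ} ∪ {φ : AutConf | ∃ f : Dhat, IsTau f φ} ∪
        {φ : AutConf | IsOmega φ}) := fun A B f => by
    have e : xiAut A B f = xiAut A B 0 * xiAut 1 1 f := by
      rw [xiAut_mul, mul_one, mul_one, zero_add]
    rw [e]
    exact mul_mem (Subgroup.subset_closure (Or.inl (Or.inl ⟨A, B, isTheta_xiAut A B⟩)))
      (Subgroup.subset_closure (Or.inl (Or.inr ⟨f, isTau_xiAut f⟩)))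
  obtain ⟨A, B, f, rfl | rfl⟩ := AutConf.exists_eq φ
  · exact hx A B f
  · exact mul_mem (Subgroup.subset_closure (Or.inr isOmega_omAut)) (hx A B f)

end LargeN4

end

theorem mainTheorem1 :
    ∃ Φ : LargeN4.TargetGroup ≃* LargeN4.AutConf,
      (∀ (A B : LargeN4.SLD) (φ : LargeN4.AutConf),
        LargeN4.IsTheta A B φ ↔ φ = Φ (LargeN4.targetSL A B)) ∧
      (∀ (f : LargeN4.Dhat) (φ : LargeN4.AutConf),
        LargeN4.IsTau f φ ↔ φ = Φ (LargeN4.targetAdd f)) ∧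
      (∀ φ : LargeN4.AutConf, LargeN4.IsOmega φ ↔ φ = Φ LargeN4.targetInv) ∧
      Subgroup.closure
        ({φ : LargeN4.AutConf | ∃ A B : LargeN4.SLD, LargeN4.IsTheta A B φ} ∪
          {φ : LargeN4.AutConf | ∃ f : LargeN4.Dhat, LargeN4.IsTau f φ} ∪
          {φ : LargeN4.AutConf | LargeN4.IsOmega φ}) = ⊤ := by
  refine ⟨LargeN4.targetEquiv, fun A B φ => ?_, fun f φ => ?_, fun φ => ?_,
    LargeN4.closure_generators⟩
  · rw [LargeN4.isTheta_iff, LargeN4.targetEquiv_apply, LargeN4.targetHom_targetSL]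
  · rw [LargeN4.isTau_iff, LargeN4.targetEquiv_apply, LargeN4.targetHom_targetAdd]
  · rw [LargeN4.isOmega_iff, LargeN4.targetEquiv_apply, LargeN4.targetHom_targetInv]
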